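/- Let $G$ be a split real form of a complex simple Lie group $G^{\mathbb C}$ of adjoint type, with Lie algebra $\mathfrak g$. Let $\mathsf B$ be an $\operatorname{Ad}_G$-invariant nondegenerate symmetric bilinear form on $\mathfrak g$ and $\theta$ a Cartan involution of $\mathfrak g$, i.e. an involutive automorphism for which $-\mathsf B(\cdot,\theta\,\cdot)$ is symmetric and positive definite; let $\mathfrak g=\mathfrak k\oplus\mathfrak p$ be its decomposition into $\pm1$-eigenspaces, $K$ the analytic subgroup of $G$ with Lie algebra $\mathfrak k$, and $\mathfrak a\subset\mathfrak p$ a maximal abelian subalgebra (that $G$ is split means that the centralizer of $\mathfrak a$ in $\mathfrak g$ is $\mathfrak a$). Choose an ordering of $\mathfrak a^*$, let $\Delta$ be the corresponding set of simple restricted roots, and put $\mathfrak a^+=\{A\in\mathfrak a : \beta(A)>0 \text{ for all } \beta\in\Delta\}$. Let $W=N_K(\mathfrak a)/Z_K(\mathfrak a)$ be the Weyl group, and let $w_0\in W$ be its longest element, with respect to word length in the simple reflections. The Jordan projection $\lambda(x)\in\overline{\mathfrak a^+}$ of $x\in G$ is defined by the requirement that $x=x_kx_hx_u$ with pairwise commuting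 $x_k,x_h,x_u\in G$, where $x_k$ is conjugate in $G$ into $K$, $x_h$ is conjugate in $G$ to $\exp\lambda(x)$, and $x_u$ is unipotent. Let $U\subset G$ be the set of purely loxodromic elements, i.e. those conjugate in $G$ into $\exp\mathfrak a^+$; on $U$ the Jordan projection is well defined. Let $\alpha\in\mathfrak a^*$ be a linear functional and let $f:=\alpha\circ\lambda:U\to\mathbb R$. Then: (i) $f$ is a real analytic invariant function; that is, $U$ is a nonempty open subset of $G$ that is invariant under conjugation, $f$ is real analytic on $U$, and $f(yxy^{-1})=f(x)$ for all $x\in U$, $y\in G$. (ii) $f$ is homogeneous: $f(x^k)=k f(x)$ for all $x\in U$ and all integers $k\ge 1$ with $x^k\in U$. (iii) Let $\widehat f:U\to\mathfrak g$ be the Goldman function of $f$: $\widehat f(x)$ is the unique element of $\mathfrak g$ with $$\mathsf B(\widehat f(x),Y)=\left.\frac{d}{dt}\right|_{t=0} f(x\exp tY)\qquad\text{for all } Y\in\mathfrak g .$$ It exists, and for every $x\in\exp\mathfrak a^+$ one has $x^{-1}\in U$ and $$\widehat f(x)=\alpha^\vee,\qquad \widehat f(x^{-1})=w_0\,\alpha^\vee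 ,$$ where $\alpha^\vee$ is the unique element of $\mathfrak a$ with $\mathsf B(\alpha^\vee,Y)=\alpha(Y)$ for all $Y\in\mathfrak a$. -/

import Mathlib

open scoped TensorProduct

namespace GoldmanLie

noncomputable section

/-! ### The adjoint group

A Lie group of adjoint type is identified with its image under the (faithful) adjoint
representation, so it is a group of linear automorphisms of its Lie algebra `L`. Under this
identification the exponential map is `X ↦ exp (ad X)`, and `Ad` of a group element `g`
is `g` itself, acting on `L`. -/

/-- The linear map `exp (ad X)`, computed as a matrix exponential (the result does not depend on
the basis). -/
def expAdLin (𝕜 : Type*) [RCLike 𝕜] {L : Type*} [LieRing L] [LieAlgebra 𝕜 L]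
    [FiniteDimensional 𝕜 L] (X : L) : L →ₗ[𝕜] L :=
  Matrix.toLin (Module.finBasis 𝕜 L) (Module.finBasis 𝕜 L)
    (NormedSpace.exp
      (LinearMap.toMatrix (Module.finBasis 𝕜 L) (Module.finBasis 𝕜 L) (LieAlgebra.ad 𝕜 L X)))

theorem matrix_exp_mul_exp_neg {𝕜 : Type*} [RCLike 𝕜] {n : ℕ} (M : Matrix (Fin n) (Fin n) 𝕜) :
    NormedSpace.exp M * NormedSpace.exp (-M) = 1 := by
  rw [← Matrix.exp_add_of_commute M (-M) (Commute.neg_right (Commute.refl M)), add_neg_cancel,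
    NormedSpace.exp_zero]

theorem expAdLin_comp_neg (𝕜 : Type*) [RCLike 𝕜] {L : Type*} [LieRing L] [LieAlgebra 𝕜 L]
    [FiniteDimensional 𝕜 L] (X : L) :
    (expAdLin 𝕜 X).comp (expAdLin 𝕜 (-X)) = LinearMap.id := by
  have hneg : LinearMap.toMatrix (Module.finBasis 𝕜 L) (Module.finBasis 𝕜 L)
      (LieAlgebra.ad 𝕜 L (-X)) = -LinearMap.toMatrix (Module.finBasis 𝕜 L)
      (Module.finBasis 𝕜 L) (LieAlgebra.ad 𝕜 L X) := by
    ext i j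
    rw [Matrix.neg_apply, LinearMap.toMatrix_apply, LinearMap.toMatrix_apply, LieAlgebra.ad_apply,
      LieAlgebra.ad_apply, neg_lie, map_neg, Finsupp.neg_apply]
  unfold expAdLin
  rw [hneg]
  generalize LinearMap.toMatrix (Module.finBasis 𝕜 L) (Module.finBasis 𝕜 L)
    (LieAlgebra.ad 𝕜 L X) = M
  rw [← Matrix.toLin_mul, matrix_exp_mul_exp_neg, Matrix.toLin_one]

/-- The exponential map `X ↦ exp (ad X)` of the adjoint group of `L`. -/
def expAd (𝕜 : Type*) [RCLike 𝕜] {L : Type*} [LieRing L] [LieAlgebra 𝕜 L]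
    [FiniteDimensional 𝕜 L] (X : L) : L ≃ₗ[𝕜] L :=
  LinearEquiv.ofLinearMap (expAdLin 𝕜 X) (expAdLin 𝕜 (-X)) (expAdLin_comp_neg 𝕜 X)
    (by simpa using expAdLin_comp_neg 𝕜 (-X))

/-- `Int L`, the connected Lie group of adjoint type with (semisimple) Lie algebra `L`: the
group of automorphisms of `L` generated by the `exp (ad X)`. -/
def innerGroup (𝕜 : Type*) [RCLike 𝕜] (L : Type*) [LieRing L] [LieAlgebra 𝕜 L]
    [FiniteDimensional 𝕜 L] : Subgroup (L ≃ₗ[𝕜] L) :=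
  Subgroup.closure (Set.range (expAd 𝕜 (L := L)))

variable {𝔤 : Type*} [LieRing 𝔤] [LieAlgebra ℝ 𝔤] [FiniteDimensional ℝ 𝔤]

/-- `G` is a real form, with Lie algebra `𝔤`, of the complex adjoint group `Int (ℂ ⊗ 𝔤)`:
a group of real points of the complex group (a real point being a real linear automorphism of
`𝔤` whose complexification lies in the complex group) which contains `exp 𝔤`.
So `G` lies between the identity component `Int 𝔤` and the group of all real points, as
`PSL_n(ℝ)` and `PGL_n(ℝ)` do for `𝔤 = 𝔰𝔩_n(ℝ)`. -/
structure IsRealForm (G : Subgroup (𝔤 ≃ₗ[ℝ] 𝔤)) : Prop where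
  expAd_mem : ∀ X : 𝔤, expAd ℝ X ∈ G
  baseChange_mem : ∀ x ∈ G, LinearEquiv.baseChange ℝ ℂ 𝔤 𝔤 x ∈ innerGroup ℂ (ℂ ⊗[ℝ] 𝔤)

/-- The usual topology on the linear automorphisms of `𝔤`, induced from that of the
finite-dimensional vector space `End 𝔤`. -/
abbrev autTopology (𝔤 : Type*) [LieRing 𝔤] [LieAlgebra ℝ 𝔤] : TopologicalSpace (𝔤 ≃ₗ[ℝ] 𝔤) :=
  TopologicalSpace.induced (fun x => (x : 𝔤 →ₗ[ℝ] 𝔤)) (moduleTopology ℝ (𝔤 →ₗ[ℝ] 𝔤))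

/-- `U ⊆ G`, and `U` is open in `G`. -/
def IsOpenIn (G : Subgroup (𝔤 ≃ₗ[ℝ] 𝔤)) (U : Set (𝔤 ≃ₗ[ℝ] 𝔤)) : Prop :=
  ∃ O : Set (𝔤 ≃ₗ[ℝ] 𝔤), @IsOpen _ (autTopology 𝔤) O ∧ U = O ∩ (G : Set (𝔤 ≃ₗ[ℝ] 𝔤))

/-- The function `f` read in the exponential chart `Y ↦ x exp Y` of the Lie group around `x`,
with linear coordinates on `𝔤`. Only values of `f` on the coset `x G = G` occur. -/
def inChart (f : (𝔤 ≃ₗ[ℝ] 𝔤) → ℝ) (x : 𝔤 ≃ₗ[ℝ] 𝔤) :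
    (Fin (Module.finrank ℝ 𝔤) → ℝ) → ℝ :=
  fun v => f (x * expAd ℝ ((Module.finBasis ℝ 𝔤).equivFun.symm v))

/-! ### Invariant functions and Goldman functions -/

/-- `f`, restricted to `U`, is an invariant function: `U` is a nonempty conjugation-invariant open
subset of `G`, and `f` is differentiable and conjugation-invariant on `U`. -/
structure IsInvariantFunction (G : Subgroup (𝔤 ≃ₗ[ℝ] 𝔤)) (U : Set (𝔤 ≃ₗ[ℝ] 𝔤))
    (f : (𝔤 ≃ₗ[ℝ] 𝔤) → ℝ) : Prop where
  nonempty : U.Nonempty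
  isOpen : IsOpenIn G U
  conj_mem : ∀ y ∈ G, ∀ x ∈ U, y * x * y⁻¹ ∈ U
  differentiable : ∀ x ∈ U, DifferentiableAt ℝ (inChart f x) 0
  conj_eq : ∀ y ∈ G, ∀ x ∈ U, f (y * x * y⁻¹) = f x

/-- `f` is real analytic on `U` (an open subset of the Lie group). -/
def IsRealAnalyticOn (U : Set (𝔤 ≃ₗ[ℝ] 𝔤)) (f : (𝔤 ≃ₗ[ℝ] 𝔤) → ℝ) : Prop :=
  ∀ x ∈ U, AnalyticAt ℝ (inChart f x) 0

/-- `f(x^k) = k f(x)` whenever `x, x^k ∈ U`, `k ≥ 1`. -/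
def IsHomogeneousOn (U : Set (𝔤 ≃ₗ[ℝ] 𝔤)) (f : (𝔤 ≃ₗ[ℝ] 𝔤) → ℝ) : Prop :=
  ∀ x ∈ U, ∀ k : ℕ, 0 < k → x ^ k ∈ U → f (x ^ k) = k * f x

/-- `Z` is a value of the Goldman function of `f` at `x`:
`B(Z, Y) = d/dt|_{t=0} f(x exp tY)` for all `Y`, where the derivatives exist. -/
def IsGoldmanValue (B : LinearMap.BilinForm ℝ 𝔤) (f : (𝔤 ≃ₗ[ℝ] 𝔤) → ℝ)
    (x : 𝔤 ≃ₗ[ℝ] 𝔤) (Z : 𝔤) : Prop :=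
  ∀ Y : 𝔤, HasDerivAt (fun t : ℝ => f (x * expAd ℝ (t • Y))) (B Z Y) 0

/-! ### Cartan involution, restricted roots, Weyl chamber -/

/-- `θ` is a Cartan involution: an involutive automorphism of `𝔤` for which
`B_θ(X, Y) = -B(X, θ Y)` is symmetric and positive definite. -/
structure IsCartanInvolution (B : LinearMap.BilinForm ℝ 𝔤) (θ : 𝔤 ≃ₗ⁅ℝ⁆ 𝔤) : Prop where
  involutive : ∀ X, θ (θ X) = X
  symm : ∀ X Y, -B X (θ Y) = -B Y (θ X)
  pos : ∀ X, X ≠ 0 → 0 < -B X (θ X)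

/-- `𝔞` is a maximal abelian subalgebra in the `-1` eigenspace `𝔭` of `θ`. -/
def IsMaximalAbelian (θ : 𝔤 ≃ₗ⁅ℝ⁆ 𝔤) (𝔞 : Submodule ℝ 𝔤) : Prop :=
  Maximal (fun s : Submodule ℝ 𝔤 =>
    (∀ X ∈ s, θ X = -X) ∧ ∀ X ∈ s, ∀ Y ∈ s, ⁅X, Y⁆ = 0) 𝔞

/-- The real form is split: the maximal abelian subalgebra `𝔞` of `𝔭` is its own centralizer in
`𝔤`, i.e. `𝔭` contains a Cartan subalgebra of `𝔤`. -/
def IsSplit (𝔞 : Submodule ℝ 𝔤) : Prop :=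
  ∀ X : 𝔤, (∀ A ∈ 𝔞, ⁅A, X⁆ = 0) → X ∈ 𝔞

variable {𝔞 : Submodule ℝ 𝔤}

/-- `β` is a restricted root of `(𝔤, 𝔞)`. -/
def IsRoot (β : Module.Dual ℝ 𝔞) : Prop :=
  β ≠ 0 ∧ ∃ X : 𝔤, X ≠ 0 ∧ ∀ A : 𝔞, ⁅(A : 𝔤), X⁆ = β A • X

/-- A notion of positivity on `𝔞*` (equivalently a total vector space ordering); `P` is the set of
positive functionals. -/
structure IsPositivity (P : Set (Module.Dual ℝ 𝔞)) : Prop where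
  zero_notMem : 0 ∉ P
  pos_or_neg : ∀ φ, φ ≠ 0 → (φ ∈ P ∨ -φ ∈ P)
  add_mem : ∀ φ ∈ P, ∀ ψ ∈ P, φ + ψ ∈ P
  smul_mem : ∀ c : ℝ, 0 < c → ∀ φ ∈ P, c • φ ∈ P

/-- `β` is a simple root: a positive root which is not a sum of two positive roots. -/
def IsSimpleRoot (P : Set (Module.Dual ℝ 𝔞)) (β : Module.Dual ℝ 𝔞) : Prop :=
  IsRoot β ∧ β ∈ P ∧
    ¬ ∃ γ δ : Module.Dual ℝ 𝔞, IsRoot γ ∧ γ ∈ P ∧ IsRoot δ ∧ δ ∈ P ∧ β = γ + δ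

/-- The open Weyl chamber `𝔞⁺`. -/
def chamber (P : Set (Module.Dual ℝ 𝔞)) : Set 𝔞 :=
  {A | ∀ β, IsSimpleRoot P β → 0 < β A}

/-- The closure of `𝔞⁺` in the usual topology of the finite-dimensional space `𝔞`. -/
def closedChamber (P : Set (Module.Dual ℝ 𝔞)) : Set 𝔞 :=
  @closure 𝔞 (moduleTopology ℝ 𝔞) (chamber P)

/-! ### Jordan projection -/

/-- The analytic (connected Lie) subgroup with Lie algebra the `+1` eigenspace `𝔨` of `θ`. -/
def analyticK (θ : 𝔤 ≃ₗ⁅ℝ⁆ 𝔤) : Subgroup (𝔤 ≃ₗ[ℝ] 𝔤) :=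
  Subgroup.closure {x | ∃ X : 𝔤, θ X = X ∧ x = expAd ℝ X}

/-- `A` is the Jordan projection of `x ∈ G`: it lies in the closed chamber, and `x` is a product
of pairwise commuting elements `x_k, x_h, x_u` of `G` where `x_k` is conjugate into the analytic
subgroup of `𝔨`, `x_h` is conjugate to `exp A`, and `x_u` is unipotent. -/
def IsJordanProjection (G : Subgroup (𝔤 ≃ₗ[ℝ] 𝔤)) (θ : 𝔤 ≃ₗ⁅ℝ⁆ 𝔤)
    (P : Set (Module.Dual ℝ 𝔞)) (x : 𝔤 ≃ₗ[ℝ] 𝔤) (A : 𝔞) : Prop :=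
  A ∈ closedChamber P ∧ ∃ xk ∈ G, ∃ xh ∈ G, ∃ xu ∈ G,
    x = xk * xh * xu ∧ Commute xk xh ∧ Commute xk xu ∧ Commute xh xu ∧
    (∃ y ∈ G, y * xk * y⁻¹ ∈ analyticK θ) ∧
    (∃ y ∈ G, y * xh * y⁻¹ = expAd ℝ (A : 𝔤)) ∧
    IsNilpotent ((xu : 𝔤 →ₗ[ℝ] 𝔤) - LinearMap.id)

/-- The Jordan projection `λ`. -/
def jordanProjection (G : Subgroup (𝔤 ≃ₗ[ℝ] 𝔤)) (θ : 𝔤 ≃ₗ⁅ℝ⁆ 𝔤)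
    (P : Set (Module.Dual ℝ 𝔞)) (x : 𝔤 ≃ₗ[ℝ] 𝔤) : 𝔞 :=
  Classical.epsilon (IsJordanProjection G θ P x)

/-- The set of purely loxodromic elements: those conjugate in `G` into `exp 𝔞⁺`. -/
def purelyLoxodromic (G : Subgroup (𝔤 ≃ₗ[ℝ] 𝔤)) (P : Set (Module.Dual ℝ 𝔞)) :
    Set (𝔤 ≃ₗ[ℝ] 𝔤) :=
  {x | x ∈ G ∧ ∃ y ∈ G, ∃ A ∈ chamber P, y * x * y⁻¹ = expAd ℝ (A : 𝔤)}

/-! ### Weyl group -/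

/-- The Weyl group `N_K(𝔞) / Z_K(𝔞)`, as the set of automorphisms of `𝔞` that are
restrictions of elements of `K`. -/
def weylGroup (θ : 𝔤 ≃ₗ⁅ℝ⁆ 𝔤) (𝔞 : Submodule ℝ 𝔤) : Set (𝔞 ≃ₗ[ℝ] 𝔞) :=
  {w | ∃ k ∈ analyticK θ, ∀ A : 𝔞, k (A : 𝔤) = (w A : 𝔤)}

/-- `s` is the `B`-orthogonal reflection of `𝔞` in the kernel of some simple root. -/
def IsSimpleReflection (B : LinearMap.BilinForm ℝ 𝔤) (P : Set (Module.Dual ℝ 𝔞))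
    (s : 𝔞 ≃ₗ[ℝ] 𝔞) : Prop :=
  ∃ β, IsSimpleRoot P β ∧ (∀ A : 𝔞, β A = 0 → s A = A) ∧
    ∀ v : 𝔞, (∀ A : 𝔞, β A = 0 → B (v : 𝔤) (A : 𝔤) = 0) → s v = -v

/-- The word length of `w` with respect to the simple reflections. -/
def weylLength (B : LinearMap.BilinForm ℝ 𝔤) (P : Set (Module.Dual ℝ 𝔞))
    (w : 𝔞 ≃ₗ[ℝ] 𝔞) : ℕ :=
  sInf {n | ∃ l : List (𝔞 ≃ₗ[ℝ] 𝔞),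
    (∀ s ∈ l, IsSimpleReflection B P s) ∧ l.prod = w ∧ l.length = n}

/-- `w₀` is the longest element of the Weyl group. -/
def IsLongest (B : LinearMap.BilinForm ℝ 𝔤) (θ : 𝔤 ≃ₗ⁅ℝ⁆ 𝔤)
    (P : Set (Module.Dual ℝ 𝔞)) (w₀ : 𝔞 ≃ₗ[ℝ] 𝔞) : Prop :=
  w₀ ∈ weylGroup θ 𝔞 ∧ ∀ w ∈ weylGroup θ 𝔞, weylLength B P w ≤ weylLength B P w₀

end

end GoldmanLie

open GoldmanLie

/-! Two facts about an element x conjugate into exp 𝔞⁺ carry the theorem: any such conjugation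
determines the Jordan projection of x, and near x the conjugation can be chosen so that its
𝔞-component is analytic.

Uniqueness (`isJordanProjection_iff`). Let exp Z' be a product of commuting elliptic, hyperbolic and
unipotent factors, the hyperbolic one being exp Z. On each joint eigenspace of ad Z and ad Z' the
unipotent factor fixes a nonzero vector and the elliptic factor preserves a norm, so the two
eigenvalues agree and Z = Z' (`hyperbolic_part_unique`). If two chamber elements are conjugate under
g in G, then g normalizes 𝔞, and it must centralize it (`apply_eq_self_of_chamber`). Since G need
not be connected, the danger is an outer automorphism preserving the chamber. It is excluded by a
multiplicity count. In the complex adjoint group the eigenvalue 1 has algebraic multiplicity at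
least dim 𝔞, by analytic continuation from a neighbourhood of a regular exp A₀
(`finrank_le_finrank_maxGenEigenspace`). For large c the generalized 1-eigenspace of g exp(cA) lies
in 𝔞, hence equals 𝔞, so g is unipotent on 𝔞. It also preserves the positive definite form B there,
hence is the identity.

Differentiation (`exists_local_conjugation`). For regular A₀ the inverse function theorem applies,
among all matrices, to (X, H, c) ↦ exp(X) exp(A₀ + H) exp(-X) (1 + c), with X in [A₀, 𝔤], H in 𝔞 and
c in a complement of ad 𝔤. Automorphisms near exp A₀ have c = 0 because every derivation is inner.
Hence λ = A₀ + H locally. Along exp(A₀) exp(tY) the first-order change of H is the component of Y in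
𝔞 along [A₀, 𝔤]. That space is B-orthogonal to 𝔞, so the derivative of α ∘ λ is B(α^∨, Y).
Conjugation carries this to every point of U.

Inverses. Word length in the Weyl group equals the number of inversions (`weylLength_eq`), so w₀
sends the chamber to its negative. A representative k of w₀ in K then has k⁻¹ exp(-X) k in exp 𝔞⁺,
and the Goldman value at exp(-X) is k α^∨ = w₀ α^∨. -/

set_option linter.unusedSectionVars false

namespace GoldmanLie

noncomputable section

/-! ### The exponential of an endomorphism -/

section ExpLin

attribute [local instance] Matrix.linftyOpNormedRing Matrix.linftyOpNormedAlgebra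

variable {𝕜 : Type*} [RCLike 𝕜]
variable {V W : Type*} [AddCommGroup V] [Module 𝕜 V] [FiniteDimensional 𝕜 V]
  [AddCommGroup W] [Module 𝕜 W] [FiniteDimensional 𝕜 W]

/-- The exponential of an endomorphism of a finite-dimensional vector space. -/
def expLin (f : V →ₗ[𝕜] V) : V →ₗ[𝕜] V :=
  Matrix.toLin (Module.finBasis 𝕜 V) (Module.finBasis 𝕜 V)
    (NormedSpace.exp (LinearMap.toMatrix (Module.finBasis 𝕜 V) (Module.finBasis 𝕜 V) f))

theorem toMatrix_pow_toLin (f : V →ₗ[𝕜] V) (k : ℕ) :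
    Matrix.toLin (Module.finBasis 𝕜 V) (Module.finBasis 𝕜 V)
      (LinearMap.toMatrix (Module.finBasis 𝕜 V) (Module.finBasis 𝕜 V) f ^ k) = f ^ k := by
  rw [LinearMap.toMatrix_pow, Matrix.toLin_toMatrix]

/-- Testing against functionals reduces identities for `expLin` to uniqueness of a scalar sum, with
no norm chosen on `V`. -/
theorem hasSum_expLin (φ : Module.Dual 𝕜 V) (f : V →ₗ[𝕜] V) (v : V) :
    HasSum (fun k : ℕ => ((k.factorial : 𝕜)⁻¹) * φ ((f ^ k) v)) (φ (expLin f v)) := by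
  have h := NormedSpace.exp_series_hasSum_exp' (𝕂 := 𝕜)
    (LinearMap.toMatrix (Module.finBasis 𝕜 V) (Module.finBasis 𝕜 V) f)
  let ℓ : Matrix (Fin (Module.finrank 𝕜 V)) (Fin (Module.finrank 𝕜 V)) 𝕜 →ₗ[𝕜] 𝕜 :=
    φ ∘ₗ (LinearMap.applyₗ v) ∘ₗ
      (Matrix.toLin (Module.finBasis 𝕜 V) (Module.finBasis 𝕜 V)).toLinearMap
  have hc : Continuous ℓ := ℓ.continuous_of_finiteDimensional
  have h2 := h.map ℓ hc
  convert! h2 using 1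
  funext k
  simp only [Function.comp_apply, map_smul, smul_eq_mul, ℓ, LinearMap.comp_apply,
    LinearEquiv.coe_coe, LinearMap.applyₗ_apply_apply, toMatrix_pow_toLin]

/-- The relation passes to powers and then through the series. It later yields both the automorphism
property of `expAd` and its conjugation formula. -/
theorem expLin_intertwine (T : V →ₗ[𝕜] W) (f : V →ₗ[𝕜] V) (g : W →ₗ[𝕜] W)
    (h : ∀ v, T (f v) = g (T v)) (v : V) : T (expLin f v) = expLin g (T v) := by
  have hk : ∀ (k : ℕ) v, T ((f ^ k) v) = (g ^ k) (T v) := by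
    intro k
    induction k with
    | zero => intro v; simp
    | succ k ih => intro v; rw [pow_succ, pow_succ, Module.End.mul_apply, Module.End.mul_apply, ih, h]
  rw [← sub_eq_zero, ← Module.forall_dual_apply_eq_zero_iff 𝕜]
  intro φ
  rw [map_sub, sub_eq_zero]
  have h1 := hasSum_expLin (φ ∘ₗ T) f v
  have h2 := hasSum_expLin φ g (T v)
  simp only [LinearMap.comp_apply, hk] at h1
  exact h1.unique h2

theorem expLin_add_of_commute (f g : V →ₗ[𝕜] V) (h : Commute f g) :
    expLin (f + g) = expLin f ∘ₗ expLin g := by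
  unfold expLin
  rw [map_add, Matrix.exp_add_of_commute, Matrix.toLin_mul _ (Module.finBasis 𝕜 V)]
  change _ * _ = _ * _
  rw [← LinearMap.toMatrix_mul, ← LinearMap.toMatrix_mul, h.eq]

theorem expLin_zero : expLin (0 : V →ₗ[𝕜] V) = LinearMap.id := by
  unfold expLin
  rw [map_zero, NormedSpace.exp_zero, Matrix.toLin_one]

theorem expLin_apply_of_eigen (f : V →ₗ[𝕜] V) (c : 𝕜) (v : V) (h : f v = c • v) :
    expLin f v = NormedSpace.exp c • v := by
  rw [← sub_eq_zero, ← Module.forall_dual_apply_eq_zero_iff 𝕜]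
  intro φ
  rw [map_sub, sub_eq_zero]
  have hk : ∀ k : ℕ, (f ^ k) v = c ^ k • v := by
    intro k
    induction k with
    | zero => simp
    | succ k ih => rw [pow_succ, Module.End.mul_apply, h, map_smul, ih, smul_smul, pow_succ, mul_comm]
  have h1 := hasSum_expLin φ f v
  simp only [hk, map_smul, smul_eq_mul] at h1
  have h2 := (NormedSpace.exp_series_hasSum_exp' (𝕂 := 𝕜) c).mul_right (φ v)
  rw [map_smul, smul_eq_mul]
  refine h1.unique ?_
  simpa only [smul_eq_mul, mul_assoc] using h2

/-- On the span of v and f v, f acts like multiplication by πi on ℂ, and e^{πi} = -1. This half turn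
later realizes simple reflections inside K. -/
theorem expLin_apply_of_sq {V : Type*} [AddCommGroup V] [Module ℝ V] [FiniteDimensional ℝ V]
    (f : V →ₗ[ℝ] V) (v : V) (h : f (f v) = -(Real.pi ^ 2) • v) : expLin f v = -v := by
  rw [← sub_eq_zero, ← Module.forall_dual_apply_eq_zero_iff ℝ]
  intro φ
  rw [map_sub, sub_eq_zero]
  have hpi := Real.pi_ne_zero
  let T : ℂ →ₗ[ℝ] V :=
    (LinearMap.toSpanSingleton ℝ V v) ∘ₗ Complex.reLm +
      (LinearMap.toSpanSingleton ℝ V (Real.pi⁻¹ • f v)) ∘ₗ Complex.imLm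
  have hT : ∀ z : ℂ, T z = z.re • v + (z.im * Real.pi⁻¹) • f v := by
    intro z
    simp [T, smul_smul]
  have hstep : ∀ z : ℂ, f (T z) = T ((Real.pi * Complex.I) * z) := by
    intro z
    rw [hT, hT, map_add, map_smul, map_smul, h]
    simp only [Complex.mul_re, Complex.ofReal_re, Complex.I_re, Complex.ofReal_im, Complex.I_im,
      Complex.mul_im, smul_smul]
    rw [add_comm]
    congr 1
    · congr 1; field_simp; ring
    · congr 1; field_simp; ring
  have hk : ∀ k : ℕ, (f ^ k) v = T ((Real.pi * Complex.I) ^ k) := by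
    intro k
    induction k with
    | zero => simp [hT]
    | succ k ih => rw [pow_succ', Module.End.mul_apply, ih, hstep, pow_succ']
  have h1 := hasSum_expLin φ f v
  let ψ : ℂ →ₗ[ℝ] ℝ := φ ∘ₗ T
  have h2 := (NormedSpace.exp_series_hasSum_exp' (𝕂 := ℝ) ((Real.pi : ℂ) * Complex.I)).map ψ
    ψ.continuous_of_finiteDimensional
  rw [← Complex.exp_eq_exp_ℂ, Complex.exp_pi_mul_I] at h2
  have : ψ (-1) = φ (-v) := by simp [ψ, hT]
  rw [this] at h2
  refine h1.unique ?_
  convert! h2 using 1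
  funext k
  rw [Function.comp_apply, map_smul, hk]
  rfl

/-- By complex linearity the vectors 1 ⊗ v suffice. There the real and imaginary parts of a complex
functional are real functionals of v. -/
theorem expLin_baseChange {V : Type*} [AddCommGroup V] [Module ℝ V] [FiniteDimensional ℝ V]
    (f : V →ₗ[ℝ] V) : expLin (f.baseChange ℂ) = (expLin f).baseChange ℂ := by
  apply TensorProduct.AlgebraTensorModule.curry_injective
  apply LinearMap.ext_ring
  ext v
  simp only [TensorProduct.AlgebraTensorModule.curry_apply, TensorProduct.curry_apply,
    LinearMap.coe_restrictScalars, LinearMap.baseChange_tmul]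
  rw [← sub_eq_zero, ← Module.forall_dual_apply_eq_zero_iff ℂ]
  intro φ
  rw [map_sub, sub_eq_zero]
  have h1 := hasSum_expLin φ (f.baseChange ℂ) ((1 : ℂ) ⊗ₜ[ℝ] v)
  have hk : ∀ k : ℕ, ((f.baseChange ℂ) ^ k) ((1 : ℂ) ⊗ₜ[ℝ] v) = (1 : ℂ) ⊗ₜ[ℝ] ((f ^ k) v) := by
    intro k
    induction k with
    | zero => simp
    | succ k ih =>
      rw [pow_succ', Module.End.mul_apply, ih, LinearMap.baseChange_tmul, pow_succ',
        Module.End.mul_apply]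
  simp only [hk] at h1
  let φ1 : V →ₗ[ℝ] ℂ := (φ.restrictScalars ℝ) ∘ₗ (TensorProduct.mk ℝ ℂ V 1)
  have hre := hasSum_expLin (Complex.reLm ∘ₗ φ1) f v
  have him := hasSum_expLin (Complex.imLm ∘ₗ φ1) f v
  refine h1.unique ?_
  rw [Complex.hasSum_iff]
  constructor
  · convert! hre using 1
    funext k
    simp [φ1, ← Complex.ofReal_natCast, ← Complex.ofReal_inv]
  · convert! him using 1
    funext k
    simp [φ1, ← Complex.ofReal_natCast, ← Complex.ofReal_inv]

end ExpLin

/-! ### The exponential of ad and the inner automorphism group. -/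

section ExpAd

variable {𝕜 : Type*} [RCLike 𝕜] {L : Type*} [LieRing L] [LieAlgebra 𝕜 L] [FiniteDimensional 𝕜 L]

theorem coe_expAd (X : L) : (expAd 𝕜 X : L →ₗ[𝕜] L) = expLin (LieAlgebra.ad 𝕜 L X) := rfl

theorem expAd_apply (X Y : L) : expAd 𝕜 X Y = expLin (LieAlgebra.ad 𝕜 L X) Y := rfl

theorem expAd_zero : expAd 𝕜 (0 : L) = 1 := by
  ext v
  rw [expAd_apply, map_zero, expLin_zero]
  rfl

theorem expAd_neg (X : L) : expAd 𝕜 (-X) = (expAd 𝕜 X)⁻¹ := by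
  rw [eq_inv_iff_mul_eq_one]
  ext v
  have := congrArg (fun f : L →ₗ[𝕜] L => f v) (expAdLin_comp_neg 𝕜 (-X))
  rw [neg_neg] at this
  exact this

theorem commute_ad_of_lie_eq_zero {X Y : L} (h : ⁅X, Y⁆ = 0) :
    Commute (LieAlgebra.ad 𝕜 L X) (LieAlgebra.ad 𝕜 L Y) := by
  change _ * _ = _ * _
  ext Z
  rw [Module.End.mul_apply, Module.End.mul_apply, LieAlgebra.ad_apply, LieAlgebra.ad_apply,
    LieAlgebra.ad_apply, LieAlgebra.ad_apply, leibniz_lie X Y Z, h, zero_lie, zero_add]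

theorem expAd_add {X Y : L} (h : ⁅X, Y⁆ = 0) :
    expAd 𝕜 (X + Y) = expAd 𝕜 X * expAd 𝕜 Y := by
  ext v
  rw [expAd_apply, map_add, expLin_add_of_commute _ _ (commute_ad_of_lie_eq_zero h)]
  rfl

theorem expAd_nsmul (X : L) (k : ℕ) : expAd 𝕜 (k • X) = expAd 𝕜 X ^ k := by
  induction k with
  | zero => rw [zero_smul, expAd_zero, pow_zero]
  | succ k ih =>
    rw [succ_nsmul, expAd_add (by rw [nsmul_lie, lie_self, smul_zero]), ih, pow_succ]

/-- The exponentiated Leibniz rule: the bracket L ⊗ L → L intertwines D ⊗ 1 + 1 ⊗ D with D = ad X,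
and the two commuting summands exponentiate separately. -/
theorem expAd_lie (X Y Z : L) : expAd 𝕜 X ⁅Y, Z⁆ = ⁅expAd 𝕜 X Y, expAd 𝕜 X Z⁆ := by
  let D := LieAlgebra.ad 𝕜 L X
  let D1 : L ⊗[𝕜] L →ₗ[𝕜] L ⊗[𝕜] L := TensorProduct.map D LinearMap.id
  let D2 : L ⊗[𝕜] L →ₗ[𝕜] L ⊗[𝕜] L := TensorProduct.map LinearMap.id D
  let T : L ⊗[𝕜] L →ₗ[𝕜] L := (LieModule.toModuleHom 𝕜 L L : L ⊗[𝕜] L →ₗ[𝕜] L)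
  have hT : ∀ Y Z : L, T (Y ⊗ₜ Z) = ⁅Y, Z⁆ := fun Y Z => by simp [T]
  have hint : ∀ v, T ((D1 + D2) v) = D (T v) := by
    intro v
    induction v using TensorProduct.induction_on with
    | zero => simp
    | add a b ha hb => rw [map_add, map_add, ha, hb, ← map_add, ← map_add]
    | tmul a b =>
      simp only [LinearMap.add_apply, D1, D2, TensorProduct.map_tmul, LinearMap.id_apply, map_add,
        hT, D, LieAlgebra.ad_apply]
      rw [leibniz_lie X a b]
  have hcomm : Commute D1 D2 := by
    change D1 * D2 = D2 * D1
    apply TensorProduct.ext'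
    intro a b
    simp [D1, D2]
  have h1 : ∀ a b : L, expLin D1 (a ⊗ₜ[𝕜] b) = (expLin D a) ⊗ₜ b := by
    intro a b
    exact (expLin_intertwine ((TensorProduct.mk 𝕜 L L).flip b) D D1
      (fun v => by simp [D1]) a).symm
  have h2 : ∀ a b : L, expLin D2 (a ⊗ₜ[𝕜] b) = a ⊗ₜ (expLin D b) := by
    intro a b
    exact (expLin_intertwine (TensorProduct.mk 𝕜 L L a) D D2 (fun v => by simp [D2]) b).symm
  have key := expLin_intertwine T (D1 + D2) D hint (Y ⊗ₜ Z)
  rw [expLin_add_of_commute _ _ hcomm, LinearMap.comp_apply, h2, h1, hT, hT] at key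
  exact key.symm

theorem conj_expAd {y : L ≃ₗ[𝕜] L} (hy : ∀ X Y : L, y ⁅X, Y⁆ = ⁅y X, y Y⁆) (X : L) :
    y * expAd 𝕜 X * y⁻¹ = expAd 𝕜 (y X) := by
  ext v
  have := expLin_intertwine (y : L →ₗ[𝕜] L) (LieAlgebra.ad 𝕜 L X) (LieAlgebra.ad 𝕜 L (y X))
    (fun v => by simp [hy]) (y⁻¹ v)
  have hv : y (y⁻¹ v) = v := by
    rw [← LinearEquiv.mul_apply, mul_inv_cancel, LinearEquiv.coe_one, id]
  simp only [LinearEquiv.coe_coe, hv] at this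
  exact this

theorem expAd_apply_of_eigen {X v : L} {c : 𝕜} (h : ⁅X, v⁆ = c • v) :
    expAd 𝕜 X v = NormedSpace.exp c • v :=
  expLin_apply_of_eigen _ c v h

theorem expAd_apply_of_lie_eq_zero {X v : L} (h : ⁅X, v⁆ = 0) : expAd 𝕜 X v = v := by
  rw [expAd_apply_of_eigen (c := (0 : 𝕜)) (by rw [h, zero_smul]), NormedSpace.exp_zero, one_smul]

theorem innerGroup_lie {x : L ≃ₗ[𝕜] L} (hx : x ∈ innerGroup 𝕜 L) (X Y : L) :
    x ⁅X, Y⁆ = ⁅x X, x Y⁆ := by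
  induction hx using Subgroup.closure_induction generalizing X Y with
  | mem x h => obtain ⟨Z, rfl⟩ := h; exact expAd_lie Z X Y
  | one => rfl
  | mul x y _ _ hx hy => rw [LinearEquiv.mul_apply, hy, hx]; rfl
  | inv x _ hx =>
    apply x.injective
    rw [hx]
    have : ∀ v, x (x⁻¹ v) = v := fun v => by
      rw [← LinearEquiv.mul_apply, mul_inv_cancel, LinearEquiv.coe_one, id]
    simp only [this]

end ExpAd

/-! ### Passage between 𝔤 and its complexification. -/

section RealExp

variable {𝔤 : Type*} [LieRing 𝔤] [LieAlgebra ℝ 𝔤] [FiniteDimensional ℝ 𝔤]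

theorem expAd_real_eigen {X v : 𝔤} {c : ℝ} (h : ⁅X, v⁆ = c • v) :
    expAd ℝ X v = Real.exp c • v := by
  rw [Real.exp_eq_exp_ℝ]
  exact expAd_apply_of_eigen h

theorem baseChange_expAd (X : 𝔤) :
    LinearEquiv.baseChange ℝ ℂ 𝔤 𝔤 (expAd ℝ X) = expAd ℂ ((1 : ℂ) ⊗ₜ[ℝ] X) := by
  have h : (LieAlgebra.ad ℂ (ℂ ⊗[ℝ] 𝔤) ((1 : ℂ) ⊗ₜ[ℝ] X)) =
      (LieAlgebra.ad ℝ 𝔤 X).baseChange ℂ := by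
    apply TensorProduct.AlgebraTensorModule.curry_injective
    apply LinearMap.ext_ring
    ext v
    simp
  apply LinearEquiv.toLinearMap_injective
  rw [coe_expAd, h, expLin_baseChange]
  rfl

theorem one_tmul_injective : Function.Injective (fun X : 𝔤 => (1 : ℂ) ⊗ₜ[ℝ] X) := by
  have h := (Module.Flat.rTensor_preserves_injective_linearMap (M := 𝔤) (Algebra.linearMap ℝ ℂ)
    (algebraMap ℝ ℂ).injective).comp (TensorProduct.lid ℝ 𝔤).symm.injective
  intro a b hab
  exact h (by simpa using hab)

/-- Elements of `G` are only assumed linear. Their complexifications are inner, hence respect the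
bracket, and 𝔤 embeds in its complexification. -/
theorem IsRealForm.map_lie {G : Subgroup (𝔤 ≃ₗ[ℝ] 𝔤)} (hG : IsRealForm G) {x : 𝔤 ≃ₗ[ℝ] 𝔤}
    (hx : x ∈ G) (X Y : 𝔤) : x ⁅X, Y⁆ = ⁅x X, x Y⁆ := by
  apply one_tmul_injective
  have h := innerGroup_lie (hG.baseChange_mem x hx) ((1 : ℂ) ⊗ₜ[ℝ] X) ((1 : ℂ) ⊗ₜ[ℝ] Y)
  simpa using h

end RealExp

/-! ### Symmetric endomorphisms and exponentials -/

section Symmetric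

variable {V : Type*} [AddCommGroup V] [Module ℝ V] [FiniteDimensional ℝ V]

/-- With `b` as inner product, `T` is a symmetric operator and the spectral theorem applies. -/
theorem iSup_eigenspace_eq_top_of_symmetric (b : V →ₗ[ℝ] V →ₗ[ℝ] ℝ) (hsymm : ∀ x y, b x y = b y x)
    (hpos : ∀ x, x ≠ 0 → 0 < b x x) (T : Module.End ℝ V) (hT : ∀ x y, b (T x) y = b x (T y)) :
    ⨆ μ : ℝ, T.eigenspace μ = ⊤ := by
  let core : InnerProductSpace.Core ℝ V :=
    { inner := fun x y => b x y
      conj_inner_symm := fun x y => by simpa using hsymm y x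
      re_inner_nonneg := fun x => by
        by_cases hx : x = 0
        · simp [hx]
        · exact (hpos x hx).le
      add_left := fun x y z => by simp
      smul_left := fun x y r => by simp
      definite := fun x hx => by
        by_contra h
        exact (hpos x h).ne' hx }
  let _i : NormedAddCommGroup V := core.toNormedAddCommGroup
  let _j : InnerProductSpace ℝ V := InnerProductSpace.ofCore core.toCore
  have hsym : T.IsSymmetric := fun x y => hT x y
  have := hsym.orthogonalComplement_iSup_eigenspaces_eq_bot
  rwa [Submodule.orthogonal_eq_bot_iff] at this

theorem expLin_smul_of_eigen {f : Module.End ℝ V} {c : ℝ} {v : V} (h : f v = c • v) :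
    expLin f v = Real.exp c • v := by
  rw [Real.exp_eq_exp_ℝ]
  exact expLin_apply_of_eigen f c v h

/-- If `f` is diagonalizable, the eigenvectors of `exp f` with positive eigenvalue `exp c` are the
eigenvectors of `f` with eigenvalue `c`. -/
theorem eigen_of_expLin_eigen {f : Module.End ℝ V} (hf : ⨆ μ : ℝ, f.eigenspace μ = ⊤) {c : ℝ}
    {v : V} (h : expLin f v = Real.exp c • v) : f v = c • v := by
  classical
  obtain ⟨w, hw, hsum⟩ := (Submodule.mem_iSup_iff_exists_finsupp _ v).1 (hf ▸ Submodule.mem_top)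
  have hw' : ∀ μ, f (w μ) = μ • w μ := fun μ => Module.End.mem_eigenspace_iff.1 (hw μ)
  -- Applying exp f - e^c to the eigenvector decomposition of v gives a linear relation among
  -- independent eigenvectors, so only the component with e^μ = e^c survives.
  have hzero : ∑ μ ∈ w.support, (Real.exp μ - Real.exp c) • w μ = 0 := by
    have h1 : expLin f v = ∑ μ ∈ w.support, Real.exp μ • w μ := by
      rw [← hsum, Finsupp.sum, map_sum]
      exact Finset.sum_congr rfl fun μ _ => expLin_smul_of_eigen (hw' μ)
    simp only [sub_smul, Finset.sum_sub_distrib, ← Finset.smul_sum]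
    rw [← h1, h, ← hsum, Finsupp.sum, sub_self]
  have hlin : LinearIndependent ℝ (fun μ : (w.support : Set ℝ) => w μ) :=
    Module.End.eigenvectors_linearIndependent f (w.support : Set ℝ) (fun μ => w μ)
      fun μ => ⟨hw μ, Finsupp.mem_support_iff.1 μ.2⟩
  have hall := Fintype.linearIndependent_iff.1 hlin (fun μ => Real.exp μ - Real.exp c) (by
    rw [← hzero]
    exact Finset.sum_coe_sort w.support fun μ => (Real.exp μ - Real.exp c) • w μ)
  have hcoef : ∀ μ, w μ ≠ 0 → μ = c := by
    intro μ hμ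
    exact Real.exp_injective (sub_eq_zero.1 (hall ⟨μ, Finsupp.mem_support_iff.2 hμ⟩))
  rw [← hsum, Finsupp.sum, map_sum, Finset.smul_sum]
  refine Finset.sum_congr rfl fun μ hμ => ?_
  rw [hw', hcoef μ (Finsupp.mem_support_iff.1 hμ)]

theorem eq_of_expLin_eq {f g : Module.End ℝ V} (hf : ⨆ μ : ℝ, f.eigenspace μ = ⊤)
    (hg : ⨆ μ : ℝ, g.eigenspace μ = ⊤) (h : expLin f = expLin g) : f = g := by
  refine LinearMap.ext fun v => ?_
  have hv : v ∈ ⨆ μ : ℝ, g.eigenspace μ := hg ▸ Submodule.mem_top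
  induction hv using Submodule.iSup_induction' with
  | mem μ v hv =>
    have hv := Module.End.mem_eigenspace_iff.1 hv
    rw [hv, eigen_of_expLin_eigen hf (h ▸ expLin_smul_of_eigen hv)]
  | zero => simp
  | add x y _ _ hx hy => rw [map_add, map_add, hx, hy]

end Symmetric

/-! ### Killing form, invariance of B, and the Cartan involution. -/

section Basics

variable {𝔤 : Type*} [LieRing 𝔤] [LieAlgebra ℝ 𝔤] [FiniteDimensional ℝ 𝔤]

/-- The trace form commutes with base change, so the Killing radical of 𝔤 lands in that of the
complexification, which is zero. -/
theorem isKilling_of_isSimple_baseChange (h : LieAlgebra.IsSimple ℂ (ℂ ⊗[ℝ] 𝔤)) :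
    LieAlgebra.IsKilling ℝ 𝔤 := by
  have hK : LieAlgebra.IsKilling ℂ (ℂ ⊗[ℝ] 𝔤) := inferInstance
  constructor
  rw [eq_bot_iff]
  intro X hX
  rw [LieIdeal.mem_killingCompl] at hX
  rw [LieSubmodule.mem_bot]
  apply one_tmul_injective
  simp only [TensorProduct.tmul_zero]
  have hmem : (1 : ℂ) ⊗ₜ[ℝ] X ∈ LieIdeal.killingCompl ℂ (ℂ ⊗[ℝ] 𝔤) ⊤ := by
    rw [LieIdeal.mem_killingCompl]
    intro Z _
    rw [killingForm, LieModule.traceForm_baseChange]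
    induction Z using TensorProduct.induction_on with
    | zero => simp
    | add a b ha hb => 
      rw [map_add, LinearMap.add_apply, ha (LieSubmodule.mem_top _), hb (LieSubmodule.mem_top _), add_zero]
    | tmul a b =>
      have := hX b (LieSubmodule.mem_top _)
      rw [killingForm] at this
      simp [this]
  rwa [hK.killingCompl_top_eq_bot, LieSubmodule.mem_bot] at hmem

section

attribute [local instance] Matrix.linftyOpNormedRing Matrix.linftyOpNormedAlgebra

theorem hasDerivAt_dual_expAd (p : Module.Dual ℝ 𝔤) (X Y : 𝔤) :
    HasDerivAt (fun t : ℝ => p (expAd ℝ (t • X) Y)) (p ⁅X, Y⁆) 0 := by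
  let b := Module.finBasis ℝ 𝔤
  let ℓ : Matrix (Fin (Module.finrank ℝ 𝔤)) (Fin (Module.finrank ℝ 𝔤)) ℝ →ₗ[ℝ] ℝ :=
    p ∘ₗ (LinearMap.applyₗ Y) ∘ₗ (Matrix.toLin b b).toLinearMap
  have h := hasDerivAt_exp_smul_const' (𝕂 := ℝ) (LinearMap.toMatrix b b (LieAlgebra.ad ℝ 𝔤 X)) 0
  have h2 := (LinearMap.toContinuousLinearMap ℓ).hasFDerivAt.comp_hasDerivAt (0 : ℝ) h
  rw [zero_smul, NormedSpace.exp_zero, mul_one] at h2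
  convert! h2 using 1
  · funext t
    simp only [Function.comp_apply, LinearMap.coe_toContinuousLinearMap', ℓ, LinearMap.comp_apply,
      LinearEquiv.coe_coe, LinearMap.applyₗ_apply_apply]
    rw [expAd_apply, map_smul, expLin, map_smul]
    rfl
  · have : ℓ (LinearMap.toMatrix b b (LieAlgebra.ad ℝ 𝔤 X)) = p ⁅X, Y⁆ := by simp [ℓ]
    exact this.symm

end

variable {B : LinearMap.BilinForm ℝ 𝔤} {G : Subgroup (𝔤 ≃ₗ[ℝ] 𝔤)}

/-- The derivative at t = 0 of B(exp(tX) Y, Z) = B(Y, exp(-tX) Z). -/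
theorem lie_invariant (hG : IsRealForm G) (hBsymm : B.IsSymm)
    (hBinv : ∀ x ∈ G, ∀ X Y : 𝔤, B (x X) (x Y) = B X Y) (X Y Z : 𝔤) :
    B ⁅X, Y⁆ Z = -B Y ⁅X, Z⁆ := by
  have h1 : ∀ t : ℝ, B Z (expAd ℝ (t • X) Y) = B Y (expAd ℝ (t • (-X)) Z) := by
    intro t
    rw [← hBinv _ (hG.expAd_mem (t • X)) Y, smul_neg, expAd_neg, ← LinearEquiv.mul_apply,
      mul_inv_cancel, LinearEquiv.coe_one, id, hBsymm.eq]
  have h2 := hasDerivAt_dual_expAd (B Z) X Y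
  have h3 := hasDerivAt_dual_expAd (B Y) (-X) Z
  simp only [h1] at h2
  have := h2.unique h3
  rw [hBsymm.eq, this, neg_lie, map_neg]

variable {θ : 𝔤 ≃ₗ⁅ℝ⁆ 𝔤}

/-- The positive definite form `-B(X, θ Y)`. -/
def cartanForm (B : LinearMap.BilinForm ℝ 𝔤) (θ : 𝔤 ≃ₗ⁅ℝ⁆ 𝔤) : 𝔤 →ₗ[ℝ] 𝔤 →ₗ[ℝ] ℝ :=
  -(B.compl₂ (θ : 𝔤 →ₗ[ℝ] 𝔤))

theorem cartanForm_apply (X Y : 𝔤) : cartanForm B θ X Y = -B X (θ Y) := by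
  simp [cartanForm]

theorem iSup_eigenspace_ad_eq_top (hθ : IsCartanInvolution B θ)
    (hinv : ∀ X Y Z : 𝔤, B ⁅X, Y⁆ Z = -B Y ⁅X, Z⁆) {A : 𝔤} (hA : θ A = -A) :
    ⨆ μ : ℝ, Module.End.eigenspace (LieAlgebra.ad ℝ 𝔤 A) μ = ⊤ := by
  apply iSup_eigenspace_eq_top_of_symmetric (cartanForm B θ)
  · intro X Y
    rw [cartanForm_apply, cartanForm_apply, hθ.symm]
  · intro X hX
    rw [cartanForm_apply]
    exact hθ.pos X hX
  · intro X Y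
    rw [cartanForm_apply, cartanForm_apply, LieAlgebra.ad_apply, LieAlgebra.ad_apply, hinv,
      LieEquiv.map_lie, hA, neg_lie, map_neg]

/-- Elements of the analytic subgroup of `𝔨` preserve the form `-B(X, θ Y)`. -/
theorem analyticK_preserves (hG : IsRealForm G)
    (hBinv : ∀ x ∈ G, ∀ X Y : 𝔤, B (x X) (x Y) = B X Y) {k : 𝔤 ≃ₗ[ℝ] 𝔤} (hk : k ∈ analyticK θ) :
    k ∈ G ∧ (∀ X, θ (k X) = k (θ X)) ∧
      ∀ X Y, cartanForm B θ (k X) (k Y) = cartanForm B θ X Y := by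
  have hθk : k ∈ G ∧ ∀ X, θ (k X) = k (θ X) := by
    induction hk using Subgroup.closure_induction with
    | mem x h =>
      obtain ⟨X, hX, rfl⟩ := h
      refine ⟨hG.expAd_mem X, fun Y => ?_⟩
      have := conj_expAd (𝕜 := ℝ) (y := θ.toLinearEquiv) (fun X Y => θ.map_lie X Y) X
      rw [mul_inv_eq_iff_eq_mul] at this
      have h2 := LinearEquiv.congr_fun this Y
      have hX' : θ.toLinearEquiv X = X := hX
      rw [hX'] at h2
      exact h2
    | one => exact ⟨G.one_mem, fun X => rfl⟩
    | mul x y _ _ hx hy =>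
      refine ⟨G.mul_mem hx.1 hy.1, fun X => ?_⟩
      rw [LinearEquiv.mul_apply, hx.2, hy.2]
      rfl
    | inv x _ hx =>
      refine ⟨G.inv_mem hx.1, fun X => ?_⟩
      have hinv : ∀ v, x (x⁻¹ v) = v := fun v => by
        rw [← LinearEquiv.mul_apply, mul_inv_cancel, LinearEquiv.coe_one, id]
      apply x.injective
      rw [← hx.2, hinv, hinv]
  refine ⟨hθk.1, hθk.2, fun X Y => ?_⟩
  rw [cartanForm_apply, cartanForm_apply, hθk.2, hBinv k hθk.1]

end Basics

/-! ### The restricted root system of a split real form -/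

section Roots

variable {𝔤 : Type*} [LieRing 𝔤] [LieAlgebra ℝ 𝔤] [FiniteDimensional ℝ 𝔤]

/-- `𝔞` is a split Cartan subalgebra contained in the `-1` eigenspace of a Cartan involution. -/
structure IsSplitCartan (B : LinearMap.BilinForm ℝ 𝔤) (θ : 𝔤 ≃ₗ⁅ℝ⁆ 𝔤) (𝔞 : Submodule ℝ 𝔤) :
    Prop where
  killing : LieAlgebra.IsKilling ℝ 𝔤
  symm : B.IsSymm
  inv : ∀ X Y Z : 𝔤, B ⁅X, Y⁆ Z = -B Y ⁅X, Z⁆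
  cartan : IsCartanInvolution B θ
  neg : ∀ A ∈ 𝔞, θ A = -A
  comm : ∀ A ∈ 𝔞, ∀ A' ∈ 𝔞, ⁅A, A'⁆ = 0
  split : IsSplit 𝔞

variable {B : LinearMap.BilinForm ℝ 𝔤} {θ : 𝔤 ≃ₗ⁅ℝ⁆ 𝔤} {𝔞 : Submodule ℝ 𝔤}

namespace IsSplitCartan

theorem iSup_eigenspace (h : IsSplitCartan B θ 𝔞) (A : 𝔞) :
    ⨆ μ : ℝ, Module.End.eigenspace (LieAlgebra.ad ℝ 𝔤 (A : 𝔤)) μ = ⊤ :=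
  iSup_eigenspace_ad_eq_top h.cartan h.inv (h.neg A A.2)

theorem form_pos (h : IsSplitCartan B θ 𝔞) {A : 𝔤} (hA : A ∈ 𝔞) (h0 : A ≠ 0) : 0 < B A A := by
  have := h.cartan.pos A h0
  rwa [h.neg A hA, map_neg, neg_neg] at this

/-- `ad A` is diagonalizable, hence its kernel is the kernel of its square. -/
theorem lie_eq_zero_of_lie_lie (h : IsSplitCartan B θ 𝔞) {A X : 𝔤} (hA : A ∈ 𝔞)
    (hX : ⁅A, ⁅A, X⁆⁆ = 0) : ⁅A, X⁆ = 0 := by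
  by_contra hne
  have h1 := h.cartan.pos _ hne
  have h2 : B ⁅A, X⁆ (θ ⁅A, X⁆) = B X (θ ⁅A, ⁅A, X⁆⁆) := by
    rw [h.inv, ← map_neg, LieEquiv.map_lie, LieEquiv.map_lie, LieEquiv.map_lie, h.neg A hA, neg_lie,
      neg_lie, lie_neg, neg_neg]
  rw [h2, hX, map_zero, map_zero, neg_zero] at h1
  exact h1.false

/-- `𝔞` as a Lie subalgebra. -/
def subalgebra (h : IsSplitCartan B θ 𝔞) : LieSubalgebra ℝ 𝔤 :=
  { 𝔞 with
    lie_mem' := by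
      intro x y hx hy
      rw [h.comm x hx y hy]
      exact 𝔞.zero_mem }

/-- `𝔞` is the underlying vector space of `h.subalgebra`. -/
def equivSubalgebra (h : IsSplitCartan B θ 𝔞) : 𝔞 ≃ₗ[ℝ] h.subalgebra where
  toFun A := ⟨A, A.2⟩
  invFun A := ⟨A, A.2⟩
  map_add' _ _ := rfl
  map_smul' _ _ := rfl
  left_inv _ := rfl
  right_inv _ := rfl

theorem coe_equivSubalgebra (h : IsSplitCartan B θ 𝔞) (A : 𝔞) :
    (h.equivSubalgebra A : 𝔤) = A := rfl

theorem isLieAbelian (h : IsSplitCartan B θ 𝔞) : IsLieAbelian h.subalgebra :=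
  ⟨fun x y => Subtype.ext (h.comm x x.2 y y.2)⟩

/-- If X normalizes 𝔞, then [A, [A, X]] = 0, so [A, X] = 0 because ad A is self-adjoint for the
Cartan form, and splitness puts X in 𝔞. This makes the root theory of Cartan subalgebras available.
-/
theorem isCartanSubalgebra (h : IsSplitCartan B θ 𝔞) : h.subalgebra.IsCartanSubalgebra where
  nilpotent := by
    have := h.isLieAbelian
    infer_instance
  self_normalizing := by
    refine le_antisymm (fun X hX => ?_) h.subalgebra.le_normalizer
    rw [LieSubalgebra.mem_normalizer_iff'] at hX
    refine h.split X fun A hA => h.lie_eq_zero_of_lie_lie hA ?_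
    exact h.comm A hA _ (hX A hA)

theorem isTriangularizable (h : IsSplitCartan B θ 𝔞) :
    haveI := h.isLieAbelian
    LieModule.IsTriangularizable ℝ h.subalgebra 𝔤 := by
  constructor
  intro x
  rw [eq_top_iff, ← h.iSup_eigenspace ⟨x, x.2⟩]
  exact iSup_mono fun μ => (Module.End.eigenspace_le_genEigenspace (f := LieAlgebra.ad ℝ 𝔤 (x : 𝔤))
    (μ := μ) (by norm_num : (0 : ℕ) < 1)).trans (Module.End.genEigenspace_le_maximal _ _ _)

end IsSplitCartan

theorem isRoot_neg (h : IsSplitCartan B θ 𝔞) {β : Module.Dual ℝ 𝔞} (hβ : IsRoot β) :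
    IsRoot (-β) := by
  obtain ⟨h0, X, hX, hXA⟩ := hβ
  refine ⟨neg_ne_zero.2 h0, θ X, fun h0 => hX (by simpa using h0), fun A => ?_⟩
  have : θ ⁅(A : 𝔤), X⁆ = β A • θ X := by rw [hXA, map_smul]
  rw [LieEquiv.map_lie, h.neg A A.2, neg_lie] at this
  rw [LinearMap.neg_apply, neg_smul, ← this, neg_neg]

/-- The weight of `𝔤` given by a root. -/
theorem IsRoot.exists_weight (h : IsSplitCartan B θ 𝔞) {β : Module.Dual ℝ 𝔞} (hβ : IsRoot β) :
    haveI := h.isCartanSubalgebra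
    ∃ χ : LieModule.Weight ℝ h.subalgebra 𝔤, χ.IsNonZero ∧ ∀ A : 𝔞, χ (h.equivSubalgebra A) = β A := by
  have := h.isCartanSubalgebra
  obtain ⟨h0, X, hX, hXA⟩ := hβ
  refine ⟨⟨fun A => β (h.equivSubalgebra.symm A), fun hbot => hX ?_⟩, fun hz => h0 ?_, fun A => rfl⟩
  · have : X ∈ LieModule.weightSpace 𝔤 (fun A : h.subalgebra => β (h.equivSubalgebra.symm A)) := by
      rw [LieModule.mem_weightSpace]
      intro A
      exact hXA (h.equivSubalgebra.symm A)
    have := LieModule.weightSpace_le_genWeightSpace _ _ this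
    rwa [hbot, LieSubmodule.mem_bot] at this
  · ext A
    exact congrFun hz (h.equivSubalgebra A)

theorem isRoot_of_weight (h : IsSplitCartan B θ 𝔞) :
    haveI := h.isCartanSubalgebra
    ∀ χ : LieModule.Weight ℝ h.subalgebra 𝔤, χ.IsNonZero →
      (∀ X ∈ LieAlgebra.rootSpace h.subalgebra χ, ∀ A : 𝔞,
        ⁅(A : 𝔤), X⁆ = χ (h.equivSubalgebra A) • X) ∧
      ∀ β : Module.Dual ℝ 𝔞, (∀ A : 𝔞, χ (h.equivSubalgebra A) = β A) → IsRoot β := by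
  have := h.isCartanSubalgebra
  have := h.killing
  have := h.isTriangularizable
  intro χ hχ
  have h1 : ∀ X ∈ LieAlgebra.rootSpace h.subalgebra χ, ∀ A : 𝔞,
      ⁅(A : 𝔤), X⁆ = χ (h.equivSubalgebra A) • X := fun X hX A =>
    LieAlgebra.IsKilling.lie_eq_smul_of_mem_rootSpace hX (h.equivSubalgebra A)
  refine ⟨h1, fun β hβ => ⟨fun h0 => hχ ?_, ?_⟩⟩
  · funext A
    have := hβ (h.equivSubalgebra.symm A)
    rw [h0] at this
    simpa using this
  · obtain ⟨X, hX, hX0⟩ := χ.exists_ne_zero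
    exact ⟨X, hX0, fun A => by rw [← hβ]; exact h1 X hX A⟩

theorem finite_setOf_isRoot (h : IsSplitCartan B θ 𝔞) : {β : Module.Dual ℝ 𝔞 | IsRoot β}.Finite := by
  have := h.isCartanSubalgebra
  have : ∀ β : {β : Module.Dual ℝ 𝔞 | IsRoot β}, ∃ χ : LieModule.Weight ℝ h.subalgebra 𝔤,
      ∀ A : 𝔞, χ (h.equivSubalgebra A) = β.1 A := fun β =>
    (IsRoot.exists_weight h β.2).imp fun _ h => h.2
  choose F hF using this
  refine Set.finite_coe_iff.1 (Finite.of_injective F fun β γ hβγ => Subtype.ext ?_)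
  ext A
  rw [← hF, ← hF, hβγ]

/-- The space of vectors on which `𝔞` acts by `β`. -/
def rootVectors (β : Module.Dual ℝ 𝔞) : Submodule ℝ 𝔤 where
  carrier := {X | ∀ A : 𝔞, ⁅(A : 𝔤), X⁆ = β A • X}
  add_mem' {X Y} hX hY A := by rw [lie_add, hX, hY, smul_add]
  zero_mem' A := by simp
  smul_mem' c X hX A := by rw [lie_smul, hX, smul_comm]

/-- Generalized weight spaces of a triangularizable Cartan subalgebra span. With nondegenerate
Killing form they are genuine weight spaces, and the one of weight zero lies in 𝔞 by splitness. -/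
theorem root_decomposition (h : IsSplitCartan B θ 𝔞) :
    𝔞 ⊔ ⨆ β ∈ {β : Module.Dual ℝ 𝔞 | IsRoot β}, rootVectors β = ⊤ := by
  have := h.isCartanSubalgebra
  have := h.killing
  have := h.isTriangularizable
  have htop := LieModule.iSup_genWeightSpace_eq_top' ℝ h.subalgebra 𝔤
  rw [eq_top_iff, 
    ← LieSubmodule.top_toSubmodule (R := ℝ) (L := h.subalgebra) (M := 𝔤), ← htop, LieSubmodule.iSup_toSubmodule, iSup_le_iff]
  intro χ
  by_cases hχ : χ.IsNonZero
  · refine le_sup_of_le_right ?_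
    let β : Module.Dual ℝ 𝔞 := χ.toLinear ∘ₗ h.equivSubalgebra.toLinearMap
    obtain ⟨h1, h2⟩ := isRoot_of_weight h χ hχ
    have hβ : IsRoot β := h2 β fun A => rfl
    have hle : (LieAlgebra.rootSpace h.subalgebra χ).toSubmodule ≤ rootVectors β :=
      fun X hX => h1 X hX
    exact hle.trans (le_iSup₂_of_le (f := fun β _ => rootVectors β) β hβ le_rfl)
  · refine le_sup_of_le_left fun X hX => h.split X fun A hA => ?_
    rw [LieModule.Weight.IsNonZero, not_not] at hχ
    have hX' : X ∈ LieAlgebra.rootSpace h.subalgebra χ := hX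
    have := LieAlgebra.IsKilling.lie_eq_smul_of_mem_rootSpace hX' (h.equivSubalgebra ⟨A, hA⟩)
    rw [hχ.eq] at this
    simpa [h.coe_equivSubalgebra] using this

/-! ### Positive roots, the chamber and simple coroots. -/

section Positive

variable {P : Set (Module.Dual ℝ 𝔞)}

/-- The positive roots. -/
def posRoots (P : Set (Module.Dual ℝ 𝔞)) : Set (Module.Dual ℝ 𝔞) := {β | IsRoot β ∧ β ∈ P}

theorem IsPositivity.not_neg (hP : IsPositivity P) {β : Module.Dual ℝ 𝔞} (h : β ∈ P) : -β ∉ P :=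
  fun hn => hP.zero_notMem (by simpa using hP.add_mem _ h _ hn)

/-- Positivity is abstract, so a chamber point must be produced. `P` is convex and omits 0, so
Hahn–Banach separates 0 from the convex hull of the finitely many positive roots, and a functional
on the dual of 𝔞 is evaluation at a point. -/
theorem exists_forall_pos (h : IsSplitCartan B θ 𝔞) (hP : IsPositivity P) :
    ∃ A : 𝔞, ∀ β ∈ posRoots P, 0 < β A := by
  let e := (Module.finBasis ℝ (Module.Dual ℝ 𝔞)).equivFun
  let S : Set (Fin (Module.finrank ℝ (Module.Dual ℝ 𝔞)) → ℝ) := e '' posRoots P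
  have hfin : S.Finite := ((finite_setOf_isRoot h).subset fun β hβ => hβ.1).image e
  have hconv : Convex ℝ (e '' P) := by
    rintro _ ⟨x, hx, rfl⟩ _ ⟨y, hy, rfl⟩ a b ha hb hab
    refine ⟨a • x + b • y, ?_, by simp⟩
    rcases ha.eq_or_lt with rfl | ha
    · rw [zero_add] at hab
      rw [hab, zero_smul, one_smul, zero_add]; exact hy
    · rcases hb.eq_or_lt with rfl | hb
      · rw [add_zero] at hab
        rw [hab, zero_smul, one_smul, add_zero]; exact hx
      · exact hP.add_mem _ (hP.smul_mem a ha _ hx) _ (hP.smul_mem b hb _ hy)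
  have h0 : (0 : Fin (Module.finrank ℝ (Module.Dual ℝ 𝔞)) → ℝ) ∉ convexHull ℝ S := by
    intro hmem
    have : (0 : Fin (Module.finrank ℝ (Module.Dual ℝ 𝔞)) → ℝ) ∈ e '' P :=
      convexHull_min (Set.image_mono fun β hβ => hβ.2) hconv hmem
    obtain ⟨x, hx, hx0⟩ := this
    rw [e.map_eq_zero_iff] at hx0
    exact hP.zero_notMem (hx0 ▸ hx)
  obtain ⟨f, u, hu, hf⟩ := geometric_hahn_banach_point_closed (convex_convexHull ℝ S)
    (hfin.isClosed_convexHull ℝ) h0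
  obtain ⟨A, hA⟩ := (Module.evalEquiv ℝ 𝔞).surjective ((f : _ →ₗ[ℝ] ℝ) ∘ₗ e.toLinearMap)
  refine ⟨A, fun β hβ => ?_⟩
  have h1 : β A = f (e β) := by
    have := LinearMap.congr_fun hA β
    simpa using this
  rw [h1]
  rw [map_zero] at hu
  exact hu.trans (hf _ (subset_convexHull ℝ S ⟨β, hβ, rfl⟩))

/-- A non-simple positive root splits into two positive roots with smaller values at the point `A`
where all positive roots are positive. The induction counts the positive roots lying below in this
sense. -/
theorem posRoots_induction (h : IsSplitCartan B θ 𝔞) (hP : IsPositivity P)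
    {p : Module.Dual ℝ 𝔞 → Prop} (hs : ∀ β, IsSimpleRoot P β → p β)
    (hadd : ∀ β γ, p β → p γ → p (β + γ)) {β : Module.Dual ℝ 𝔞} (hβ : β ∈ posRoots P) : p β := by
  obtain ⟨A, hA⟩ := exists_forall_pos h hP
  have hfin : (posRoots P).Finite := (finite_setOf_isRoot h).subset fun β hβ => hβ.1
  have key : ∀ n : ℕ, ∀ β ∈ posRoots P, {γ ∈ posRoots P | γ A < β A}.ncard = n → p β := by
    intro n
    induction n using Nat.strong_induction_on with
    | _ n ih =>
      intro β hβ hn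
      by_cases hsimple : IsSimpleRoot P β
      · exact hs β hsimple
      · simp only [IsSimpleRoot, not_and, not_not] at hsimple
        obtain ⟨γ, δ, hγ, hγP, hδ, hδP, rfl⟩ := hsimple hβ.1 hβ.2
        have hlt : ∀ ε ∈ posRoots P, ε A < (γ + δ) A → p ε := by
          intro ε hε hlt
          refine ih _ ?_ ε hε rfl
          rw [← hn]
          refine Set.ncard_lt_ncard ⟨fun ζ hζ => ⟨hζ.1, hζ.2.trans hlt⟩, fun hsub => ?_⟩
            (hfin.subset fun _ h => h.1)
          exact (hsub ⟨hε, hlt⟩).2.false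
        have hγA := hA γ ⟨hγ, hγP⟩
        have hδA := hA δ ⟨hδ, hδP⟩
        refine hadd _ _ (hlt γ ⟨hγ, hγP⟩ ?_) (hlt δ ⟨hδ, hδP⟩ ?_) <;>
        · rw [LinearMap.add_apply]; linarith
  exact key _ β hβ rfl

theorem mem_chamber_iff (h : IsSplitCartan B θ 𝔞) (hP : IsPositivity P) {A : 𝔞} :
    A ∈ chamber P ↔ ∀ β ∈ posRoots P, 0 < β A :=
  ⟨fun hA _ hβ => posRoots_induction h hP (p := fun β => 0 < β A) hA
    (fun _ _ h1 h2 => add_pos h1 h2) hβ, fun hA β hβ => hA β ⟨hβ.1, hβ.2.1⟩⟩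

theorem chamber_nonempty (h : IsSplitCartan B θ 𝔞) (hP : IsPositivity P) : (chamber P).Nonempty :=
  let ⟨A, hA⟩ := exists_forall_pos h hP
  ⟨A, (mem_chamber_iff h hP).2 hA⟩

/-- A simple root has a coroot, and the reflection in it permutes the other positive roots. -/
theorem exists_coroot (h : IsSplitCartan B θ 𝔞) (hP : IsPositivity P) {β : Module.Dual ℝ 𝔞}
    (hβ : IsSimpleRoot P β) :
    ∃ H : 𝔞, β H = 2 ∧ (∀ A : 𝔞, β A = 0 → B (H : 𝔤) A = 0) ∧
      ∀ γ ∈ posRoots P, γ ≠ β → γ - γ H • β ∈ posRoots P := by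
  have := h.isCartanSubalgebra
  have := h.killing
  have := h.isTriangularizable
  let R := LieAlgebra.IsKilling.rootSystem h.subalgebra
  let e := h.equivSubalgebra
  let r : h.subalgebra.root → Module.Dual ℝ 𝔞 := fun i => R.root i ∘ₗ e.toLinearMap
  have hr : ∀ i, IsRoot (r i) := fun i =>
    (isRoot_of_weight h i.1 (LieSubalgebra.isNonZero_coe_root i)).2 _ fun A => rfl
  have hr' : ∀ γ, IsRoot γ → ∃ i, r i = γ := by
    intro γ hγ
    obtain ⟨χ, hχ, hχγ⟩ := IsRoot.exists_weight h hγ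
    exact ⟨⟨χ, by simpa using hχ⟩, LinearMap.ext hχγ⟩
  have hrneg : ∀ γ ∉ P, IsRoot γ → -γ ∈ posRoots P := fun γ hγP hγ =>
    ⟨isRoot_neg h hγ, (hP.pos_or_neg γ hγ.1).resolve_left hγP⟩
  obtain ⟨A₀, hA₀⟩ := exists_forall_pos h hP
  let f : Module.Dual ℝ (Module.Dual ℝ h.subalgebra) := Module.Dual.eval ℝ _ (e A₀)
  have hfr : ∀ i, f (R.root i) = r i A₀ := fun i => rfl
  have hfpos : ∀ i, 0 < f (R.root i) ↔ r i ∈ P := by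
    intro i
    refine ⟨fun hi => ?_, fun hi => hA₀ _ ⟨hr i, hi⟩⟩
    by_contra hn
    have := hA₀ _ (hrneg _ hn (hr i))
    rw [LinearMap.neg_apply, ← hfr] at this
    linarith
  have hf : ∀ i, f (R.root i) ≠ 0 := by
    intro i h0
    by_cases hi : r i ∈ P
    · exact ((hfpos i).2 hi).ne' h0
    · have := hA₀ _ (hrneg _ hi (hr i))
      rw [LinearMap.neg_apply, ← hfr, h0, neg_zero] at this
      exact this.false
  let idx := R.indexNeg
  let s := IsAddIndecomposable.baseOf R.root (f : Module.Dual ℝ h.subalgebra →+ ℝ)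
  have hli : LinearIndepOn ℝ R.root s := R.linearIndepOn_root_baseOf' f hf
  let b : R.Base := RootPairing.Base.mk' R s hli fun i =>
    IsAddIndecomposable.mem_or_neg_mem_closure_baseOf R.root (f : Module.Dual ℝ h.subalgebra →+ ℝ) i
      (hf i) (by simp)
  have hbs : ∀ i, i ∈ b.support ↔ i ∈ s := fun i => Set.Finite.mem_toFinset _
  have hsP : ∀ i ∈ s, r i ∈ P := fun i hi => (hfpos i).1 hi.1
  have hpos1 : ∀ i, b.IsPos i → r i ∈ P := by
    intro i hi
    refine hi.induction_on_add (p := fun i => r i ∈ P) (fun j hj => hsP j ((hbs j).1 hj)) ?_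
    intro i j k hk hi hj
    have : r k = r i + r j := by
      simp only [r, hk, LinearMap.add_comp]
    rw [this]
    exact hP.add_mem _ hi _ (hsP j ((hbs j).1 hj))
  have hpos2 : ∀ i, r i ∈ P → b.IsPos i := by
    intro i hi
    by_contra hn
    rw [← RootPairing.Base.IsPos.neg_iff_not] at hn
    have h1 := hpos1 _ hn
    have h2 : r (-i) = - r i := by
      simp only [r, RootPairing.indexNeg_neg, RootPairing.root_reflectionPerm, RootPairing.reflection_apply_self, LinearMap.neg_comp]
    rw [h2] at h1
    exact hP.not_neg hi h1
  obtain ⟨i, rfl⟩ := hr' β hβ.1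
  have his : i ∈ s := by
    refine ⟨(hfpos i).2 hβ.2.1, fun j hj k hk hijk => ?_⟩
    exfalso
    refine hβ.2.2 ⟨r j, r k, hr j, (hfpos j).1 hj, hr k, (hfpos k).1 hk, ?_⟩
    simp only [r, hijk, LinearMap.add_comp]
  refine ⟨e.symm (R.coroot i), ?_, ?_, ?_⟩
  · exact R.root_coroot_two i
  · intro A hA
    -- The coroot is a combination of brackets [u, v] with u a root vector for β, and B([u, v], A) =
    -- -B(v, [u, A]) vanishes when β(A) = 0.
    have hco : (R.coroot i) ∈ LieAlgebra.corootSpace (i.1 : h.subalgebra → ℝ) :=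
      LieAlgebra.IsKilling.coroot_mem_corootSpace i.1
    change B ((R.coroot i : h.subalgebra) : 𝔤) A = 0
    rw [LieAlgebra.mem_corootSpace'] at hco
    generalize R.coroot i = c at hco
    induction hco using Submodule.span_induction with
    | mem z hz =>
      obtain ⟨u, hu, v, -, huv⟩ := hz
      have h1 := (isRoot_of_weight h i.1 (LieSubalgebra.isNonZero_coe_root i)).1 u hu A
      have h2 : (i.1 : LieModule.Weight ℝ h.subalgebra 𝔤) (h.equivSubalgebra A) = 0 := hA
      rw [h2, zero_smul] at h1
      rw [← huv, h.inv, ← lie_skew, h1, neg_zero, map_zero, neg_zero]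
    | zero => simp
    | add x y _ _ hx hy => simp [hx, hy]
    | smul c x _ hx => simp [hx]
  · intro γ hγ hγβ
    obtain ⟨j, rfl⟩ := hr' γ hγ.1
    have h1 := (hpos2 j hγ.2).reflectionPerm ((hbs i).2 his) (fun hji => hγβ (by rw [hji]))
    have h2 : r (R.reflectionPerm i j) = r j - r j (e.symm (R.coroot i)) • r i := by
      simp only [r, RootPairing.root_reflectionPerm, RootPairing.reflection_apply]
      ext A
      simp [-mul_eq_mul_right_iff]
      rw [← R.root_coroot_eq_pairing]
      rfl
    rw [← h2]
    exact ⟨hr _, hpos1 _ h1⟩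

end Positive

end Roots

/-! ### Local coordinates near a regular element of `exp 𝔞` -/

section LocalInverse

open Filter Topology

variable {𝒜 : Type*} [NormedRing 𝒜] [NormedAlgebra ℝ 𝒜] [CompleteSpace 𝒜]
variable {E F : Type*} [NormedAddCommGroup E] [NormedSpace ℝ E] [FiniteDimensional ℝ E]
  [NormedAddCommGroup F] [NormedSpace ℝ F] [FiniteDimensional ℝ F]

/-- The map in `hbij` is the differential at the origin of the product displayed at the end, so the
inverse function theorem applies. The factor 1 + c accounts for the directions leaving the
automorphism group. -/
theorem exists_local_coordinates (p q : E →L[ℝ] 𝒜) (c : F →L[ℝ] 𝒜) (a : 𝒜)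
    (hbij : Function.Bijective
      (fun z : E × F => p z.1 * a + a * q z.1 - a * p z.1 + a * c z.2)) :
    ∃ g : 𝒜 → E × F, AnalyticAt ℝ g a ∧ g a = 0 ∧
      (∀ z : E × F, fderiv ℝ g a (p z.1 * a + a * q z.1 - a * p z.1 + a * c z.2) = z) ∧
      ∀ᶠ m in 𝓝 a, NormedSpace.exp (p (g m).1) * a * NormedSpace.exp (q (g m).1) *
        NormedSpace.exp (-p (g m).1) * (1 + c (g m).2) = m := by
  let Ψ : E × F → 𝒜 := fun z => NormedSpace.exp (p z.1) * a * NormedSpace.exp (q z.1) *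
        NormedSpace.exp (-p z.1) * (1 + c z.2)
  have hΨ0 : Ψ 0 = a := by simp [Ψ, NormedSpace.exp_zero]
  have hexp : ∀ r : E × F →L[ℝ] 𝒜, AnalyticAt ℝ (fun z => NormedSpace.exp (r z)) 0 := fun r =>
    (NormedSpace.exp_analytic (𝕂 := ℝ) (r 0)).comp (r.analyticAt 0)
  have hexp' : ∀ r : E × F →L[ℝ] 𝒜, HasFDerivAt (fun z => NormedSpace.exp (r z)) r 0 := by
    intro r
    have h : HasFDerivAt NormedSpace.exp (1 : 𝒜 →L[ℝ] 𝒜) (r 0) := by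
      rw [map_zero]
      exact hasFDerivAt_exp_zero
    exact h.comp 0 r.hasFDerivAt
  let pp : E × F →L[ℝ] 𝒜 := p ∘L ContinuousLinearMap.fst ℝ E F
  let qq : E × F →L[ℝ] 𝒜 := q ∘L ContinuousLinearMap.fst ℝ E F
  let cc : E × F →L[ℝ] 𝒜 := c ∘L ContinuousLinearMap.snd ℝ E F
  have han : AnalyticAt ℝ Ψ 0 :=
    ((((hexp pp).mul analyticAt_const).mul (hexp qq)).mul (hexp (-pp))).mul
      (analyticAt_const.add (cc.analyticAt 0))
  let D : E × F →ₗ[ℝ] 𝒜 :=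
    { toFun := fun z => p z.1 * a + a * q z.1 - a * p z.1 + a * c z.2
      map_add' := fun x y => by simp [mul_add, add_mul]; abel
      map_smul' := fun r x => by simp [smul_add, smul_sub] }
  let e : (E × F) ≃L[ℝ] 𝒜 :=
    ContinuousLinearEquiv.ofBijective (LinearMap.toContinuousLinearMap D)
      (LinearMap.ker_eq_bot.2 hbij.1) (LinearMap.range_eq_top.2 hbij.2)
  have he : ∀ z, e z = p z.1 * a + a * q z.1 - a * p z.1 + a * c z.2 := fun z => rfl
  have hder : HasFDerivAt Ψ (e : E × F →L[ℝ] 𝒜) 0 := by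
    have h1 := ((((hexp' pp).mul_const' a).mul' (hexp' qq)).mul' (hexp' (-pp))).mul'
      (((hasFDerivAt_const (1 : 𝒜) (0 : E × F))).add cc.hasFDerivAt)
    refine h1.congr_fderiv ?_
    ext z
    · simp [he, pp, qq, cc, NormedSpace.exp_zero]
      abel
    · simp [he, pp, qq, cc, NormedSpace.exp_zero]
  -- In `WithTop ℕ∞` the top element is the analytic class ω, so the local inverse obtained below is
  -- analytic and not merely smooth.
  have hω : ContDiffAt ℝ (⊤ : WithTop ℕ∞) Ψ 0 := han.contDiffAt
  have hstrict : HasStrictFDerivAt Ψ (e : E × F →L[ℝ] 𝒜) 0 := hω.hasStrictFDerivAt' hder (by simp)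
  refine ⟨hstrict.localInverse, ?_, ?_, ?_, ?_⟩
  · have h1 := hω.to_localInverse hder (by simp)
    rw [hΨ0] at h1
    exact h1.analyticAt
  · have h1 := hstrict.localInverse_apply_image
    rwa [hΨ0] at h1
  · intro z
    have h1 := hstrict.to_localInverse.hasFDerivAt.fderiv
    rw [hΨ0] at h1
    rw [h1, ← he]
    exact e.symm_apply_apply z
  · have h1 := hstrict.eventually_right_inverse
    rwa [hΨ0] at h1

/-- Injectivity gives ‖c‖ ≤ K ‖δ c‖ ≤ K ‖Q‖ ‖c‖², impossible for small nonzero c. -/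
theorem eventually_eq_zero_of_eq_quadratic (δ : E →ₗ[ℝ] F) (hδ : LinearMap.ker δ = ⊥)
    (Q : E →ₗ[ℝ] E →ₗ[ℝ] F) : ∀ᶠ c in 𝓝 0, δ c = Q c c → c = 0 := by
  let Q' : E →L[ℝ] E →L[ℝ] F := Q.toContinuousBilinearMap
  obtain ⟨K, hK, hanti⟩ := LinearMap.exists_antilipschitzWith δ hδ
  have hev : ∀ᶠ c : E in 𝓝 0, ‖c‖ * (K * ‖Q'‖) < 1 := by
    have : Tendsto (fun c : E => ‖c‖ * (K * ‖Q'‖)) (𝓝 0) (𝓝 (‖(0 : E)‖ * (K * ‖Q'‖))) :=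
      (continuous_norm.mul continuous_const).tendsto 0
    rw [norm_zero, zero_mul] at this
    exact this.eventually_lt_const one_pos
  filter_upwards [hev] with c hc h1
  have h2 : ‖c‖ ≤ K * ‖δ c‖ := by
    have := hanti.le_mul_dist c 0
    rwa [map_zero, dist_zero_right, dist_zero_right] at this
  have h3 : ‖δ c‖ ≤ ‖Q'‖ * ‖c‖ * ‖c‖ := by
    rw [h1]
    exact Q'.le_opNorm₂ c c
  by_contra hne
  have hpos : 0 < ‖c‖ := norm_pos_iff.2 hne
  have h4 : ‖c‖ ≤ K * (‖Q'‖ * ‖c‖ * ‖c‖) := h2.trans (mul_le_mul_of_nonneg_left h3 K.2)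
  nlinarith

end LocalInverse

/-! ### Automorphisms close to the identity. -/

section Coordinates

open Filter Topology

attribute [local instance] Matrix.linftyOpNormedRing Matrix.linftyOpNormedAlgebra

variable {𝔤 : Type*} [LieRing 𝔤] [LieAlgebra ℝ 𝔤] [FiniteDimensional ℝ 𝔤]

/-- The matrix of an endomorphism in the standard basis. -/
def mat : Module.End ℝ 𝔤 ≃ₐ[ℝ]
    Matrix (Fin (Module.finrank ℝ 𝔤)) (Fin (Module.finrank ℝ 𝔤)) ℝ :=
  LinearMap.toMatrixAlgEquiv (Module.finBasis ℝ 𝔤)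

theorem mat_expAd (X : 𝔤) :
    mat (expAd ℝ X : 𝔤 →ₗ[ℝ] 𝔤) = NormedSpace.exp (mat (LieAlgebra.ad ℝ 𝔤 X)) := by
  change LinearMap.toMatrix _ _ (Matrix.toLin _ _ _) = _
  rw [LinearMap.toMatrix_toLin]
  rfl

/-- The automorphism identity for 1 + c reads δ(c) = Q(c, c), where δ measures the failure of c to
be a derivation. A kernel element of δ is a derivation, hence inner, hence zero by `hC`. -/
theorem eq_zero_of_small_of_automorphism [LieAlgebra.IsKilling ℝ 𝔤]
    (C : Submodule ℝ (Matrix (Fin (Module.finrank ℝ 𝔤)) (Fin (Module.finrank ℝ 𝔤)) ℝ))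
    (hC : ∀ X : 𝔤, mat (LieAlgebra.ad ℝ 𝔤 X) ∈ C → X = 0) :
    ∀ᶠ c : C in 𝓝 0, (∀ X Y : 𝔤, mat.symm (1 + (c : Matrix _ _ ℝ)) ⁅X, Y⁆ =
      ⁅mat.symm (1 + (c : Matrix _ _ ℝ)) X, mat.symm (1 + (c : Matrix _ _ ℝ)) Y⁆) → c = 0 := by
  let b := Module.finBasis ℝ 𝔤
  let n := Module.finrank ℝ 𝔤
  let L : C →ₗ[ℝ] Module.End ℝ 𝔤 := (mat (𝔤 := 𝔤)).symm.toLinearMap ∘ₗ C.subtype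
  let δ : C →ₗ[ℝ] (Fin n → Fin n → Fin n → ℝ) :=
    { toFun := fun c i j => b.equivFun (L c ⁅b i, b j⁆ - ⁅L c (b i), b j⁆ - ⁅b i, L c (b j)⁆)
      map_add' := fun c c' => by
        funext i j
        simp only [map_add, LinearMap.add_apply, add_lie, lie_add, Pi.add_apply, map_sub]
        abel
      map_smul' := fun r c => by
        funext i j
        simp only [map_smul, LinearMap.smul_apply, smul_lie, lie_smul, Pi.smul_apply, map_sub,
          RingHom.id_apply, smul_sub] }
  let Q : C →ₗ[ℝ] C →ₗ[ℝ] (Fin n → Fin n → Fin n → ℝ) :=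
    LinearMap.mk₂ ℝ (fun c c' i j => b.equivFun ⁅L c (b i), L c' (b j)⁆)
      (fun c c' c'' => by funext i j; simp)
      (fun r c c' => by funext i j; simp)
      (fun c c' c'' => by funext i j; simp)
      (fun r c c' => by funext i j; simp)
  have hδ : LinearMap.ker δ = ⊥ := by
    rw [LinearMap.ker_eq_bot']
    intro c hc
    have h1 : ∀ X Y : 𝔤, L c ⁅X, Y⁆ = ⁅X, L c Y⁆ - ⁅Y, L c X⁆ := by
      intro X Y
      let T : 𝔤 →ₗ[ℝ] 𝔤 →ₗ[ℝ] 𝔤 := LinearMap.mk₂ ℝ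
        (fun X Y => L c ⁅X, Y⁆ - ⁅L c X, Y⁆ - ⁅X, L c Y⁆)
        (fun X Y Z => by simp only [add_lie, map_add]; abel)
        (fun r X Y => by simp only [smul_lie, map_smul, smul_sub])
        (fun X Y Z => by simp only [lie_add, map_add]; abel)
        (fun r X Y => by simp only [lie_smul, map_smul, smul_sub])
      have hT : T = 0 := by
        refine b.ext fun i => b.ext fun j => ?_
        have := congrFun (congrFun hc i) j
        exact b.equivFun.map_eq_zero_iff.1 this
      have hXY : L c ⁅X, Y⁆ - ⁅L c X, Y⁆ - ⁅X, L c Y⁆ = 0 :=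
        LinearMap.congr_fun (LinearMap.congr_fun hT X) Y
      rw [← lie_skew Y (L c X)]
      rw [sub_sub, sub_eq_zero] at hXY
      rw [hXY]
      abel
    obtain ⟨X, hX⟩ := LieDerivation.IsKilling.exists_eq_ad (⟨L c, h1⟩ : LieDerivation ℝ 𝔤 𝔤)
    have h2 : LieAlgebra.ad ℝ 𝔤 X = L c := by
      rw [← LieDerivation.coe_ad_apply_eq_ad_apply, hX]
    have h3 : mat (L c) = (c : Matrix _ _ ℝ) := (mat (𝔤 := 𝔤)).apply_symm_apply _
    have h4 := hC X (by rw [h2, h3]; exact c.2)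
    rw [h4, map_zero] at h2
    rw [← h2, map_zero] at h3
    exact Subtype.ext h3.symm
  filter_upwards [eventually_eq_zero_of_eq_quadratic δ hδ Q] with c hc haut
  refine hc ?_
  funext i j
  have := haut (b i) (b j)
  rw [map_add, map_one] at this
  change (1 + L c) _ = ⁅(1 + L c) _, (1 + L c) _⁆ at this
  simp only [LinearMap.add_apply, Module.End.one_apply, add_lie, lie_add] at this
  change b.equivFun _ = b.equivFun _
  congr 1
  rw [sub_sub, sub_eq_iff_eq_add]
  have h2 : ⁅b i, b j⁆ + L c ⁅b i, b j⁆ = ⁅b i, b j⁆ + (⁅L c (b i), L c (b j)⁆ +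
      (⁅L c (b i), b j⁆ + ⁅b i, L c (b j)⁆)) := by
    rw [this]; abel
  exact add_left_cancel h2

end Coordinates

/-! ### Conjugating automorphisms near a regular element into exp 𝔞. -/

section LocalConjugation

open Filter Topology

attribute [local instance] Matrix.linftyOpNormedRing Matrix.linftyOpNormedAlgebra

variable {𝔤 : Type*} [LieRing 𝔤] [LieAlgebra ℝ 𝔤] [FiniteDimensional ℝ 𝔤]
variable {B : LinearMap.BilinForm ℝ 𝔤} {θ : 𝔤 ≃ₗ⁅ℝ⁆ 𝔤} {𝔞 : Submodule ℝ 𝔤}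

theorem apply_inv_apply (x : 𝔤 ≃ₗ[ℝ] 𝔤) (v : 𝔤) : x (x⁻¹ v) = v := by
  rw [← LinearEquiv.mul_apply, mul_inv_cancel, LinearEquiv.coe_one, id]

theorem inv_apply_apply (x : 𝔤 ≃ₗ[ℝ] 𝔤) (v : 𝔤) : x⁻¹ (x v) = v := by
  rw [← LinearEquiv.mul_apply, inv_mul_cancel, LinearEquiv.coe_one, id]

theorem inv_map_lie {x : 𝔤 ≃ₗ[ℝ] 𝔤} (hx : ∀ X Y, x ⁅X, Y⁆ = ⁅x X, x Y⁆) (X Y : 𝔤) :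
    x⁻¹ ⁅X, Y⁆ = ⁅x⁻¹ X, x⁻¹ Y⁆ := by
  apply x.injective
  rw [hx, apply_inv_apply, apply_inv_apply, apply_inv_apply]

theorem mul_map_lie {x y : 𝔤 ≃ₗ[ℝ] 𝔤} (hx : ∀ X Y, x ⁅X, Y⁆ = ⁅x X, x Y⁆)
    (hy : ∀ X Y, y ⁅X, Y⁆ = ⁅y X, y Y⁆) (X Y : 𝔤) : (x * y) ⁅X, Y⁆ = ⁅(x * y) X, (x * y) Y⁆ := by
  rw [LinearEquiv.mul_apply, hy, hx]
  rfl

namespace IsSplitCartan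

/-- Regularity makes 𝔞 the kernel of ad A₀. Kernel and range meet trivially because ad A₀ is
diagonalizable, and rank-nullity does the rest. -/
theorem disjoint_range_ad (h : IsSplitCartan B θ 𝔞) {A₀ : 𝔞}
    (hreg : ∀ X : 𝔤, ⁅(A₀ : 𝔤), X⁆ = 0 → X ∈ 𝔞) :
    IsCompl 𝔞 (LinearMap.range (LieAlgebra.ad ℝ 𝔤 (A₀ : 𝔤))) := by
  have hker : LinearMap.ker (LieAlgebra.ad ℝ 𝔤 (A₀ : 𝔤)) = 𝔞 := by
    ext X
    rw [LinearMap.mem_ker, LieAlgebra.ad_apply]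
    exact ⟨hreg X, fun hX => h.comm _ A₀.2 _ hX⟩
  rw [Submodule.isCompl_iff_disjoint]
  · rw [Submodule.disjoint_def]
    rintro X hX ⟨W, rfl⟩
    exact h.lie_eq_zero_of_lie_lie A₀.2 (h.comm _ A₀.2 _ hX)
  · rw [← LinearMap.finrank_range_add_finrank_ker (LieAlgebra.ad ℝ 𝔤 (A₀ : 𝔤)), hker, add_comm]

end IsSplitCartan

/-- Near `exp A₀`, with `A₀ ∈ 𝔞` regular, every automorphism is conjugate to an element of `exp 𝔞`,
which depends analytically on the automorphism. -/
theorem exists_local_conjugation (h : IsSplitCartan B θ 𝔞) {A₀ : 𝔞}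
    (hreg : ∀ X : 𝔤, ⁅(A₀ : 𝔤), X⁆ = 0 → X ∈ 𝔞) :
    ∃ Λ : Matrix (Fin (Module.finrank ℝ 𝔤)) (Fin (Module.finrank ℝ 𝔤)) ℝ → 𝔞,
      Λ (mat (expAd ℝ (A₀ : 𝔤) : 𝔤 →ₗ[ℝ] 𝔤)) = A₀ ∧
      (∀ α : Module.Dual ℝ 𝔞,
        AnalyticAt ℝ (fun m => α (Λ m)) (mat (expAd ℝ (A₀ : 𝔤) : 𝔤 →ₗ[ℝ] 𝔤)) ∧
        ∀ αv : 𝔞, (∀ Y : 𝔞, B (αv : 𝔤) (Y : 𝔤) = α Y) → ∀ Y : 𝔤,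
          fderiv ℝ (fun m => α (Λ m)) (mat (expAd ℝ (A₀ : 𝔤) : 𝔤 →ₗ[ℝ] 𝔤))
            (mat (expAd ℝ (A₀ : 𝔤) : 𝔤 →ₗ[ℝ] 𝔤) * mat (LieAlgebra.ad ℝ 𝔤 Y)) = B (αv : 𝔤) Y) ∧
      ∀ᶠ m in 𝓝 (mat (expAd ℝ (A₀ : 𝔤) : 𝔤 →ₗ[ℝ] 𝔤)), ∀ x : 𝔤 ≃ₗ[ℝ] 𝔤,
        (∀ X Y : 𝔤, x ⁅X, Y⁆ = ⁅x X, x Y⁆) → mat (x : 𝔤 →ₗ[ℝ] 𝔤) = m →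
        ∃ X : 𝔤, x = expAd ℝ X * expAd ℝ (Λ m : 𝔤) * (expAd ℝ X)⁻¹ := by
  have := h.killing
  set R := LinearMap.range (LieAlgebra.ad ℝ 𝔤 (A₀ : 𝔤)) with hR
  have hcompl : IsCompl 𝔞 R := h.disjoint_range_ad hreg
  set a₀ := expAd ℝ (A₀ : 𝔤) with ha₀
  set M := mat (a₀ : 𝔤 →ₗ[ℝ] 𝔤) with hM
  have haut : ∀ X Y : 𝔤, a₀ ⁅X, Y⁆ = ⁅a₀ X, a₀ Y⁆ := expAd_lie _
  let pa : 𝔤 →ₗ[ℝ] 𝔞 := Submodule.projectionOnto 𝔞 R hcompl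
  let pm : 𝔤 →ₗ[ℝ] 𝔤 := LinearMap.id - 𝔞.subtype ∘ₗ pa
  have hpm : ∀ X, pm X ∈ R := fun X => Submodule.sub_projection_mem hcompl X
  have hsum : ∀ X, pm X + pa X = X := fun X => by simp [pm]
  have hdisj : ∀ X ∈ R, ∀ A : 𝔞, X + A = 0 → X = 0 ∧ A = 0 := by
    intro X hX A hXA
    have hA : (A : 𝔤) ∈ R := by
      have : (A : 𝔤) = -X := by rw [eq_neg_iff_add_eq_zero, add_comm]; exact hXA
      rw [this]
      exact R.neg_mem hX
    have h0 : (A : 𝔤) = 0 := (Submodule.disjoint_def.1 hcompl.disjoint) _ A.2 hA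
    rw [h0, add_zero] at hXA
    exact ⟨hXA, Subtype.ext h0⟩
  have hRinv : ∀ X ∈ R, a₀⁻¹ X ∈ R := by
    rintro _ ⟨W, rfl⟩
    refine ⟨a₀⁻¹ W, ?_⟩
    have h1 : a₀⁻¹ (A₀ : 𝔤) = A₀ := by
      rw [ha₀, ← expAd_neg]
      exact expAd_apply_of_lie_eq_zero (by rw [neg_lie, lie_self, neg_zero])
    rw [LieAlgebra.ad_apply, LieAlgebra.ad_apply, inv_map_lie haut, h1]
  -- the differential of the parametrization, read in the Lie algebra
  let T : 𝔤 →ₗ[ℝ] 𝔤 := (a₀⁻¹ : 𝔤 ≃ₗ[ℝ] 𝔤).toLinearMap ∘ₗ pm - pm + 𝔞.subtype ∘ₗ pa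
  have hT : ∀ X, T X = (a₀⁻¹ (pm X) - pm X) + pa X := fun X => rfl
  -- If a₀⁻¹ X = X with X in `R`, then a₀ X = X, so ad A₀ kills X by diagonalizability, and X lies
  -- in 𝔞 ∩ R = 0.
  have hTinj : Function.Injective T := by
    rw [← LinearMap.ker_eq_bot, LinearMap.ker_eq_bot']
    intro X hX
    rw [hT] at hX
    obtain ⟨h1, h2⟩ := hdisj _ (R.sub_mem (hRinv _ (hpm X)) (hpm X)) _ hX
    have h3 : a₀ (pm X) = Real.exp 0 • pm X := by
      rw [Real.exp_zero, one_smul]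
      conv_lhs => rw [← sub_eq_zero.1 h1, apply_inv_apply]
    have h4 := eigen_of_expLin_eigen (h.iSup_eigenspace A₀) h3
    rw [zero_smul, LieAlgebra.ad_apply] at h4
    have h5 : pm X = 0 := (Submodule.disjoint_def.1 hcompl.disjoint) _ (hreg _ h4) (hpm X)
    rw [← hsum X, h5, h2, Submodule.coe_zero, add_zero]
  have hTsurj : Function.Surjective T := LinearMap.injective_iff_surjective.1 hTinj
  let adm : 𝔤 →ₗ[ℝ] Matrix (Fin (Module.finrank ℝ 𝔤)) (Fin (Module.finrank ℝ 𝔤)) ℝ :=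
    (mat (𝔤 := 𝔤)).toLinearMap ∘ₗ (LieAlgebra.ad ℝ 𝔤 : 𝔤 →ₗ[ℝ] Module.End ℝ 𝔤)
  have hadm : ∀ X, adm X = mat (LieAlgebra.ad ℝ 𝔤 X) := fun X => rfl
  have hadm_inj : Function.Injective adm := by
    rw [← LinearMap.ker_eq_bot, LinearMap.ker_eq_bot']
    intro X hX
    have h1 : LieAlgebra.ad ℝ 𝔤 X = 0 := (map_eq_zero_iff _ (mat (𝔤 := 𝔤)).injective).1 hX
    have h2 : X ∈ LieAlgebra.center ℝ 𝔤 := fun Y => by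
      rw [← lie_skew, ← LieAlgebra.ad_apply ℝ, h1, LinearMap.zero_apply, neg_zero]
    rwa [LieAlgebra.center_eq_bot, LieSubmodule.mem_bot] at h2
  -- `C` completes ad 𝔤 to the whole matrix space, so that the inverse function theorem can be used
  -- there without a manifold structure on the automorphism group.
  obtain ⟨C, hC⟩ := (LinearMap.range adm).exists_isCompl
  let ε := (Module.finBasis ℝ 𝔤).equivFun.symm
  let p : (Fin (Module.finrank ℝ 𝔤) → ℝ) →L[ℝ]
      Matrix (Fin (Module.finrank ℝ 𝔤)) (Fin (Module.finrank ℝ 𝔤)) ℝ :=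
    LinearMap.toContinuousLinearMap (adm ∘ₗ pm ∘ₗ ε.toLinearMap)
  let q : (Fin (Module.finrank ℝ 𝔤) → ℝ) →L[ℝ]
      Matrix (Fin (Module.finrank ℝ 𝔤)) (Fin (Module.finrank ℝ 𝔤)) ℝ :=
    LinearMap.toContinuousLinearMap (adm ∘ₗ 𝔞.subtype ∘ₗ pa ∘ₗ ε.toLinearMap)
  -- Since a₀ is an automorphism, ad(X) a₀ = a₀ ad(a₀⁻¹ X). With `M` pulled out on the left, the
  -- differential splits along ad 𝔤 and `C`.
  have hD : ∀ (v : Fin (Module.finrank ℝ 𝔤) → ℝ) (c : C),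
      p v * M + M * q v - M * p v + M * (c : Matrix _ _ ℝ) = M * (adm (T (ε v)) + (c : Matrix _ _ ℝ)) := by
    intro v c
    have h1 : p v * M = M * adm (a₀⁻¹ (pm (ε v))) := by
      change mat _ * mat _ = mat _ * mat _
      rw [← map_mul, ← map_mul]
      congr 1
      ext Z
      change ⁅pm (ε v), a₀ Z⁆ = a₀ ⁅a₀⁻¹ (pm (ε v)), Z⁆
      rw [haut, apply_inv_apply]
    have h2 : q v = adm (pa (ε v)) := rfl
    have h3 : p v = adm (pm (ε v)) := rfl
    rw [h1, h2, h3, hT, map_add, map_sub, mul_add, mul_add, mul_sub]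
    abel
  have hMinv : ∃ N, N * M = 1 ∧ M * N = 1 := by
    refine ⟨mat ((a₀⁻¹ : 𝔤 ≃ₗ[ℝ] 𝔤) : 𝔤 →ₗ[ℝ] 𝔤), ?_, ?_⟩
    · rw [hM, ← map_mul, ← map_one mat]
      congr 1
      ext Z
      exact inv_apply_apply a₀ Z
    · rw [hM, ← map_mul, ← map_one mat]
      congr 1
      ext Z
      exact apply_inv_apply a₀ Z
  obtain ⟨N, hNM, hMN⟩ := hMinv
  have hbij : Function.Bijective (fun z : (Fin (Module.finrank ℝ 𝔤) → ℝ) × C =>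
      p z.1 * M + M * q z.1 - M * p z.1 + M * C.subtypeL z.2) := by
    constructor
    · rintro ⟨v, c⟩ ⟨v', c'⟩ heq
      simp only [Submodule.subtypeL_apply, hD] at heq
      have h1 := congrArg (N * ·) heq
      simp only [← mul_assoc, hNM, one_mul] at h1
      have h2 : adm (T (ε v)) - adm (T (ε v')) = (c' : Matrix (Fin (Module.finrank ℝ 𝔤)) (Fin (Module.finrank ℝ 𝔤)) ℝ) -
          (c : Matrix _ _ ℝ) := by
        rw [sub_eq_sub_iff_add_eq_add, h1, add_comm]
      have h3 : adm (T (ε v)) - adm (T (ε v')) = 0 :=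
        (Submodule.disjoint_def.1 hC.disjoint) _
          (Submodule.sub_mem _ ⟨_, rfl⟩ ⟨_, rfl⟩) (h2 ▸ C.sub_mem c'.2 c.2)
      rw [h3] at h2
      have h4 := hTinj (hadm_inj (sub_eq_zero.1 h3))
      exact Prod.ext (ε.injective h4) (Subtype.ext (sub_eq_zero.1 h2.symm).symm)
    · intro m
      obtain ⟨_, ⟨W, rfl⟩, c, hc, hWc⟩ := Submodule.mem_sup.1
        (hC.sup_eq_top ▸ Submodule.mem_top : N * m ∈ LinearMap.range adm ⊔ C)
      obtain ⟨X, rfl⟩ := hTsurj W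
      refine ⟨(ε.symm X, ⟨c, hc⟩), ?_⟩
      have h1 := hD (ε.symm X) ⟨c, hc⟩
      rw [LinearEquiv.apply_symm_apply] at h1
      refine h1.trans ?_
      rw [hWc, ← mul_assoc, hMN, one_mul]
  obtain ⟨g, hg_an, hg0, hg_der, hg_ev⟩ := exists_local_coordinates p q C.subtypeL M hbij
  refine ⟨fun m => A₀ + pa (ε (g m).1), ?_, ?_, ?_⟩
  · simp [hg0]
  · intro α
    let ℓ : (Fin (Module.finrank ℝ 𝔤) → ℝ) × C →L[ℝ] ℝ := LinearMap.toContinuousLinearMap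
      (α ∘ₗ pa ∘ₗ ε.toLinearMap ∘ₗ LinearMap.fst ℝ _ _)
    have hℓ : (fun m => α (A₀ + pa (ε (g m).1))) = fun m => α A₀ + ℓ (g m) := by
      funext m
      rw [map_add]
      rfl
    rw [hℓ]
    have han : AnalyticAt ℝ (fun m => ℓ (g m)) M := (ℓ.analyticAt _).comp hg_an
    refine ⟨analyticAt_const.add han, fun αv hαv Y => ?_⟩
    have hcomp : fderiv ℝ (fun m => α A₀ + ℓ (g m)) M = ℓ ∘L fderiv ℝ g M :=
      ((ℓ.hasFDerivAt.comp M hg_an.differentiableAt.hasFDerivAt).const_add _).fderiv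
    rw [hcomp, ContinuousLinearMap.comp_apply]
    obtain ⟨X, rfl⟩ := hTsurj Y
    have h1 := hg_der (ε.symm X, 0)
    have h0 := hD (ε.symm X) 0
    rw [Submodule.coe_zero, add_zero, LinearEquiv.apply_symm_apply, hadm] at h0
    have h1 : fderiv ℝ g M (M * mat (LieAlgebra.ad ℝ 𝔤 (T X))) = (ε.symm X, 0) := by
      rw [← h0]
      exact h1
    rw [h1]
    have h2 : ℓ (ε.symm X, 0) = α (pa X) := by simp [ℓ]
    rw [h2, hT, map_add, hαv]
    obtain ⟨W, hW⟩ := R.sub_mem (hRinv _ (hpm X)) (hpm X)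
    rw [← hW, LieAlgebra.ad_apply]
    -- The (a₀⁻¹ - 1)-part of `T X` lies in [A₀, 𝔤], which is B-orthogonal to 𝔞; only the 𝔞-part
    -- contributes.
    have h3 : B (αv : 𝔤) ⁅(A₀ : 𝔤), W⁆ = 0 := by
      have h4 := h.inv A₀ αv W
      rw [h.comm _ A₀.2 _ αv.2, map_zero, LinearMap.zero_apply] at h4
      linarith
    rw [h3, zero_add]
  · have hsmall := eq_zero_of_small_of_automorphism C (fun X hX => by
      have h1 : adm X = 0 := (Submodule.disjoint_def.1 hC.disjoint) _ ⟨X, rfl⟩ hX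
      exact hadm_inj (by rw [h1, map_zero]))
    have htend : Tendsto (fun m => (g m).2) (𝓝 M) (𝓝 0) := by
      have h1 := (continuous_snd.tendsto (g M)).comp hg_an.continuousAt.tendsto
      rw [hg0] at h1
      exact h1
    filter_upwards [hg_ev, htend.eventually hsmall] with m hm hc x hx hxm
    set X := pm (ε (g m).1)
    set H := pa (ε (g m).1)
    let y : 𝔤 ≃ₗ[ℝ] 𝔤 := expAd ℝ X * expAd ℝ ((A₀ + H : 𝔞) : 𝔤) * (expAd ℝ X)⁻¹
    have hy : ∀ X Y : 𝔤, y ⁅X, Y⁆ = ⁅y X, y Y⁆ :=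
      mul_map_lie (mul_map_lie (expAd_lie _) (expAd_lie _)) (inv_map_lie (expAd_lie _))
    have hmat_mul : ∀ u v : 𝔤 ≃ₗ[ℝ] 𝔤, mat ((u * v : 𝔤 ≃ₗ[ℝ] 𝔤) : 𝔤 →ₗ[ℝ] 𝔤) =
        mat (u : 𝔤 →ₗ[ℝ] 𝔤) * mat (v : 𝔤 →ₗ[ℝ] 𝔤) := fun u v => by
      rw [← map_mul]; rfl
    have hym : mat (y : 𝔤 →ₗ[ℝ] 𝔤) * (1 + ((g m).2 : Matrix _ _ ℝ)) = m := by
      rw [hmat_mul, hmat_mul, ← expAd_neg, Submodule.coe_add, expAd_add (h.comm _ A₀.2 _ H.2),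
        hmat_mul, mat_expAd X, mat_expAd (H : 𝔤), mat_expAd (-X), map_neg, map_neg, ← mul_assoc]
      exact hm
    have h1c : 1 + ((g m).2 : Matrix _ _ ℝ) =
        mat ((y⁻¹ * x : 𝔤 ≃ₗ[ℝ] 𝔤) : 𝔤 →ₗ[ℝ] 𝔤) := by
      rw [hmat_mul, hxm]
      conv_rhs => rw [← hym]
      rw [← mul_assoc, ← hmat_mul, inv_mul_cancel]
      have : mat ((1 : 𝔤 ≃ₗ[ℝ] 𝔤) : 𝔤 →ₗ[ℝ] 𝔤) = 1 := map_one mat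
      rw [this, one_mul]
    -- Here 1 + c = y⁻¹ x is itself an automorphism, so the small matrix c vanishes and x = y.
    have hc0 := hc (by
      intro X Y
      rw [h1c, AlgEquiv.symm_apply_apply]
      exact mul_map_lie (inv_map_lie hy) hx X Y)
    refine ⟨X, ?_⟩
    rw [hc0, Submodule.coe_zero, add_zero] at h1c
    have h2 : y⁻¹ * x = 1 := by
      apply LinearEquiv.toLinearMap_injective
      apply (mat (𝔤 := 𝔤)).injective
      rw [← h1c]
      exact (map_one mat).symm
    exact (inv_mul_eq_one.1 h2).symm

end LocalConjugation

/-! ### Openness of the loxodromic set, analyticity and the Goldman value. -/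

section LocalProjection

open Filter Topology

attribute [local instance] Matrix.linftyOpNormedRing Matrix.linftyOpNormedAlgebra

variable {𝔤 : Type*} [LieRing 𝔤] [LieAlgebra ℝ 𝔤] [FiniteDimensional ℝ 𝔤]
variable {B : LinearMap.BilinForm ℝ 𝔤} {θ : 𝔤 ≃ₗ⁅ℝ⁆ 𝔤} {𝔞 : Submodule ℝ 𝔤}
variable {P : Set (Module.Dual ℝ 𝔞)} {G : Subgroup (𝔤 ≃ₗ[ℝ] 𝔤)}

theorem mat_mul (u v : 𝔤 ≃ₗ[ℝ] 𝔤) : mat ((u * v : 𝔤 ≃ₗ[ℝ] 𝔤) : 𝔤 →ₗ[ℝ] 𝔤) =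
    mat (u : 𝔤 →ₗ[ℝ] 𝔤) * mat (v : 𝔤 →ₗ[ℝ] 𝔤) := by
  rw [← map_mul]; rfl

theorem mat_one : mat ((1 : 𝔤 ≃ₗ[ℝ] 𝔤) : 𝔤 →ₗ[ℝ] 𝔤) = 1 := map_one mat

/-- Each root space lies in the range of ad A₀, so the part of X outside 𝔞 is [A₀, W] for some W. It
is also killed by ad A₀, hence zero. -/
theorem mem_of_lie_eq_zero_of_regular (h : IsSplitCartan B θ 𝔞) {A₀ : 𝔞}
    (hA₀ : ∀ β : Module.Dual ℝ 𝔞, IsRoot β → β A₀ ≠ 0) (X : 𝔤) (hX : ⁅(A₀ : 𝔤), X⁆ = 0) :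
    X ∈ 𝔞 := by
  have hle : ⨆ β ∈ {β : Module.Dual ℝ 𝔞 | IsRoot β}, rootVectors β ≤
      LinearMap.range (LieAlgebra.ad ℝ 𝔤 (A₀ : 𝔤)) := by
    refine iSup₂_le fun β hβ Z hZ => ⟨(β A₀)⁻¹ • Z, ?_⟩
    rw [LieAlgebra.ad_apply, lie_smul, hZ A₀, inv_smul_smul₀ (hA₀ β hβ)]
  obtain ⟨A, hA, e, he, rfl⟩ := Submodule.mem_sup.1
    (root_decomposition h ▸ Submodule.mem_top : X ∈ 𝔞 ⊔ _)
  obtain ⟨W, rfl⟩ := hle he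
  rw [lie_add, h.comm _ A₀.2 _ hA, zero_add, LieAlgebra.ad_apply] at hX
  rw [LieAlgebra.ad_apply, h.lie_eq_zero_of_lie_lie A₀.2 hX, add_zero]
  exact hA

theorem ne_zero_of_mem_chamber (h : IsSplitCartan B θ 𝔞) (hP : IsPositivity P) {A : 𝔞}
    (hA : A ∈ chamber P) {β : Module.Dual ℝ 𝔞} (hβ : IsRoot β) : β A ≠ 0 := by
  rw [mem_chamber_iff h hP] at hA
  rcases hP.pos_or_neg β hβ.1 with hβP | hβP
  · exact (hA β ⟨hβ, hβP⟩).ne'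
  · have := hA (-β) ⟨isRoot_neg h hβ, hβP⟩
    rw [LinearMap.neg_apply] at this
    linarith

/-- Conjugation by y transports the chart at exp A₀ to x, and invariance of B turns B(αv, y Y) into
B(y⁻¹ αv, Y). Finitely many strict inequalities define the chamber, so nearby elements stay in it.
-/
theorem exists_local_projection (h : IsSplitCartan B θ 𝔞) (hP : IsPositivity P)
    (hexp : ∀ X : 𝔤, expAd ℝ X ∈ G) (hlie : ∀ x ∈ G, ∀ X Y : 𝔤, x ⁅X, Y⁆ = ⁅x X, x Y⁆)
    (hB : ∀ x ∈ G, ∀ X Y : 𝔤, B (x X) (x Y) = B X Y)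
    {x y : 𝔤 ≃ₗ[ℝ] 𝔤} (hy : y ∈ G) {A₀ : 𝔞} (hA₀ : A₀ ∈ chamber P)
    (hxy : y * x * y⁻¹ = expAd ℝ (A₀ : 𝔤)) :
    ∃ F : Matrix (Fin (Module.finrank ℝ 𝔤)) (Fin (Module.finrank ℝ 𝔤)) ℝ → 𝔞,
      (∀ α : Module.Dual ℝ 𝔞,
        AnalyticAt ℝ (fun m => α (F m)) (mat (x : 𝔤 →ₗ[ℝ] 𝔤)) ∧
        ∀ αv : 𝔞, (∀ Y : 𝔞, B (αv : 𝔤) (Y : 𝔤) = α Y) → ∀ Y : 𝔤,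
          fderiv ℝ (fun m => α (F m)) (mat (x : 𝔤 →ₗ[ℝ] 𝔤))
            (mat (x : 𝔤 →ₗ[ℝ] 𝔤) * mat (LieAlgebra.ad ℝ 𝔤 Y)) = B (y⁻¹ (αv : 𝔤)) Y) ∧
      ∀ᶠ m in 𝓝 (mat (x : 𝔤 →ₗ[ℝ] 𝔤)), ∀ x' ∈ G, mat (x' : 𝔤 →ₗ[ℝ] 𝔤) = m →
        F m ∈ chamber P ∧ ∃ z ∈ G, z * x' * z⁻¹ = expAd ℝ (F m : 𝔤) := by
  obtain ⟨Λ, hΛ0, hΛ, hev⟩ := exists_local_conjugation h (A₀ := A₀)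
    (mem_of_lie_eq_zero_of_regular h fun β hβ => ne_zero_of_mem_chamber h hP hA₀ hβ)
  let c : Matrix (Fin (Module.finrank ℝ 𝔤)) (Fin (Module.finrank ℝ 𝔤)) ℝ →L[ℝ]
      Matrix (Fin (Module.finrank ℝ 𝔤)) (Fin (Module.finrank ℝ 𝔤)) ℝ :=
    LinearMap.toContinuousLinearMap (LinearMap.mulLeft ℝ (mat (y : 𝔤 →ₗ[ℝ] 𝔤)) ∘ₗ
      LinearMap.mulRight ℝ (mat ((y⁻¹ : 𝔤 ≃ₗ[ℝ] 𝔤) : 𝔤 →ₗ[ℝ] 𝔤)))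
  have hc : ∀ m, c m = mat (y : 𝔤 →ₗ[ℝ] 𝔤) * (m * mat ((y⁻¹ : 𝔤 ≃ₗ[ℝ] 𝔤) : 𝔤 →ₗ[ℝ] 𝔤)) :=
    fun m => rfl
  have hcx : ∀ u : 𝔤 ≃ₗ[ℝ] 𝔤, c (mat (u : 𝔤 →ₗ[ℝ] 𝔤)) =
      mat ((y * u * y⁻¹ : 𝔤 ≃ₗ[ℝ] 𝔤) : 𝔤 →ₗ[ℝ] 𝔤) := fun u => by
    rw [hc, ← mat_mul, ← mat_mul, mul_assoc]
  have hcx0 : c (mat (x : 𝔤 →ₗ[ℝ] 𝔤)) = mat (expAd ℝ (A₀ : 𝔤) : 𝔤 →ₗ[ℝ] 𝔤) := by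
    rw [hcx, hxy]
  refine ⟨fun m => Λ (c m), fun α => ⟨?_, fun αv hαv Y => ?_⟩, ?_⟩
  · have h1 := (hΛ α).1
    rw [← hcx0] at h1
    exact h1.comp (c.analyticAt _)
  · have h1 := (hΛ α).1.differentiableAt.hasFDerivAt
    rw [← hcx0] at h1
    have h2 := (h1.comp (mat (x : 𝔤 →ₗ[ℝ] 𝔤)) c.hasFDerivAt).fderiv
    change fderiv ℝ (fun m => α (Λ (c m))) _ = _ at h2
    rw [h2]
    change fderiv ℝ (fun m => α (Λ m)) (c (mat (x : 𝔤 →ₗ[ℝ] 𝔤))) (c _) = _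
    have h3 : c (mat (x : 𝔤 →ₗ[ℝ] 𝔤) * mat (LieAlgebra.ad ℝ 𝔤 Y)) =
        mat (expAd ℝ (A₀ : 𝔤) : 𝔤 →ₗ[ℝ] 𝔤) * mat (LieAlgebra.ad ℝ 𝔤 (y Y)) := by
      rw [hc, ← hxy, mat_mul, mat_mul]
      have h4 : mat (LieAlgebra.ad ℝ 𝔤 (y Y)) * mat (y : 𝔤 →ₗ[ℝ] 𝔤) =
          mat (y : 𝔤 →ₗ[ℝ] 𝔤) * mat (LieAlgebra.ad ℝ 𝔤 Y) := by
        rw [← map_mul, ← map_mul]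
        congr 1
        ext Z
        exact (hlie y hy Y Z).symm
      have h5 : mat (y : 𝔤 →ₗ[ℝ] 𝔤) * mat ((y⁻¹ : 𝔤 ≃ₗ[ℝ] 𝔤) : 𝔤 →ₗ[ℝ] 𝔤) = 1 := by
        rw [← mat_mul, mul_inv_cancel, mat_one]
      have h6 : mat ((y⁻¹ : 𝔤 ≃ₗ[ℝ] 𝔤) : 𝔤 →ₗ[ℝ] 𝔤) * mat (y : 𝔤 →ₗ[ℝ] 𝔤) = 1 := by
        rw [← mat_mul, inv_mul_cancel, mat_one]
      calc _ = mat (y : 𝔤 →ₗ[ℝ] 𝔤) * mat (x : 𝔤 →ₗ[ℝ] 𝔤) *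
            (mat ((y⁻¹ : 𝔤 ≃ₗ[ℝ] 𝔤) : 𝔤 →ₗ[ℝ] 𝔤) * mat (y : 𝔤 →ₗ[ℝ] 𝔤)) *
            mat (LieAlgebra.ad ℝ 𝔤 Y) * mat ((y⁻¹ : 𝔤 ≃ₗ[ℝ] 𝔤) : 𝔤 →ₗ[ℝ] 𝔤) := by
              rw [h6, mul_one]; simp only [mul_assoc]
        _ = mat (y : 𝔤 →ₗ[ℝ] 𝔤) * mat (x : 𝔤 →ₗ[ℝ] 𝔤) *
            mat ((y⁻¹ : 𝔤 ≃ₗ[ℝ] 𝔤) : 𝔤 →ₗ[ℝ] 𝔤) * (mat (y : 𝔤 →ₗ[ℝ] 𝔤) *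
            mat (LieAlgebra.ad ℝ 𝔤 Y)) * mat ((y⁻¹ : 𝔤 ≃ₗ[ℝ] 𝔤) : 𝔤 →ₗ[ℝ] 𝔤) := by
              simp only [mul_assoc]
        _ = _ := by rw [← h4, mul_assoc, mul_assoc (mat (LieAlgebra.ad ℝ 𝔤 (y Y))), h5, mul_one]
    rw [h3, hcx0, (hΛ α).2 αv hαv, ← hB y hy (y⁻¹ _) Y, apply_inv_apply]
  · have hβ : ∀ β : Module.Dual ℝ 𝔞, IsSimpleRoot P β →
        ∀ᶠ m in 𝓝 (mat (expAd ℝ (A₀ : 𝔤) : 𝔤 →ₗ[ℝ] 𝔤)), 0 < β (Λ m) := fun β hβ =>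
      (hΛ β).1.continuousAt.eventually_const_lt (by simpa only [hΛ0] using hA₀ β hβ)
    have hfin : {β : Module.Dual ℝ 𝔞 | IsSimpleRoot P β}.Finite :=
      (finite_setOf_isRoot h).subset fun β hβ => hβ.1
    have hcham := (eventually_all_finite hfin).2 hβ
    have hcont : Tendsto c (𝓝 (mat (x : 𝔤 →ₗ[ℝ] 𝔤)))
        (𝓝 (mat (expAd ℝ (A₀ : 𝔤) : 𝔤 →ₗ[ℝ] 𝔤))) := by
      rw [← hcx0]
      exact c.continuous.tendsto _
    filter_upwards [hcont.eventually hcham, hcont.eventually hev] with m hm1 hm2 x' hx' hxm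
    refine ⟨fun β hβ => hm1 β hβ, ?_⟩
    obtain ⟨X, hX⟩ := hm2 (y * x' * y⁻¹)
      (hlie _ (G.mul_mem (G.mul_mem hy hx') (G.inv_mem hy))) (by rw [← hcx, hxm])
    refine ⟨(expAd ℝ X)⁻¹ * y, G.mul_mem (G.inv_mem (hexp X)) hy, ?_⟩
    rw [mul_inv_rev, inv_inv]
    calc _ = (expAd ℝ X)⁻¹ * (y * x' * y⁻¹) * expAd ℝ X := by simp only [mul_assoc]
      _ = _ := by rw [hX]; group

theorem isOpenIn_purelyLoxodromic (h : IsSplitCartan B θ 𝔞) (hP : IsPositivity P)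
    (hexp : ∀ X : 𝔤, expAd ℝ X ∈ G) (hlie : ∀ x ∈ G, ∀ X Y : 𝔤, x ⁅X, Y⁆ = ⁅x X, x Y⁆)
    (hB : ∀ x ∈ G, ∀ X Y : 𝔤, B (x X) (x Y) = B X Y) :
    IsOpenIn G (purelyLoxodromic G P) := by
  -- The open set consists of the points all of whose neighbours in `G` are purely loxodromic; it is
  -- open by its very form.
  refine ⟨(fun x : 𝔤 ≃ₗ[ℝ] 𝔤 => mat (x : 𝔤 →ₗ[ℝ] 𝔤)) ⁻¹'
    {m | ∀ᶠ m' in 𝓝 m, ∀ x' ∈ G, mat (x' : 𝔤 →ₗ[ℝ] 𝔤) = m' → x' ∈ purelyLoxodromic G P}, ?_, ?_⟩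
  · let : TopologicalSpace (𝔤 →ₗ[ℝ] 𝔤) := moduleTopology ℝ (𝔤 →ₗ[ℝ] 𝔤)
    have : IsModuleTopology ℝ (𝔤 →ₗ[ℝ] 𝔤) := ⟨rfl⟩
    let := autTopology 𝔤
    refine isOpen_setOfPred_eventually_nhds.preimage (Continuous.comp (g := mat) ?_ continuous_induced_dom)
    exact IsModuleTopology.continuous_of_linearMap (mat (𝔤 := 𝔤)).toLinearMap
  · refine Set.eq_of_subset_of_subset (fun x hx => ⟨?_, hx.1⟩) fun x hx =>
      Filter.Eventually.self_of_nhds hx.1 x hx.2 rfl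
    obtain ⟨hxG, y, hy, A₀, hA₀, hxy⟩ := hx
    obtain ⟨F, -, hF⟩ := exists_local_projection h hP hexp hlie hB hy hA₀ hxy
    change ∀ᶠ m' in 𝓝 (mat (x : 𝔤 →ₗ[ℝ] 𝔤)), _
    filter_upwards [hF] with m hm x' hx' hxm
    obtain ⟨h1, z, hz, h2⟩ := hm x' hx' hxm
    exact ⟨hx', z, hz, _, h1, h2⟩

theorem mat_mul_expAd (x : 𝔤 ≃ₗ[ℝ] 𝔤) (Y : 𝔤) :
    mat ((x * expAd ℝ Y : 𝔤 ≃ₗ[ℝ] 𝔤) : 𝔤 →ₗ[ℝ] 𝔤) =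
      mat (x : 𝔤 →ₗ[ℝ] 𝔤) * NormedSpace.exp (mat (LieAlgebra.ad ℝ 𝔤 Y)) := by
  rw [mat_mul, mat_expAd]

/-- If `f` is invariant and equals `α` on `exp 𝔞⁺`, it is analytic on the purely loxodromic
elements and its Goldman function is given by the dual of `α`. -/
theorem analyticAt_and_isGoldmanValue (h : IsSplitCartan B θ 𝔞) (hP : IsPositivity P)
    (hexp : ∀ X : 𝔤, expAd ℝ X ∈ G) (hlie : ∀ x ∈ G, ∀ X Y : 𝔤, x ⁅X, Y⁆ = ⁅x X, x Y⁆)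
    (hB : ∀ x ∈ G, ∀ X Y : 𝔤, B (x X) (x Y) = B X Y)
    {α : Module.Dual ℝ 𝔞} {f : (𝔤 ≃ₗ[ℝ] 𝔤) → ℝ}
    (hf : ∀ x ∈ G, ∀ z ∈ G, ∀ A ∈ chamber P, z * x * z⁻¹ = expAd ℝ (A : 𝔤) → f x = α A)
    {x y : 𝔤 ≃ₗ[ℝ] 𝔤} (hx : x ∈ G) (hy : y ∈ G) {A₀ : 𝔞} (hA₀ : A₀ ∈ chamber P)
    (hxy : y * x * y⁻¹ = expAd ℝ (A₀ : 𝔤)) :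
    AnalyticAt ℝ (inChart f x) 0 ∧
      ∀ αv : 𝔞, (∀ Y : 𝔞, B (αv : 𝔤) (Y : 𝔤) = α Y) → IsGoldmanValue B f x (y⁻¹ (αv : 𝔤)) := by
  obtain ⟨F, hF, hev⟩ := exists_local_projection h hP hexp hlie hB hy hA₀ hxy
  have hev' : ∀ᶠ m in 𝓝 (mat (x : 𝔤 →ₗ[ℝ] 𝔤)), ∀ x' ∈ G, mat (x' : 𝔤 →ₗ[ℝ] 𝔤) = m →
      f x' = α (F m) := by
    filter_upwards [hev] with m hm x' hx' hxm
    obtain ⟨h1, z, hz, h2⟩ := hm x' hx' hxm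
    exact hf x' hx' z hz _ h1 h2
  constructor
  · let ε := (Module.finBasis ℝ 𝔤).equivFun.symm
    let L : (Fin (Module.finrank ℝ 𝔤) → ℝ) →L[ℝ]
        Matrix (Fin (Module.finrank ℝ 𝔤)) (Fin (Module.finrank ℝ 𝔤)) ℝ :=
      LinearMap.toContinuousLinearMap ((mat (𝔤 := 𝔤)).toLinearMap ∘ₗ
        (LieAlgebra.ad ℝ 𝔤 : 𝔤 →ₗ[ℝ] Module.End ℝ 𝔤) ∘ₗ ε.toLinearMap)
    let M : (Fin (Module.finrank ℝ 𝔤) → ℝ) →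
        Matrix (Fin (Module.finrank ℝ 𝔤)) (Fin (Module.finrank ℝ 𝔤)) ℝ :=
      fun v => mat (x : 𝔤 →ₗ[ℝ] 𝔤) * NormedSpace.exp (L v)
    have hM : AnalyticAt ℝ M 0 :=
      analyticAt_const.mul ((NormedSpace.exp_analytic (𝕂 := ℝ) (L 0)).comp (L.analyticAt 0))
    have hM0 : M 0 = mat (x : 𝔤 →ₗ[ℝ] 𝔤) := by simp [M]
    have h1 : AnalyticAt ℝ (fun v => α (F (M v))) 0 := by
      have h2 := (hF α).1
      rw [← hM0] at h2
      exact h2.comp hM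
    refine h1.congr ?_
    have h3 : Tendsto M (𝓝 0) (𝓝 (mat (x : 𝔤 →ₗ[ℝ] 𝔤))) := by
      rw [← hM0]
      exact hM.continuousAt
    filter_upwards [h3.eventually hev'] with v hv
    exact (hv _ (G.mul_mem hx (hexp _)) (mat_mul_expAd x _)).symm
  · intro αv hαv Y
    let M : ℝ → Matrix (Fin (Module.finrank ℝ 𝔤)) (Fin (Module.finrank ℝ 𝔤)) ℝ :=
      fun t => mat (x : 𝔤 →ₗ[ℝ] 𝔤) * NormedSpace.exp (t • mat (LieAlgebra.ad ℝ 𝔤 Y))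
    have hM : HasDerivAt M (mat (x : 𝔤 →ₗ[ℝ] 𝔤) * mat (LieAlgebra.ad ℝ 𝔤 Y)) 0 := by
      have := (hasDerivAt_exp_smul_const (𝕂 := ℝ) (mat (LieAlgebra.ad ℝ 𝔤 Y)) (0 : ℝ)).const_mul
        (mat (x : 𝔤 →ₗ[ℝ] 𝔤))
      rwa [zero_smul, NormedSpace.exp_zero, one_mul] at this
    have hM0 : M 0 = mat (x : 𝔤 →ₗ[ℝ] 𝔤) := by simp [M]
    have h2 : HasFDerivAt (fun m => α (F m)) (fderiv ℝ (fun m => α (F m)) (mat (x : 𝔤 →ₗ[ℝ] 𝔤)))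
        (M 0) := by
      rw [hM0]
      exact (hF α).1.differentiableAt.hasFDerivAt
    have h4 := (h2.comp_hasDerivAt (0 : ℝ) hM).congr_deriv ((hF α).2 αv hαv Y)
    refine h4.congr_of_eventuallyEq ?_
    have h3 : Tendsto M (𝓝 0) (𝓝 (mat (x : 𝔤 →ₗ[ℝ] 𝔤))) := by
      rw [← hM0]
      exact hM.continuousAt
    filter_upwards [h3.eventually hev'] with t ht
    refine ht _ (G.mul_mem hx (hexp _)) ?_
    rw [mat_mul_expAd, map_smul, map_smul]

end LocalProjection

/-! ### Multiplicity of the eigenvalue 1, by analytic continuation. -/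

section Rank

open Filter Topology

attribute [local instance] Matrix.linftyOpNormedRing Matrix.linftyOpNormedAlgebra

section Analytic

variable {𝕜 : Type*} [RCLike 𝕜]

theorem analyticAt_list_prod {A ι : Type*} [NormedRing A] [NormedAlgebra 𝕜 A] (l : List ι)
    {F : ι → 𝕜 → A} {s : 𝕜} (h : ∀ i, AnalyticAt 𝕜 (F i) s) :
    AnalyticAt 𝕜 (fun s => (l.map fun i => F i s).prod) s := by
  induction l with
  | nil => exact analyticAt_const
  | cons i l ih =>
    simp only [List.map_cons, List.prod_cons]
    exact (h i).mul ih

/-- The coefficients of the characteristic polynomial are polynomials in the matrix entries. -/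
theorem analyticAt_charpoly_coeff {n : ℕ} {M : 𝕜 → Matrix (Fin n) (Fin n) 𝕜} {s : 𝕜}
    (hM : AnalyticAt 𝕜 M s) (k : ℕ) : AnalyticAt 𝕜 (fun s => (M s).charpoly.coeff k) s := by
  have h1 : ∀ ij : Fin n × Fin n, AnalyticAt 𝕜 (fun s => M s ij.1 ij.2) s := fun ij =>
    ((LinearMap.toContinuousLinearMap
      (Matrix.entryLinearMap 𝕜 𝕜 ij.1 ij.2)).analyticAt _).comp hM
  refine (AnalyticAt.aeval_mvPolynomial h1 ((Matrix.charpoly.univ 𝕜 (Fin n)).coeff k)).congr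
    (Eventually.of_forall fun s => ?_)
  have := Matrix.charpoly.univ_coeff_eval₂Hom (Fin n) (RingHom.id 𝕜)
    (fun ij => M s ij.1 ij.2) k
  refine Eq.trans ?_ this
  rfl

variable {L : Type*} [LieRing L] [LieAlgebra 𝕜 L] [FiniteDimensional 𝕜 L]

/-- The product of the `exp (ad (X + s Y))` for `(X, Y)` in a list. -/
def prodExp (l : List (L × L)) (s : 𝕜) : L ≃ₗ[𝕜] L :=
  (l.map fun p => expAd 𝕜 (p.1 + s • p.2)).prod

theorem analyticAt_toMatrix_prodExp (l : List (L × L)) (s : 𝕜) :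
    AnalyticAt 𝕜 (fun s => LinearMap.toMatrixAlgEquiv (Module.finBasis 𝕜 L)
      (prodExp l s : L →ₗ[𝕜] L)) s := by
  let T : L →ₗ[𝕜] Matrix (Fin (Module.finrank 𝕜 L)) (Fin (Module.finrank 𝕜 L)) 𝕜 :=
    (LinearMap.toMatrixAlgEquiv (Module.finBasis 𝕜 L)).toLinearMap ∘ₗ
      (LieAlgebra.ad 𝕜 L : L →ₗ[𝕜] Module.End 𝕜 L)
  have h1 : ∀ s : 𝕜, LinearMap.toMatrixAlgEquiv (Module.finBasis 𝕜 L)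
      (prodExp l s : L →ₗ[𝕜] L) =
      (l.map fun p => NormedSpace.exp (T p.1 + s • T p.2)).prod := by
    intro s
    unfold prodExp
    induction l with
    | nil => exact map_one (LinearMap.toMatrixAlgEquiv (Module.finBasis 𝕜 L))
    | cons p l ih =>
      rw [List.map_cons, List.prod_cons, List.map_cons, List.prod_cons, ← ih, ← map_smul, ← map_add]
      refine (map_mul (LinearMap.toMatrixAlgEquiv (Module.finBasis 𝕜 L))
        (expAd 𝕜 (p.1 + s • p.2) : L →ₗ[𝕜] L) _).trans ?_
      congr 1
      change LinearMap.toMatrix _ _ (Matrix.toLin _ _ _) = _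
      rw [LinearMap.toMatrix_toLin]
      rfl
  simp only [h1]
  refine analyticAt_list_prod l fun p => ?_
  exact (NormedSpace.exp_analytic (𝕂 := 𝕜) _).comp
    (analyticAt_const.add (analyticAt_id.smul analyticAt_const))

theorem analyticAt_charpoly_coeff_prodExp (l : List (L × L)) (k : ℕ) (s : 𝕜) :
    AnalyticAt 𝕜 (fun s => ((prodExp l s : L →ₗ[𝕜] L) - 1).charpoly.coeff k) s := by
  have hM : AnalyticAt 𝕜 (fun s => LinearMap.toMatrixAlgEquiv (Module.finBasis 𝕜 L)
      (prodExp l s : L →ₗ[𝕜] L) - 1) s :=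
    (analyticAt_toMatrix_prodExp l s).sub analyticAt_const
  have heq : (fun s : 𝕜 => ((prodExp l s : L →ₗ[𝕜] L) - 1).charpoly.coeff k) =
      fun s : 𝕜 => (LinearMap.toMatrixAlgEquiv (Module.finBasis 𝕜 L)
        (prodExp l s : L →ₗ[𝕜] L) - 1).charpoly.coeff k := by
    funext s
    rw [← map_one (LinearMap.toMatrixAlgEquiv (Module.finBasis 𝕜 L)), ← map_sub]
    exact congrArg (Polynomial.coeff · k)
      (LinearMap.charpoly_toMatrix _ (Module.finBasis 𝕜 L)).symm
  rw [heq]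
  exact analyticAt_charpoly_coeff hM k

theorem prodExp_mem (l : List (L × L)) (s : 𝕜) : prodExp l s ∈ innerGroup 𝕜 L :=
  Subgroup.list_prod_mem _ fun x hx => by
    obtain ⟨p, -, rfl⟩ := List.mem_map.1 hx
    exact Subgroup.subset_closure ⟨_, rfl⟩

theorem exists_list_of_mem_innerGroup {x : L ≃ₗ[𝕜] L} (hx : x ∈ innerGroup 𝕜 L) :
    ∃ l : List L, (l.map (expAd 𝕜)).prod = x := by
  induction hx using Subgroup.closure_induction_left with
  | one => exact ⟨[], rfl⟩
  | mul_left y hy z _ ih =>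
    obtain ⟨Y, rfl⟩ := hy
    obtain ⟨l, rfl⟩ := ih
    exact ⟨Y :: l, rfl⟩
  | inv_mul_cancel y hy z _ ih =>
    obtain ⟨Y, rfl⟩ := hy
    obtain ⟨l, rfl⟩ := ih
    exact ⟨-Y :: l, by rw [List.map_cons, List.prod_cons, expAd_neg]⟩

end Analytic

variable {𝔤 : Type*} [LieRing 𝔤] [LieAlgebra ℝ 𝔤] [FiniteDimensional ℝ 𝔤]
variable {B : LinearMap.BilinForm ℝ 𝔤} {θ : 𝔤 ≃ₗ⁅ℝ⁆ 𝔤} {𝔞 : Submodule ℝ 𝔤}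
variable {P : Set (Module.Dual ℝ 𝔞)} {G : Subgroup (𝔤 ≃ₗ[ℝ] 𝔤)}

/-- The order of vanishing of the characteristic polynomial at 0 is the dimension of the generalized
kernel, which here contains the conjugate e(𝔞). -/
theorem charpoly_coeff_conj_exp (h : IsSplitCartan B θ 𝔞) (e : 𝔤 ≃ₗ[ℝ] 𝔤) (A : 𝔞) {k : ℕ}
    (hk : k < Module.finrank ℝ 𝔞) :
    (((e * expAd ℝ (A : 𝔤) * e⁻¹ : 𝔤 ≃ₗ[ℝ] 𝔤) : 𝔤 →ₗ[ℝ] 𝔤) - 1).charpoly.coeff k = 0 := by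
  apply Polynomial.coeff_eq_zero_of_lt_natTrailingDegree
  rw [← LinearMap.finrank_maxGenEigenspace_zero_eq]
  refine hk.trans_le ?_
  rw [← LinearEquiv.finrank_map_eq e 𝔞]
  refine Submodule.finrank_mono ?_
  rintro _ ⟨X, hX, rfl⟩
  refine Module.End.mem_maxGenEigenspace _ _ _ |>.2 ⟨1, ?_⟩
  rw [zero_smul, sub_zero, pow_one]
  change e (expAd ℝ (A : 𝔤) (e⁻¹ (e X))) - e X = 0
  rw [inv_apply_apply, expAd_apply_of_lie_eq_zero (h.comm _ A.2 _ hX), sub_self]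

theorem charpoly_coeff_prod_expAd (h : IsSplitCartan B θ 𝔞) (hP : IsPositivity P) (l : List 𝔤)
    {k : ℕ} (hk : k < Module.finrank ℝ 𝔞) :
    ((((l.map (expAd ℝ)).prod : 𝔤 ≃ₗ[ℝ] 𝔤) : 𝔤 →ₗ[ℝ] 𝔤) - 1).charpoly.coeff k = 0 := by
  obtain ⟨A₀, hA₀⟩ := chamber_nonempty h hP
  -- The curve s ↦ exp((1 - s) A₀) ∏ exp(s Xᵢ) runs from exp A₀ to the given product. Near s = 0 its
  -- values are conjugate into exp 𝔞, so the coefficient vanishes there and, being analytic,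
  -- everywhere.
  let l' : List (𝔤 × 𝔤) := ((A₀ : 𝔤), -(A₀ : 𝔤)) :: l.map fun X => (0, X)
  have h0 : prodExp l' (0 : ℝ) = expAd ℝ (A₀ : 𝔤) := by
    simp [prodExp, l', expAd_zero, Function.comp_def]
  have h1 : prodExp l' (1 : ℝ) = (l.map (expAd ℝ)).prod := by
    simp [prodExp, l', expAd_zero, Function.comp_def]
  obtain ⟨Λ, -, -, hev⟩ := exists_local_conjugation h (A₀ := A₀)
    (mem_of_lie_eq_zero_of_regular h fun β hβ => ne_zero_of_mem_chamber h hP hA₀ hβ)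
  have hcont : Tendsto (fun s : ℝ => mat (prodExp l' s : 𝔤 →ₗ[ℝ] 𝔤)) (𝓝 0)
      (𝓝 (mat (expAd ℝ (A₀ : 𝔤) : 𝔤 →ₗ[ℝ] 𝔤))) := by
    rw [← h0]
    exact (analyticAt_toMatrix_prodExp l' (0 : ℝ)).continuousAt
  have hzero := AnalyticOnNhd.eq_of_eventuallyEq (𝕜 := ℝ) (z₀ := 0)
    (fun s _ => analyticAt_charpoly_coeff_prodExp l' k s)
    (fun s _ => analyticAt_const (v := (0 : ℝ))) (by
      filter_upwards [hcont.eventually hev] with s hs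
      obtain ⟨X, hX⟩ := hs _ (innerGroup_lie (prodExp_mem l' s)) rfl
      rw [hX]
      exact charpoly_coeff_conj_exp h _ _ hk)
  rw [← h1]
  exact congrFun hzero 1

theorem prod_expAd_baseChange (l : List 𝔤) :
    (((l.map fun X => expAd ℂ ((1 : ℂ) ⊗ₜ[ℝ] X)).prod : (ℂ ⊗[ℝ] 𝔤) ≃ₗ[ℂ] (ℂ ⊗[ℝ] 𝔤)) :
      (ℂ ⊗[ℝ] 𝔤) →ₗ[ℂ] (ℂ ⊗[ℝ] 𝔤)) =
      LinearMap.baseChange ℂ ((l.map (expAd ℝ)).prod : 𝔤 ≃ₗ[ℝ] 𝔤).toLinearMap := by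
  induction l with
  | nil => exact LinearMap.baseChange_id.symm
  | cons X l ih =>
    rw [List.map_cons, List.prod_cons, List.map_cons, List.prod_cons, ← baseChange_expAd]
    refine Eq.trans ?_ (LinearMap.baseChange_mul (A := ℂ) (expAd ℝ X).toLinearMap
      ((l.map (expAd ℝ)).prod : 𝔤 ≃ₗ[ℝ] 𝔤).toLinearMap).symm
    rw [← ih]
    rfl

theorem baseChange_sub_one (f : Module.End ℝ 𝔤) :
    (LinearMap.baseChange ℂ f : Module.End ℂ (ℂ ⊗[ℝ] 𝔤)) - 1 =
      LinearMap.baseChange ℂ (f - 1) := by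
  rw [LinearMap.baseChange_sub]
  congr 1
  exact LinearMap.baseChange_id.symm

theorem exists_re_im (Z : ℂ ⊗[ℝ] 𝔤) :
    ∃ X Y : 𝔤, Z = (1 : ℂ) ⊗ₜ[ℝ] X + Complex.I • ((1 : ℂ) ⊗ₜ[ℝ] Y) := by
  induction Z using TensorProduct.induction_on with
  | zero => exact ⟨0, 0, by simp⟩
  | tmul z X =>
    refine ⟨z.re • X, z.im • X, ?_⟩
    rw [TensorProduct.smul_tmul', ← TensorProduct.smul_tmul, ← TensorProduct.smul_tmul,
      ← TensorProduct.add_tmul]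
    congr 1
    apply Complex.ext <;> simp
  | add Z W hZ hW =>
    obtain ⟨X, Y, rfl⟩ := hZ
    obtain ⟨X', Y', rfl⟩ := hW
    refine ⟨X + X', Y + Y', ?_⟩
    rw [TensorProduct.tmul_add, TensorProduct.tmul_add, smul_add]
    abel

/-- Write each exponent as X + iY and replace i by a complex variable z. For real z the product is
the complexification of a real one, so the coefficient vanishes on ℝ, hence at z = i. -/
theorem charpoly_coeff_complex (h : IsSplitCartan B θ 𝔞) (hP : IsPositivity P)
    {x : (ℂ ⊗[ℝ] 𝔤) ≃ₗ[ℂ] (ℂ ⊗[ℝ] 𝔤)} (hx : x ∈ innerGroup ℂ (ℂ ⊗[ℝ] 𝔤))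
    {k : ℕ} (hk : k < Module.finrank ℝ 𝔞) :
    ((x : (ℂ ⊗[ℝ] 𝔤) →ₗ[ℂ] (ℂ ⊗[ℝ] 𝔤)) - 1).charpoly.coeff k = 0 := by
  obtain ⟨l, rfl⟩ := exists_list_of_mem_innerGroup hx
  choose re im hre using exists_re_im (𝔤 := 𝔤)
  let l' : List ((ℂ ⊗[ℝ] 𝔤) × (ℂ ⊗[ℝ] 𝔤)) :=
    l.map fun Z => ((1 : ℂ) ⊗ₜ[ℝ] re Z, (1 : ℂ) ⊗ₜ[ℝ] im Z)
  have hI : prodExp l' Complex.I = (l.map (expAd ℂ)).prod := by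
    simp only [prodExp, l', List.map_map, Function.comp_def, ← hre]
  have hreal : ∀ t : ℝ, ((prodExp l' (t : ℂ) : (ℂ ⊗[ℝ] 𝔤) →ₗ[ℂ] (ℂ ⊗[ℝ] 𝔤)) -
      1).charpoly.coeff k = 0 := by
    intro t
    have h1 : prodExp l' (t : ℂ) = ((l.map fun Z => re Z + t • im Z).map
        fun X => expAd ℂ ((1 : ℂ) ⊗ₜ[ℝ] X)).prod := by
      simp only [prodExp, l', List.map_map, Function.comp_def, TensorProduct.tmul_add,
        TensorProduct.tmul_smul]
      rfl
    rw [h1, prod_expAd_baseChange, baseChange_sub_one, LinearMap.charpoly_baseChange,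
      Polynomial.coeff_map]
    refine (congrArg _ (charpoly_coeff_prod_expAd h hP _ hk)).trans (map_zero _)
  have hfreq : ∃ᶠ z : ℂ in 𝓝[≠] 0, ((prodExp l' z : (ℂ ⊗[ℝ] 𝔤) →ₗ[ℂ] (ℂ ⊗[ℝ] 𝔤)) -
      1).charpoly.coeff k = 0 := by
    have ht : Tendsto (fun t : ℝ => (t : ℂ)) (𝓝[≠] 0) (𝓝[≠] 0) := by
      refine tendsto_nhdsWithin_of_tendsto_nhds_of_eventually_within _ ?_ ?_
      · have := Complex.continuous_ofReal.tendsto 0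
        rw [Complex.ofReal_zero] at this
        exact this.mono_left nhdsWithin_le_nhds
      · filter_upwards [self_mem_nhdsWithin] with t ht
        simpa using ht
    exact ht.frequently (Eventually.of_forall hreal).frequently
  have hzero := AnalyticOnNhd.eq_of_frequently_eq (𝕜 := ℂ) (z₀ := 0)
    (fun s _ => analyticAt_charpoly_coeff_prodExp l' k s)
    (fun s _ => analyticAt_const (v := (0 : ℂ))) hfreq
  rw [← hI]
  exact congrFun hzero Complex.I

/-- Every element of a split real form has a fixed-point multiplicity of at least the rank. -/
theorem finrank_le_finrank_maxGenEigenspace (h : IsSplitCartan B θ 𝔞) (hP : IsPositivity P)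
    (hG : IsRealForm G) {x : 𝔤 ≃ₗ[ℝ] 𝔤} (hx : x ∈ G) :
    Module.finrank ℝ 𝔞 ≤
      Module.finrank ℝ (Module.End.maxGenEigenspace (x : 𝔤 →ₗ[ℝ] 𝔤) 1) := by
  have h1 : Module.End.maxGenEigenspace (x : 𝔤 →ₗ[ℝ] 𝔤) 1 =
      Module.End.maxGenEigenspace ((x : 𝔤 →ₗ[ℝ] 𝔤) - 1) 0 := by
    ext v
    simp only [Module.End.mem_maxGenEigenspace, zero_smul, one_smul, sub_zero]
  rw [h1, LinearMap.finrank_maxGenEigenspace_zero_eq]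
  refine Polynomial.le_natTrailingDegree (LinearMap.charpoly_monic _).ne_zero fun k hk => ?_
  have h2 := charpoly_coeff_complex h hP (hG.baseChange_mem x hx) hk
  have h3 : ((LinearEquiv.baseChange ℝ ℂ 𝔤 𝔤 x : (ℂ ⊗[ℝ] 𝔤) →ₗ[ℂ] (ℂ ⊗[ℝ] 𝔤))) =
      LinearMap.baseChange ℂ (x : 𝔤 →ₗ[ℝ] 𝔤) := rfl
  rw [h3, baseChange_sub_one, LinearMap.charpoly_baseChange, Polynomial.coeff_map] at h2
  exact (map_eq_zero_iff _ (algebraMap ℝ ℂ).injective).1 h2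

end Rank

/-! ### Chamber-preserving elements of G act trivially on 𝔞. -/

section Normalizer

open Filter Topology

section Projection

variable {V ι : Type*} [AddCommGroup V] [Module ℝ V] [Fintype ι]

open Classical in
/-- The projection onto the span of the basis vectors selected by `p`. -/
def coordProj (b : Module.Basis ι ℝ V) (p : ι → Prop) : Module.End ℝ V :=
  b.constr ℝ fun i => if p i then b i else 0

open Classical in
theorem coordProj_repr (b : Module.Basis ι ℝ V) (p : ι → Prop) (v : V) (j : ι) :
    b.repr (coordProj b p v) j = if p j then b.repr v j else 0 := by
  have : b.coord j ∘ₗ coordProj b p = if p j then b.coord j else 0 := by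
    refine b.ext fun i => ?_
    rw [LinearMap.comp_apply, coordProj, Module.Basis.constr_basis]
    by_cases hij : i = j
    · subst hij; split_ifs <;> simp
    · split_ifs <;> simp [hij]
  have h2 := LinearMap.congr_fun this v
  rw [LinearMap.comp_apply, Module.Basis.coord_apply] at h2
  rw [h2]
  split_ifs <;> simp

theorem coordProj_commute (b : Module.Basis ι ℝ V) (p : ι → Prop) (f : Module.End ℝ V)
    (hf : ∀ i j, b.repr (f (b i)) j ≠ 0 → (p i ↔ p j)) : Commute (coordProj b p) f := by
  refine b.ext fun i => b.repr.injective (Finsupp.ext fun j => ?_)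
  rw [Module.End.mul_apply, Module.End.mul_apply, coordProj_repr, coordProj,
    Module.Basis.constr_basis]
  by_cases h0 : b.repr (f (b i)) j = 0
  · split_ifs <;> simp [h0]
  · have := hf i j h0
    by_cases hj : p j
    · rw [if_pos hj, if_pos (this.2 hj)]
    · rw [if_neg hj, if_neg (mt this.1 hj), map_zero, map_zero, Finsupp.zero_apply]

/-- N preserves the image of π and is injective there, so its generalized kernel projects to zero.
-/
theorem eq_zero_of_pow_apply_eq_zero {π N : Module.End ℝ V} (hc : Commute π N)
    (hπ : ∀ v, π (π v) = π v) (hinj : ∀ u, π u = u → N u = 0 → u = 0) (k : ℕ) (v : V)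
    (hv : (N ^ k) v = 0) : π v = 0 := by
  have hck : ∀ k u, π ((N ^ k) u) = (N ^ k) (π u) := fun k u =>
    LinearMap.congr_fun (hc.pow_right k).eq u
  have key : ∀ k, ∀ u, π u = u → (N ^ k) u = 0 → u = 0 := by
    intro k
    induction k with
    | zero => intro u _ h; exact h
    | succ k ih =>
      intro u hu h
      refine ih u hu (hinj _ (by rw [hck, hu]) ?_)
      rwa [pow_succ', Module.End.mul_apply] at h
  exact key k _ (hπ v) (by rw [← hck, hv, map_zero])

end Projection

variable {𝔤 : Type*} [LieRing 𝔤] [LieAlgebra ℝ 𝔤] [FiniteDimensional ℝ 𝔤]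
variable {B : LinearMap.BilinForm ℝ 𝔤} {θ : 𝔤 ≃ₗ⁅ℝ⁆ 𝔤} {𝔞 : Submodule ℝ 𝔤}
variable {P : Set (Module.Dual ℝ 𝔞)} {G : Subgroup (𝔤 ≃ₗ[ℝ] 𝔤)}

theorem exists_root_basis (h : IsSplitCartan B θ 𝔞) :
    ∃ (b : Module.Basis (Fin (Module.finrank ℝ 𝔤)) ℝ 𝔤)
      (β : Fin (Module.finrank ℝ 𝔤) → Module.Dual ℝ 𝔞),
      (∀ i, β i = 0 ∨ IsRoot (β i)) ∧ ∀ i (A : 𝔞), ⁅(A : 𝔤), b i⁆ = β i A • b i := by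
  let S : Set 𝔤 := {v | ∃ β : Module.Dual ℝ 𝔞, (β = 0 ∨ IsRoot β) ∧
    ∀ A : 𝔞, ⁅(A : 𝔤), v⁆ = β A • v}
  have hS : ⊤ ≤ Submodule.span ℝ S := by
    rw [← root_decomposition h]
    refine sup_le (fun X hX => Submodule.subset_span ⟨0, Or.inl rfl, fun A => ?_⟩)
      (iSup₂_le fun β hβ X hX => Submodule.subset_span ⟨β, Or.inr hβ, hX⟩)
    rw [h.comm _ A.2 _ hX, LinearMap.zero_apply, zero_smul]
  let b' := Module.Basis.ofSpan hS
  let b := b'.reindex (Fintype.equivFinOfCardEq (Module.finrank_eq_card_basis b').symm)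
  have hb : ∀ i, b i ∈ S := fun i => by
    rw [Module.Basis.reindex_apply]
    exact Module.Basis.ofSpan_subset hS ⟨_, rfl⟩
  choose β h1 h2 using hb
  exact ⟨b, β, h1, h2⟩

section RootBasis

variable {b : Module.Basis (Fin (Module.finrank ℝ 𝔤)) ℝ 𝔤}
  {β : Fin (Module.finrank ℝ 𝔤) → Module.Dual ℝ 𝔞}

theorem repr_lie (hb : ∀ i (A : 𝔞), ⁅(A : 𝔤), b i⁆ = β i A • b i) (A : 𝔞) (v : 𝔤)
    (i : Fin (Module.finrank ℝ 𝔤)) : b.repr ⁅(A : 𝔤), v⁆ i = β i A * b.repr v i := by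
  have : b.coord i ∘ₗ LieAlgebra.ad ℝ 𝔤 (A : 𝔤) = β i A • b.coord i := by
    refine b.ext fun j => ?_
    by_cases hij : j = i
    · subst hij; simp [hb]
    · simp [hb, hij]
  exact LinearMap.congr_fun this v

theorem repr_expAd (hb : ∀ i (A : 𝔞), ⁅(A : 𝔤), b i⁆ = β i A • b i) (A : 𝔞) (v : 𝔤)
    (i : Fin (Module.finrank ℝ 𝔤)) :
    b.repr (expAd ℝ (A : 𝔤) v) i = Real.exp (β i A) * b.repr v i := by
  have : b.coord i ∘ₗ (expAd ℝ (A : 𝔤)).toLinearMap = Real.exp (β i A) • b.coord i := by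
    refine b.ext fun j => ?_
    change b.coord i (expAd ℝ (A : 𝔤) (b j)) = _
    rw [expAd_real_eigen (hb j A)]
    by_cases hij : j = i
    · subst hij; simp
    · simp [hij]
  exact LinearMap.congr_fun this v

theorem mem_iff_repr (h : IsSplitCartan B θ 𝔞) (hP : IsPositivity P)
    (hb0 : ∀ i, β i = 0 ∨ IsRoot (β i))
    (hb : ∀ i (A : 𝔞), ⁅(A : 𝔤), b i⁆ = β i A • b i) (v : 𝔤) :
    v ∈ 𝔞 ↔ ∀ i, β i ≠ 0 → b.repr v i = 0 := by
  constructor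
  · intro hv i hi
    obtain ⟨A₀, hA₀⟩ := chamber_nonempty h hP
    have h1 := repr_lie hb A₀ v i
    rw [h.comm _ A₀.2 _ hv, map_zero, Finsupp.zero_apply, zero_eq_mul] at h1
    exact h1.resolve_left (ne_zero_of_mem_chamber h hP hA₀ ((hb0 i).resolve_left hi))
  · refine fun hv => h.split v fun A hA => b.repr.injective (Finsupp.ext fun i => ?_)
    rw [repr_lie hb ⟨A, hA⟩, map_zero, Finsupp.zero_apply]
    by_cases hi : β i = 0
    · rw [hi, LinearMap.zero_apply, zero_mul]
    · rw [hv i hi, mul_zero]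

end RootBasis

theorem exists_bound {n : ℕ} (b : Module.Basis (Fin n) ℝ 𝔤) (f : 𝔤 →ₗ[ℝ] 𝔤) :
    ∃ K : ℝ, 0 < K ∧ ∀ v, ‖b.equivFun (f v)‖ ≤ K * ‖b.equivFun v‖ := by
  let F := LinearMap.toContinuousLinearMap
    (b.equivFun.toLinearMap ∘ₗ f ∘ₗ b.equivFun.symm.toLinearMap)
  refine ⟨‖F‖ + 1, by positivity, fun v => ?_⟩
  have h1 := F.le_opNorm (b.equivFun v)
  have h2 : F (b.equivFun v) = b.equivFun (f v) := by simp [F]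
  rw [h2] at h1
  nlinarith [norm_nonneg (b.equivFun v)]

/-- An element of a split real form which normalizes `𝔞` and maps a point of the open chamber into
the open chamber centralizes `𝔞`. -/
theorem apply_eq_self_of_chamber (h : IsSplitCartan B θ 𝔞) (hP : IsPositivity P)
    (hG : IsRealForm G) (hB : ∀ x ∈ G, ∀ X Y : 𝔤, B (x X) (x Y) = B X Y)
    {g : 𝔤 ≃ₗ[ℝ] 𝔤} (hg : g ∈ G) (hg𝔞 : ∀ X ∈ 𝔞, g X ∈ 𝔞) {A A' : 𝔞} (hA : A ∈ chamber P)
    (hA' : A' ∈ chamber P) (hgA : g (A : 𝔤) = A') : ∀ X ∈ 𝔞, g X = X := by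
  obtain ⟨b, β, hb0, hb⟩ := exists_root_basis h
  have hsign : ∀ i, (0 < β i A ↔ 0 < β i A') ∧ (β i A < 0 ↔ β i A' < 0) := by
    intro i
    rw [mem_chamber_iff h hP] at hA hA'
    rcases hb0 i with hi | hi
    · simp [hi]
    · rcases hP.pos_or_neg _ hi.1 with hp | hp
      · have h1 := hA _ ⟨hi, hp⟩
        have h2 := hA' _ ⟨hi, hp⟩
        exact ⟨by tauto, ⟨fun h3 => absurd h1 h3.not_gt, fun h3 => absurd h2 h3.not_gt⟩⟩
      · have h1 := hA _ ⟨isRoot_neg h hi, hp⟩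
        have h2 := hA' _ ⟨isRoot_neg h hi, hp⟩
        rw [LinearMap.neg_apply] at h1 h2
        constructor <;> constructor <;> intro <;> linarith
  -- Since g maps A to A', it carries the β(A)-eigenspace of ad A to that of ad A'. With `hsign` it
  -- therefore preserves the positive, zero and negative blocks.
  have hentry : ∀ i j, b.repr (g (b i)) j ≠ 0 → β i A = β j A' := by
    intro i j hij
    have h1 := repr_lie hb A' (g (b i)) j
    rw [← hgA, ← hG.map_lie hg, hb, map_smul, map_smul, Finsupp.smul_apply, smul_eq_mul] at h1
    exact mul_right_cancel₀ hij h1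
  obtain ⟨K, hK0, hK⟩ := exists_bound b g.toLinearMap
  obtain ⟨K', hK0', hK'⟩ := exists_bound b (g⁻¹ : 𝔤 ≃ₗ[ℝ] 𝔤).toLinearMap
  -- For large c, exp(cA) expands the positive block by at least 2K' and contracts the negative one
  -- by at least 2K. This beats the bounds for g⁻¹ and g, so g exp(cA) fixes no nonzero vector in
  -- either block.
  have hpos : ∀ᶠ c : ℝ in atTop, ∀ i, 0 < β i A → 2 * K' ≤ Real.exp (c * β i A) := by
    refine eventually_all.2 fun i => ?_
    by_cases hi : 0 < β i A
    · exact ((Real.tendsto_exp_atTop.comp (tendsto_id.atTop_mul_const hi)).eventually_ge_atTop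
        (2 * K')).mono fun c hc _ => hc
    · exact Eventually.of_forall fun c hc => absurd hc hi
  have hneg : ∀ᶠ c : ℝ in atTop, ∀ i, β i A < 0 → Real.exp (c * β i A) ≤ (2 * K)⁻¹ := by
    refine eventually_all.2 fun i => ?_
    by_cases hi : β i A < 0
    · have h1 : (0 : ℝ) < (2 * K)⁻¹ := by positivity
      exact ((Real.tendsto_exp_atBot.comp
        (tendsto_id.atTop_mul_const_of_neg hi)).eventually_le_const h1).mono fun c hc _ => hc
    · exact Eventually.of_forall fun c hc => absurd hc hi
  obtain ⟨c, hc1, hc2⟩ := (hpos.and hneg).exists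
  let e := expAd ℝ ((c • A : 𝔞) : 𝔤)
  have hee : ∀ v i, b.repr (e v) i = Real.exp (c * β i A) * b.repr v i := fun v i => by
    rw [repr_expAd hb, map_smul, smul_eq_mul]
  let k := g * e
  have hkG : k ∈ G := G.mul_mem hg (hG.expAd_mem _)
  have hkv : ∀ v, k v = g (e v) := fun v => rfl
  let N : Module.End ℝ 𝔤 := k.toLinearMap - 1
  have hNv : ∀ v, N v = k v - v := fun v => rfl
  have hcomm : ∀ p : Fin (Module.finrank ℝ 𝔤) → Prop,
      (∀ i j, b.repr (g (b i)) j ≠ 0 → (p i ↔ p j)) → Commute (coordProj b p) N := by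
    intro p hp
    refine (coordProj_commute b p _ fun i j hij => hp i j fun h0 => hij ?_).sub_right
      (Commute.one_right _)
    change b.repr (g (e (b i))) j = 0
    have : e (b i) = Real.exp (β i (c • A)) • b i := expAd_real_eigen (hb i _)
    rw [this, map_smul, map_smul, Finsupp.smul_apply, h0, smul_zero]
  have hidem : ∀ p v, coordProj b p (coordProj b p v) = coordProj b p v := by
    intro p v
    refine b.repr.injective (Finsupp.ext fun j => ?_)
    rw [coordProj_repr, coordProj_repr]
    split_ifs <;> rfl
  have hsupp : ∀ p u, coordProj b p u = u → ∀ j, ¬ p j → b.repr u j = 0 := by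
    intro p u hu j hj
    rw [← hu, coordProj_repr, if_neg hj]
  have hzero_pos : ∀ m v, (N ^ m) v = 0 → coordProj b (fun i => 0 < β i A) v = 0 := by
    refine eq_zero_of_pow_apply_eq_zero (hcomm _ fun i j hij => ?_) (hidem _) fun u hu hNu => ?_
    · rw [hentry i j hij, (hsign j).1]
    · have h1 : e u = g⁻¹ u := by
        rw [hNv, sub_eq_zero, hkv] at hNu
        conv_rhs => rw [← hNu]
        rw [inv_apply_apply]
      have h2 : ‖b.equivFun u‖ ≤ 2⁻¹ * ‖b.equivFun u‖ := by
        refine (pi_norm_le_iff_of_nonneg (by positivity)).2 fun i => ?_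
        change ‖b.repr u i‖ ≤ _
        by_cases hi : 0 < β i A
        · have h3 := (norm_le_pi_norm (b.equivFun (g⁻¹ u)) i).trans (hK' u)
          rw [← h1, Module.Basis.equivFun_apply, hee, norm_mul, Real.norm_of_nonneg
            (Real.exp_pos _).le] at h3
          have h4 := hc1 i hi
          have h5 := mul_le_mul_of_nonneg_right h4 (norm_nonneg (b.repr u i))
          have h6 : K' * (2 * ‖b.repr u i‖) ≤ K' * ‖b.equivFun u‖ := by linarith
          have h7 := le_of_mul_le_mul_left h6 hK0'
          linarith
        · rw [hsupp _ u hu i hi, norm_zero]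
          positivity
      have h3 : b.equivFun u = 0 := norm_le_zero_iff.1 (by linarith)
      exact b.equivFun.map_eq_zero_iff.1 h3
  have hzero_neg : ∀ m v, (N ^ m) v = 0 → coordProj b (fun i => β i A < 0) v = 0 := by
    refine eq_zero_of_pow_apply_eq_zero (hcomm _ fun i j hij => ?_) (hidem _) fun u hu hNu => ?_
    · rw [hentry i j hij, (hsign j).2]
    · have h1 : g (e u) = u := by rwa [hNv, sub_eq_zero, hkv] at hNu
      have h2 : ‖b.equivFun (e u)‖ ≤ (2 * K)⁻¹ * ‖b.equivFun u‖ := by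
        refine (pi_norm_le_iff_of_nonneg (by positivity)).2 fun i => ?_
        rw [Module.Basis.equivFun_apply, hee, norm_mul, Real.norm_of_nonneg (Real.exp_pos _).le]
        by_cases hi : β i A < 0
        · exact mul_le_mul (hc2 i hi) (norm_le_pi_norm (b.equivFun u) i) (norm_nonneg _)
            (by positivity)
        · rw [hsupp _ u hu i hi, norm_zero, mul_zero]
          positivity
      have h3 := (hK (e u)).trans (mul_le_mul_of_nonneg_left h2 hK0.le)
      have h4 : K * ((2 * K)⁻¹ * ‖b.equivFun u‖) = 2⁻¹ * ‖b.equivFun u‖ := by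
        field_simp
      rw [h4] at h3
      change ‖b.equivFun (g (e u))‖ ≤ _ at h3
      rw [h1] at h3
      have h5 : b.equivFun u = 0 := norm_le_zero_iff.1 (by linarith)
      exact b.equivFun.map_eq_zero_iff.1 h5
  have hle : Module.End.maxGenEigenspace (k : 𝔤 →ₗ[ℝ] 𝔤) 1 ≤ 𝔞 := by
    intro v hv
    obtain ⟨m, hm⟩ := (Module.End.mem_maxGenEigenspace _ _ _).1 hv
    rw [one_smul] at hm
    refine (mem_iff_repr h hP hb0 hb v).2 fun i hi => ?_
    have hroot := (hb0 i).resolve_left hi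
    rcases lt_or_gt_of_ne (ne_zero_of_mem_chamber h hP hA hroot) with hlt | hgt
    · have h1 := coordProj_repr b (fun i => β i A < 0) v i
      rwa [hzero_neg m v hm, map_zero, if_pos hlt, Finsupp.zero_apply, eq_comm] at h1
    · have h1 := coordProj_repr b (fun i => 0 < β i A) v i
      rwa [hzero_pos m v hm, map_zero, if_pos hgt, Finsupp.zero_apply, eq_comm] at h1
  -- This is where the complex inner group enters: the lower bound on the multiplicity of 1 turns
  -- the inclusion into an equality.
  have heq := Submodule.eq_of_le_of_finrank_le hle
    (finrank_le_finrank_maxGenEigenspace h hP hG hkG)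
  have hk𝔞 : ∀ X ∈ 𝔞, k X = g X := fun X hX => by
    rw [hkv, expAd_apply_of_lie_eq_zero (h.comm _ (c • A : 𝔞).2 _ hX)]
  have key : ∀ m, ∀ X ∈ 𝔞, (N ^ m) X = 0 → k X = X := by
    intro m
    induction m with
    | zero =>
      intro X _ h0
      have h1 : X = 0 := h0
      rw [h1, map_zero]
    | succ m ih =>
      intro X hX h0
      rw [pow_succ, Module.End.mul_apply] at h0
      have hw : N X ∈ 𝔞 := by
        rw [hNv, hk𝔞 X hX]
        exact 𝔞.sub_mem (hg𝔞 X hX) hX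
      have h1 := ih _ hw h0
      by_contra hne
      have h2 := h.form_pos hw (by rwa [hNv, sub_ne_zero])
      -- With w = (k - 1)X fixed by k, B(w, w) = B(kw, kX) - B(w, X) = 0, contradicting definiteness
      -- on 𝔞.
      have h3 : B (N X) (N X) = B (k (N X)) (k X) - B (N X) X := by
        conv_lhs => rw [hNv X, map_sub]
        rw [← hNv, h1]
      rw [h3, hB k hkG, sub_self] at h2
      exact lt_irrefl _ h2
  intro X hX
  have hX' : X ∈ Module.End.maxGenEigenspace (k : 𝔤 →ₗ[ℝ] 𝔤) 1 := heq ▸ hX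
  obtain ⟨m, hm⟩ := (Module.End.mem_maxGenEigenspace _ _ _).1 hX'
  rw [one_smul] at hm
  rw [← hk𝔞 X hX]
  exact key m X hX hm

end Normalizer

/-! ### Uniqueness of the Jordan projection. -/

section JordanUniqueness

variable {𝔤 : Type*} [LieRing 𝔤] [LieAlgebra ℝ 𝔤] [FiniteDimensional ℝ 𝔤]
variable {B : LinearMap.BilinForm ℝ 𝔤} {θ : 𝔤 ≃ₗ⁅ℝ⁆ 𝔤} {𝔞 : Submodule ℝ 𝔤}
variable {P : Set (Module.Dual ℝ 𝔞)} {G : Subgroup (𝔤 ≃ₗ[ℝ] 𝔤)}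

theorem ad_injective [LieAlgebra.IsKilling ℝ 𝔤] {X Y : 𝔤}
    (h : LieAlgebra.ad ℝ 𝔤 X = LieAlgebra.ad ℝ 𝔤 Y) : X = Y := by
  have h2 : X - Y ∈ LieAlgebra.center ℝ 𝔤 := fun Z => by
    rw [← lie_skew, ← LieAlgebra.ad_apply ℝ, map_sub, h, sub_self, LinearMap.zero_apply, neg_zero]
  rwa [LieAlgebra.center_eq_bot, LieSubmodule.mem_bot, sub_eq_zero] at h2

theorem iSup_eigenspace_ad_conj {u : 𝔤 ≃ₗ[ℝ] 𝔤} (hu : ∀ X Y, u ⁅X, Y⁆ = ⁅u X, u Y⁆) {X : 𝔤}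
    (hX : ⨆ μ : ℝ, Module.End.eigenspace (LieAlgebra.ad ℝ 𝔤 X) μ = ⊤) :
    ⨆ μ : ℝ, Module.End.eigenspace (LieAlgebra.ad ℝ 𝔤 (u X)) μ = ⊤ := by
  have h1 : Submodule.map (u : 𝔤 →ₗ[ℝ] 𝔤) ⊤ = ⊤ := by
    rw [Submodule.map_top, LinearEquiv.range]
  rw [eq_top_iff, ← h1, ← hX, Submodule.map_iSup]
  refine iSup_mono fun μ => ?_
  rintro _ ⟨v, hv, rfl⟩
  have hv := Module.End.mem_eigenspace_iff.1 hv
  rw [LieAlgebra.ad_apply] at hv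
  rw [Module.End.mem_eigenspace_iff, LieAlgebra.ad_apply]
  change ⁅u X, u v⁆ = μ • u v
  rw [← hu, hv, map_smul]

/-- The exponential map is injective on real-diagonalizable elements. -/
theorem eq_of_expAd_eq [LieAlgebra.IsKilling ℝ 𝔤] {X Y : 𝔤}
    (hX : ⨆ μ : ℝ, Module.End.eigenspace (LieAlgebra.ad ℝ 𝔤 X) μ = ⊤)
    (hY : ⨆ μ : ℝ, Module.End.eigenspace (LieAlgebra.ad ℝ 𝔤 Y) μ = ⊤)
    (h : expAd ℝ X = expAd ℝ Y) : X = Y :=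
  ad_injective (eq_of_expLin_eq hX hY (by rw [← coe_expAd, ← coe_expAd, h]))

/-- Both u X and X are real-diagonalizable with the same exponential, on which the exponential map
is injective. -/
theorem apply_eq_self_of_commute [LieAlgebra.IsKilling ℝ 𝔤] {u : 𝔤 ≃ₗ[ℝ] 𝔤}
    (hu : ∀ X Y, u ⁅X, Y⁆ = ⁅u X, u Y⁆) {X : 𝔤}
    (hX : ⨆ μ : ℝ, Module.End.eigenspace (LieAlgebra.ad ℝ 𝔤 X) μ = ⊤)
    (h : Commute u (expAd ℝ X)) : u X = X := by
  refine eq_of_expAd_eq (iSup_eigenspace_ad_conj hu hX) hX ?_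
  rw [← conj_expAd hu, h.eq, mul_inv_cancel_right]

/-- The witness is the last nonzero vector in the sequence (u - 1)ⁿ v. -/
theorem exists_fixed_of_unipotent {u : 𝔤 ≃ₗ[ℝ] 𝔤}
    (hu : IsNilpotent ((u : 𝔤 →ₗ[ℝ] 𝔤) - LinearMap.id)) {V : Submodule ℝ 𝔤}
    (hV : ∀ v ∈ V, u v ∈ V) {v : 𝔤} (hv : v ∈ V) (hv0 : v ≠ 0) :
    ∃ w ∈ V, w ≠ 0 ∧ u w = w := by
  classical
  obtain ⟨n, hn⟩ := hu
  set N : Module.End ℝ 𝔤 := (u : 𝔤 →ₗ[ℝ] 𝔤) - LinearMap.id with hN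
  have hex : ∃ n, (N ^ n) v = 0 := ⟨n, by rw [hn]; rfl⟩
  have hNV : ∀ k, (N ^ k) v ∈ V := by
    intro k
    induction k with
    | zero => exact hv
    | succ k ih =>
      rw [pow_succ', Module.End.mul_apply]
      exact V.sub_mem (hV _ ih) ih
  rcases hm : Nat.find hex with _ | m
  · have := Nat.find_spec hex
    rw [hm] at this
    exact absurd this hv0
  · refine ⟨(N ^ m) v, hNV m, Nat.find_min hex (by omega), ?_⟩
    have := Nat.find_spec hex
    rw [hm, pow_succ', Module.End.mul_apply] at this
    exact sub_eq_zero.1 this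

theorem closedChamber_nonneg {A : 𝔞} (hA : A ∈ closedChamber P) {β : Module.Dual ℝ 𝔞}
    (hβ : IsSimpleRoot P β) : 0 ≤ β A := by
  let _ : TopologicalSpace 𝔞 := moduleTopology ℝ 𝔞
  have _ : IsModuleTopology ℝ 𝔞 := ⟨rfl⟩
  have hc : Continuous β := IsModuleTopology.continuous_of_linearMap β
  exact closure_minimal (fun A (hA : A ∈ chamber P) => (hA β hβ).le)
    (isClosed_Ici.preimage hc) hA

theorem chamber_subset_closedChamber : chamber P ⊆ closedChamber P :=
  @subset_closure _ (moduleTopology ℝ 𝔞) _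

/-- If the product of commuting elliptic, hyperbolic and unipotent elements is hyperbolic, it equals
its hyperbolic factor. -/
theorem hyperbolic_part_unique (h : IsSplitCartan B θ 𝔞) (hG : IsRealForm G)
    (hB : ∀ x ∈ G, ∀ X Y : 𝔤, B (x X) (x Y) = B X Y) {Z Z' : 𝔤}
    (hZ : ⨆ μ : ℝ, Module.End.eigenspace (LieAlgebra.ad ℝ 𝔤 Z) μ = ⊤)
    (hZ' : ⨆ μ : ℝ, Module.End.eigenspace (LieAlgebra.ad ℝ 𝔤 Z') μ = ⊤)
    {xk xu y : 𝔤 ≃ₗ[ℝ] 𝔤} (hxu : xu ∈ G)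
    (hx : expAd ℝ Z' = xk * expAd ℝ Z * xu) (hkh : Commute xk (expAd ℝ Z))
    (hku : Commute xk xu) (hhu : Commute (expAd ℝ Z) xu)
    (hk : y * xk * y⁻¹ ∈ analyticK θ)
    (hnil : IsNilpotent ((xu : 𝔤 →ₗ[ℝ] 𝔤) - LinearMap.id)) : Z = Z' := by
  have := h.killing
  have hcom_h : Commute (expAd ℝ Z) (expAd ℝ Z') := by
    rw [hx]
    exact (hkh.symm.mul_right (Commute.refl _)).mul_right hhu
  have hcom_u : Commute xu (expAd ℝ Z') := by
    rw [hx]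
    exact (hku.symm.mul_right hhu.symm).mul_right (Commute.refl _)
  have hZZ' : expAd ℝ Z Z' = Z' := apply_eq_self_of_commute (expAd_lie Z) hZ' hcom_h
  have huZ' : xu Z' = Z' := apply_eq_self_of_commute (fun X Y => hG.map_lie hxu X Y) hZ' hcom_u
  have huZ : xu Z = Z := apply_eq_self_of_commute (fun X Y => hG.map_lie hxu X Y) hZ hhu.symm
  have hlie : ⁅Z, Z'⁆ = 0 := by
    have := eigen_of_expLin_eigen hZ (c := 0) (v := Z')
      (by rw [Real.exp_zero, one_smul, ← expAd_apply, hZZ'])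
    rwa [zero_smul] at this
  have hiso : ∀ w, cartanForm B θ (y (xk w)) (y (xk w)) = cartanForm B θ (y w) (y w) := by
    intro w
    have h1 := (analyticK_preserves hG hB hk).2.2 (y w) (y w)
    have h2 : (y * xk * y⁻¹) (y w) = y (xk w) := by
      change y (xk (y⁻¹ (y w))) = _
      rw [inv_apply_apply]
    rwa [h2] at h1
  -- On a joint eigenvector w fixed by `xu`, the factorization reads e^c w = e^d xk w. As `xk`
  -- preserves the definite form transported by y, e^c = e^d.
  have key : ∀ c d : ℝ, ∀ v : 𝔤, ⁅Z', v⁆ = c • v → ⁅Z, v⁆ = d • v → v ≠ 0 → c = d := by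
    intro c d v hvc hvd hv0
    obtain ⟨w, ⟨hw1, hw2⟩, hw0, hwu⟩ := exists_fixed_of_unipotent hnil
      (V := Module.End.eigenspace (LieAlgebra.ad ℝ 𝔤 Z') c ⊓
        Module.End.eigenspace (LieAlgebra.ad ℝ 𝔤 Z) d) (by
        rintro u ⟨h1, h2⟩
        have h1 := Module.End.mem_eigenspace_iff.1 h1
        have h2 := Module.End.mem_eigenspace_iff.1 h2
        rw [LieAlgebra.ad_apply] at h1 h2
        refine ⟨Module.End.mem_eigenspace_iff.2 ?_, Module.End.mem_eigenspace_iff.2 ?_⟩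
        · rw [LieAlgebra.ad_apply]
          conv_lhs => rw [← huZ']
          rw [← hG.map_lie hxu, h1, map_smul]
        · rw [LieAlgebra.ad_apply]
          conv_lhs => rw [← huZ]
          rw [← hG.map_lie hxu, h2, map_smul])
      ⟨Module.End.mem_eigenspace_iff.2 hvc, Module.End.mem_eigenspace_iff.2 hvd⟩ hv0
    have hw1 := Module.End.mem_eigenspace_iff.1 hw1
    have hw2 := Module.End.mem_eigenspace_iff.1 hw2
    rw [LieAlgebra.ad_apply] at hw1 hw2
    have h1 : Real.exp c • w = Real.exp d • xk w := by
      rw [← expAd_real_eigen hw1, hx]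
      change xk (expAd ℝ Z (xu w)) = _
      rw [hwu, expAd_real_eigen hw2, map_smul]
    have h2 : Real.exp c * Real.exp c * cartanForm B θ (y w) (y w) =
        Real.exp d * Real.exp d * cartanForm B θ (y w) (y w) := by
      have h3 : cartanForm B θ (y (Real.exp c • w)) (y (Real.exp c • w)) =
          cartanForm B θ (y (Real.exp d • xk w)) (y (Real.exp d • xk w)) := by rw [h1]
      simp only [map_smul, LinearMap.smul_apply, smul_eq_mul, hiso] at h3
      linarith
    have h3 : 0 < cartanForm B θ (y w) (y w) := by
      rw [cartanForm_apply]
      exact h.cartan.pos _ (by simpa using hw0)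
    have h4 := mul_right_cancel₀ h3.ne' h2
    rw [← Real.exp_add, ← Real.exp_add, Real.exp_eq_exp] at h4
    linarith
  refine ad_injective (LinearMap.ext fun v => ?_)
  have hv : v ∈ ⨆ μ : ℝ, Module.End.eigenspace (LieAlgebra.ad ℝ 𝔤 Z') μ :=
    hZ' ▸ Submodule.mem_top
  induction hv using Submodule.iSup_induction' with
  | zero => simp
  | add x y _ _ hx hy => rw [map_add, map_add, hx, hy]
  | mem c v hv =>
    have h1 := Submodule.inf_iSup_genEigenspace (f := LieAlgebra.ad ℝ 𝔤 Z)
      (p := Module.End.eigenspace (LieAlgebra.ad ℝ 𝔤 Z') c) (fun u hu => by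
        have hu := Module.End.mem_eigenspace_iff.1 hu
        rw [LieAlgebra.ad_apply] at hu
        rw [Module.End.mem_eigenspace_iff, LieAlgebra.ad_apply, LieAlgebra.ad_apply,
          leibniz_lie, hu, ← lie_skew Z' Z, hlie, neg_zero, zero_lie, zero_add, lie_smul]) 1
    have h2 : v ∈ ⨆ d : ℝ, Module.End.eigenspace (LieAlgebra.ad ℝ 𝔤 Z') c ⊓
        Module.End.eigenspace (LieAlgebra.ad ℝ 𝔤 Z) d := by
      refine h1.le ⟨hv, ?_⟩
      have : ⨆ μ : ℝ, Module.End.genEigenspace (LieAlgebra.ad ℝ 𝔤 Z) μ 1 = ⊤ := hZ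
      rw [this]
      trivial
    clear hv h1
    induction h2 using Submodule.iSup_induction' with
    | zero => simp
    | add x y _ _ hx hy => rw [map_add, map_add, hx, hy]
    | mem d v hv =>
      have hv1 := Module.End.mem_eigenspace_iff.1 hv.1
      have hv2 := Module.End.mem_eigenspace_iff.1 hv.2
      rw [hv1, hv2]
      by_cases hv0 : v = 0
      · rw [hv0, smul_zero, smul_zero]
      · rw [key c d v hv1 hv2 hv0]

/-- Two points of the closed chamber, one of them in the open chamber, which are conjugate under a
split real form are equal. -/
theorem eq_of_conj_of_mem_chamber (h : IsSplitCartan B θ 𝔞) (hP : IsPositivity P)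
    (hG : IsRealForm G) (hB : ∀ x ∈ G, ∀ X Y : 𝔤, B (x X) (x Y) = B X Y)
    {g : 𝔤 ≃ₗ[ℝ] 𝔤} (hg : g ∈ G) {A A' : 𝔞} (hA : A ∈ closedChamber P) (hA' : A' ∈ chamber P)
    (hgA : g (A : 𝔤) = A') : A = A' := by
  have hreg : ∀ X : 𝔤, ⁅(A' : 𝔤), X⁆ = 0 → X ∈ 𝔞 :=
    mem_of_lie_eq_zero_of_regular h fun β hβ => ne_zero_of_mem_chamber h hP hA' hβ
  have hcent : ∀ X : 𝔤, ⁅(A : 𝔤), X⁆ = 0 → g X ∈ 𝔞 := by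
    intro X hX
    apply hreg
    rw [← hgA, ← hG.map_lie hg, hX, map_zero]
  have hg𝔞 : ∀ X ∈ 𝔞, g X ∈ 𝔞 := fun X hX => hcent X (h.comm _ A.2 _ hX)
  have hmap : 𝔞.map (g : 𝔤 →ₗ[ℝ] 𝔤) = 𝔞 := by
    refine Submodule.eq_of_le_of_finrank_eq ?_ (LinearEquiv.finrank_map_eq g 𝔞)
    rintro _ ⟨X, hX, rfl⟩
    exact hg𝔞 X hX
  have hAreg : ∀ X : 𝔤, ⁅(A : 𝔤), X⁆ = 0 → X ∈ 𝔞 := by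
    intro X hX
    have h1 := hcent X hX
    rw [← hmap] at h1
    obtain ⟨Y, hY, hYX⟩ := h1
    exact g.injective hYX ▸ hY
  -- A simple root vanishing at A would put its root vector in the centralizer of A, which is 𝔞; so
  -- A is off every wall.
  have hAcham : A ∈ chamber P := by
    intro β hβ
    refine lt_of_le_of_ne (closedChamber_nonneg hA hβ) fun h0 => ?_
    obtain ⟨X, hX0, hX⟩ := hβ.1.2
    have h1 : X ∈ 𝔞 := hAreg X (by rw [hX, ← h0, zero_smul])
    refine hβ.1.1 (LinearMap.ext fun C => ?_)
    have h2 := hX C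
    rw [h.comm _ C.2 _ h1] at h2
    exact (smul_eq_zero.1 h2.symm).resolve_right hX0
  have h1 := apply_eq_self_of_chamber h hP hG hB hg hg𝔞 hAcham hA' hgA _ A.2
  exact Subtype.ext (h1.symm.trans hgA)

theorem isJordanProjection_iff (h : IsSplitCartan B θ 𝔞) (hP : IsPositivity P)
    (hG : IsRealForm G) (hB : ∀ x ∈ G, ∀ X Y : 𝔤, B (x X) (x Y) = B X Y)
    {x y : 𝔤 ≃ₗ[ℝ] 𝔤} (hx : x ∈ G) (hy : y ∈ G) {A' : 𝔞} (hA' : A' ∈ chamber P)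
    (hxy : y * x * y⁻¹ = expAd ℝ (A' : 𝔤)) (A : 𝔞) :
    IsJordanProjection G θ P x A ↔ A = A' := by
  have := h.killing
  constructor
  · rintro ⟨hA, xk, hxk, xh, hxh, xu, hxu, hprod, hkh, hku, hhu, ⟨y₁, hy₁, hk⟩, ⟨y₂, hy₂, hh⟩, hnil⟩
    have hlie : ∀ u ∈ G, ∀ X Y, u ⁅X, Y⁆ = ⁅u X, u Y⁆ := fun u hu X Y => hG.map_lie hu X Y
    have hxh' : xh = expAd ℝ (y₂⁻¹ (A : 𝔤)) := by
      rw [← conj_expAd (hlie _ (G.inv_mem hy₂)), ← hh]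
      group
    have hx' : x = expAd ℝ (y⁻¹ (A' : 𝔤)) := by
      rw [← conj_expAd (hlie _ (G.inv_mem hy)), ← hxy]
      group
    rw [hxh'] at hprod hkh hhu
    have h1 := hyperbolic_part_unique h hG hB
      (iSup_eigenspace_ad_conj (hlie _ (G.inv_mem hy₂)) (h.iSup_eigenspace A))
      (iSup_eigenspace_ad_conj (hlie _ (G.inv_mem hy)) (h.iSup_eigenspace A'))
      hxu (hx' ▸ hprod) hkh hku hhu hk hnil
    refine eq_of_conj_of_mem_chamber h hP hG hB (G.mul_mem hy (G.inv_mem hy₂)) hA hA' ?_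
    rw [LinearEquiv.mul_apply, h1, apply_inv_apply]
  · rintro rfl
    refine ⟨chamber_subset_closedChamber hA', 1, G.one_mem, x, hx, 1, G.one_mem, by simp,
      Commute.one_left _, Commute.one_left _, Commute.one_right _, ⟨1, G.one_mem, ?_⟩,
      ⟨y, hy, hxy⟩, ?_⟩
    · simp only [mul_one, inv_one]
      exact one_mem _
    · exact ⟨1, by rw [pow_one]; exact sub_self _⟩

end JordanUniqueness

/-! ### Simple reflections, inversions and the longest Weyl element. -/

section Weyl

variable {𝔤 : Type*} [LieRing 𝔤] [LieAlgebra ℝ 𝔤] [FiniteDimensional ℝ 𝔤]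
variable {B : LinearMap.BilinForm ℝ 𝔤} {θ : 𝔤 ≃ₗ⁅ℝ⁆ 𝔤} {𝔞 : Submodule ℝ 𝔤}
variable {P : Set (Module.Dual ℝ 𝔞)} {G : Subgroup (𝔤 ≃ₗ[ℝ] 𝔤)}

theorem one_mem_weylGroup : (1 : 𝔞 ≃ₗ[ℝ] 𝔞) ∈ weylGroup θ 𝔞 :=
  ⟨1, one_mem _, fun _ => rfl⟩

theorem mul_mem_weylGroup {v w : 𝔞 ≃ₗ[ℝ] 𝔞} (hv : v ∈ weylGroup θ 𝔞) (hw : w ∈ weylGroup θ 𝔞) :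
    v * w ∈ weylGroup θ 𝔞 := by
  obtain ⟨k, hk, hkv⟩ := hv
  obtain ⟨l, hl, hlw⟩ := hw
  refine ⟨k * l, mul_mem hk hl, fun A => ?_⟩
  rw [LinearEquiv.mul_apply, hlw, hkv]
  rfl

theorem inv_mem_weylGroup {w : 𝔞 ≃ₗ[ℝ] 𝔞} (hw : w ∈ weylGroup θ 𝔞) : w⁻¹ ∈ weylGroup θ 𝔞 := by
  obtain ⟨k, hk, hkw⟩ := hw
  refine ⟨k⁻¹, inv_mem hk, fun A => k.injective ?_⟩
  rw [apply_inv_apply, hkw]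
  congr 1
  exact (LinearEquiv.apply_symm_apply w A).symm

theorem IsRoot.comp_weyl (hG : IsRealForm G)
    (hB : ∀ x ∈ G, ∀ X Y : 𝔤, B (x X) (x Y) = B X Y) {w : 𝔞 ≃ₗ[ℝ] 𝔞} (hw : w ∈ weylGroup θ 𝔞)
    {β : Module.Dual ℝ 𝔞} (hβ : IsRoot β) : IsRoot (β ∘ₗ (w : 𝔞 →ₗ[ℝ] 𝔞)) := by
  obtain ⟨k, hk, hkw⟩ := hw
  obtain ⟨h0, X, hX, hXA⟩ := hβ
  have hkG := (analyticK_preserves hG hB hk).1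
  refine ⟨fun h1 => h0 ?_, k⁻¹ X, by simpa using hX, fun A => k.injective ?_⟩
  · ext A
    have := LinearMap.congr_fun h1 (w.symm A)
    simpa using this
  · rw [hG.map_lie hkG, hkw, apply_inv_apply, hXA, map_smul, apply_inv_apply]
    rfl

/-- An element of the Weyl group preserving the positive roots is trivial. -/
theorem weyl_eq_one (h : IsSplitCartan B θ 𝔞) (hP : IsPositivity P) (hG : IsRealForm G)
    (hB : ∀ x ∈ G, ∀ X Y : 𝔤, B (x X) (x Y) = B X Y) {w : 𝔞 ≃ₗ[ℝ] 𝔞} (hw : w ∈ weylGroup θ 𝔞)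
    (hpos : ∀ β ∈ posRoots P, β ∘ₗ (w : 𝔞 →ₗ[ℝ] 𝔞) ∈ P) : w = 1 := by
  obtain ⟨A, hA⟩ := chamber_nonempty h hP
  have hwA : w A ∈ chamber P := by
    rw [mem_chamber_iff h hP] at hA ⊢
    exact fun β hβ => hA _ ⟨IsRoot.comp_weyl hG hB hw hβ.1, hpos β hβ⟩
  obtain ⟨k, hk, hkw⟩ := hw
  have hkG := (analyticK_preserves hG hB hk).1
  have := apply_eq_self_of_chamber h hP hG hB hkG
    (fun X hX => by rw [hkw ⟨X, hX⟩]; exact (w _).2) hA hwA (hkw A)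
  ext C
  rw [← hkw, this C C.2]
  rfl

/-- The reflection in a simple root is realized by an element of `K`. -/
theorem reflection_mem_weylGroup (h : IsSplitCartan B θ 𝔞) {β : Module.Dual ℝ 𝔞} (hβ : IsRoot β)
    {H : 𝔞} (hH : β H = 2) (hHB : ∀ A : 𝔞, β A = 0 → B (H : 𝔤) A = 0) :
    Module.reflection hH ∈ weylGroup θ 𝔞 := by
  obtain ⟨h0, E, hE0, hE⟩ := hβ
  have hθE : ∀ A : 𝔞, ⁅(A : 𝔤), θ E⁆ = -(β A • θ E) := by
    intro A
    have : θ ⁅(A : 𝔤), E⁆ = β A • θ E := by rw [hE, map_smul]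
    rw [LieEquiv.map_lie, h.neg A A.2, neg_lie] at this
    rw [← this, neg_neg]
  have hH0 : H ≠ 0 := by
    rintro rfl
    rw [map_zero] at hH
    norm_num at hH
  have hHH : 0 < B (H : 𝔤) H := h.form_pos H.2 (by simpa using hH0)
  have hHA : ∀ A : 𝔞, B (H : 𝔤) A = B (H : 𝔤) H / 2 * β A := by
    intro A
    have h1 := hHB (A - (β A / 2) • H) (by rw [map_sub, map_smul, hH, smul_eq_mul]; ring)
    rw [Submodule.coe_sub, Submodule.coe_smul, map_sub, map_smul, smul_eq_mul] at h1
    linarith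
  have hEE : 0 < -B E (θ E) := h.cartan.pos E hE0
  -- The value of μ is forced by pairing [E, θE] = -μH with 𝔞, using B(H, A) = B(H, H) β(A) / 2.
  set μ := -B E (θ E) / (B (H : 𝔤) H / 2) with hμ
  have hμ0 : 0 < μ := by positivity
  have hbr : ⁅E, θ E⁆ = -(μ • (H : 𝔤)) := by
    have hmem : ⁅E, θ E⁆ ∈ 𝔞 := by
      refine h.split _ fun A hA => ?_
      rw [leibniz_lie, hE ⟨A, hA⟩, hθE ⟨A, hA⟩, smul_lie, lie_neg, lie_smul, add_neg_cancel]
    have hBA : ∀ A : 𝔞, B ⁅E, θ E⁆ A = β A * B E (θ E) := by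
      intro A
      rw [h.inv, ← lie_skew, hE, map_neg, neg_neg, map_smul, smul_eq_mul, h.symm.eq]
    by_contra hne
    have h1 := h.form_pos (𝔞.add_mem hmem (𝔞.smul_mem μ H.2)) fun h2 => hne (eq_neg_of_add_eq_zero_left h2)
    have h2 : ∀ A : 𝔞, B (⁅E, θ E⁆ + μ • (H : 𝔤)) A = 0 := by
      intro A
      rw [map_add, LinearMap.add_apply, map_smul, LinearMap.smul_apply, hBA, hHA, smul_eq_mul, hμ]
      field_simp
      ring
    exact h1.ne' (h2 ⟨_, 𝔞.add_mem hmem (𝔞.smul_mem μ H.2)⟩)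
  -- For T = t(E + θE) in 𝔨 one finds (ad T)² H = -4μt² H. This t makes the factor -π², so exp(ad T)
  -- is a half turn on H, while it fixes ker β.
  set t := Real.pi / (2 * Real.sqrt μ) with ht
  have htμ : t ^ 2 * (4 * μ) = Real.pi ^ 2 := by
    have := Real.sq_sqrt hμ0.le
    have hs : Real.sqrt μ ≠ 0 := (Real.sqrt_pos.2 hμ0).ne'
    rw [ht, div_pow, mul_pow, this]
    field_simp
    norm_num
  have hTA : ∀ A : 𝔞, ⁅t • (E + θ E), (A : 𝔤)⁆ = (t * β A) • (θ E - E) := by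
    intro A
    rw [smul_lie, add_lie, ← lie_skew E, ← lie_skew (θ E), hE, hθE, neg_neg, mul_smul, smul_sub]
    congr 1
    abel
  have hTH : ⁅t • (E + θ E), ⁅t • (E + θ E), (H : 𝔤)⁆⁆ = -(Real.pi ^ 2) • (H : 𝔤) := by
    rw [hTA, hH, lie_smul, smul_lie, add_lie, lie_sub, lie_sub, lie_self, lie_self,
      ← lie_skew (θ E) E, hbr, ← htμ]
    module
  have hkH : expAd ℝ (t • (E + θ E)) (H : 𝔤) = -H := expLin_apply_of_sq _ _ hTH
  refine ⟨expAd ℝ (t • (E + θ E)), Subgroup.subset_closure ⟨_, ?_, rfl⟩, fun A => ?_⟩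
  · rw [map_smul, map_add, h.cartan.involutive, add_comm]
  · have h1 : expAd ℝ (t • (E + θ E)) ((A - (β A / 2) • H : 𝔞) : 𝔤) = (A - (β A / 2) • H : 𝔞) := by
      refine expAd_apply_of_lie_eq_zero ?_
      rw [hTA, map_sub, map_smul, hH, smul_eq_mul, div_mul_cancel₀ _ two_ne_zero, sub_self,
        mul_zero, zero_smul]
    rw [Submodule.coe_sub, Submodule.coe_smul, map_sub, map_smul, hkH] at h1
    rw [Module.reflection_apply, Submodule.coe_sub, Submodule.coe_smul]
    rw [← sub_eq_zero] at h1 ⊢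
    rw [← h1]
    module

/-- A simple reflection is an involution in the Weyl group which negates its simple root and
permutes the other positive roots. -/
theorem IsSimpleReflection.properties (h : IsSplitCartan B θ 𝔞) (hP : IsPositivity P)
    {s : 𝔞 ≃ₗ[ℝ] 𝔞} {β : Module.Dual ℝ 𝔞} (hβ : IsSimpleRoot P β)
    (hs1 : ∀ A : 𝔞, β A = 0 → s A = A)
    (hs2 : ∀ v : 𝔞, (∀ A : 𝔞, β A = 0 → B (v : 𝔤) (A : 𝔤) = 0) → s v = -v) :
    s ∈ weylGroup θ 𝔞 ∧ s * s = 1 ∧ β ∘ₗ (s : 𝔞 →ₗ[ℝ] 𝔞) = -β ∧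
      ∀ γ ∈ posRoots P, γ ≠ β → γ ∘ₗ (s : 𝔞 →ₗ[ℝ] 𝔞) ∈ posRoots P := by
  obtain ⟨H, hH, hHB, hperm⟩ := exists_coroot h hP hβ
  have hs : s = Module.reflection hH := by
    ext1 A
    have h1 := hs1 (A - (β A / 2) • H) (by rw [map_sub, map_smul, hH, smul_eq_mul]; ring)
    rw [map_sub, map_smul, hs2 H hHB] at h1
    rw [Module.reflection_apply]
    rw [← sub_eq_zero] at h1 ⊢
    rw [← h1]
    module
  have hcomp : ∀ γ : Module.Dual ℝ 𝔞, γ ∘ₗ (s : 𝔞 →ₗ[ℝ] 𝔞) = γ - γ H • β := by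
    intro γ
    ext A
    rw [hs]
    simp only [LinearMap.comp_apply, LinearEquiv.coe_coe, Module.reflection_apply, map_sub,
      map_smul, smul_eq_mul, LinearMap.sub_apply, LinearMap.smul_apply]
    ring
  refine ⟨hs ▸ reflection_mem_weylGroup h hβ.1 hH hHB, ?_, ?_, fun γ hγ hne => ?_⟩
  · rw [hs]
    ext1 A
    exact Module.involutive_reflection hH A
  · rw [hcomp, hH]
    module
  · rw [hcomp]
    exact hperm γ hγ hne

theorem exists_isSimpleReflection (h : IsSplitCartan B θ 𝔞) (hP : IsPositivity P)
    {β : Module.Dual ℝ 𝔞} (hβ : IsSimpleRoot P β) :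
    ∃ s : 𝔞 ≃ₗ[ℝ] 𝔞, (∀ A : 𝔞, β A = 0 → s A = A) ∧
      ∀ v : 𝔞, (∀ A : 𝔞, β A = 0 → B (v : 𝔤) (A : 𝔤) = 0) → s v = -v := by
  obtain ⟨H, hH, hHB, -⟩ := exists_coroot h hP hβ
  refine ⟨Module.reflection hH, fun A hA => ?_, fun v hv => ?_⟩
  · rw [Module.reflection_apply, hA, zero_smul, sub_zero]
  · have h0 : β (v - (β v / 2) • H) = 0 := by
      rw [map_sub, map_smul, hH, smul_eq_mul]; ring
    have h1 : v - (β v / 2) • H = 0 := by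
      by_contra hne
      set u := v - (β v / 2) • H with hu
      have h2 := h.form_pos u.2 (by rwa [ne_eq, Submodule.coe_eq_zero])
      have h5 : B (u : 𝔤) (u : 𝔤) = B (v : 𝔤) (u : 𝔤) - β v / 2 * B (H : 𝔤) (u : 𝔤) := by
        have h6 : (u : 𝔤) = v - (β v / 2) • (H : 𝔤) := by rw [hu]; rfl
        have h7 : B (u : 𝔤) (u : 𝔤) = B (v - (β v / 2) • (H : 𝔤)) (u : 𝔤) := by rw [← h6]
        rw [h7, map_sub, map_smul, LinearMap.sub_apply, LinearMap.smul_apply, smul_eq_mul]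
      rw [h5, hv _ h0, hHB _ h0] at h2
      norm_num at h2
    have h2 : v = (β v / 2) • H := sub_eq_zero.1 h1
    rw [Module.reflection_apply]
    nth_rewrite 1 [h2]
    nth_rewrite 3 [h2]
    module

/-- The positive roots made negative by `w`. -/
def inversions (P : Set (Module.Dual ℝ 𝔞)) (w : 𝔞 ≃ₗ[ℝ] 𝔞) : Set (Module.Dual ℝ 𝔞) :=
  {γ ∈ posRoots P | γ ∘ₗ (w : 𝔞 →ₗ[ℝ] 𝔞) ∉ P}

theorem finite_posRoots (h : IsSplitCartan B θ 𝔞) : (posRoots P).Finite :=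
  (finite_setOf_isRoot h).subset fun _ hβ => hβ.1

theorem comp_mul_weyl (γ : Module.Dual ℝ 𝔞) (v w : 𝔞 ≃ₗ[ℝ] 𝔞) :
    γ ∘ₗ ((v * w : 𝔞 ≃ₗ[ℝ] 𝔞) : 𝔞 →ₗ[ℝ] 𝔞) =
      (γ ∘ₗ (v : 𝔞 →ₗ[ℝ] 𝔞)) ∘ₗ (w : 𝔞 →ₗ[ℝ] 𝔞) := rfl

/-- Composition with s maps the inversions of `s * w` bijectively onto those of w other than β,
since s permutes the positive roots different from β. -/
theorem ncard_inversions_of_notMem (h : IsSplitCartan B θ 𝔞) (hP : IsPositivity P)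
    {s w : 𝔞 ≃ₗ[ℝ] 𝔞} {β : Module.Dual ℝ 𝔞} (hβ : β ∈ posRoots P) (hss : s * s = 1)
    (hsβ : β ∘ₗ (s : 𝔞 →ₗ[ℝ] 𝔞) = -β)
    (hperm : ∀ γ ∈ posRoots P, γ ≠ β → γ ∘ₗ (s : 𝔞 →ₗ[ℝ] 𝔞) ∈ posRoots P)
    (hβw : β ∘ₗ (w : 𝔞 →ₗ[ℝ] 𝔞) ∉ P) :
    (inversions P (s * w)).ncard + 1 = (inversions P w).ncard := by
  have hinvol : ∀ γ : Module.Dual ℝ 𝔞, (γ ∘ₗ (s : 𝔞 →ₗ[ℝ] 𝔞)) ∘ₗ (s : 𝔞 →ₗ[ℝ] 𝔞) = γ := by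
    intro γ
    rw [← comp_mul_weyl, hss]
    rfl
  have hβw0 : -(β ∘ₗ (w : 𝔞 →ₗ[ℝ] 𝔞)) ∈ P := by
    refine (hP.pos_or_neg _ fun h0 => hβ.1.1 ?_).resolve_left hβw
    ext A
    simpa using LinearMap.congr_fun h0 (w.symm A)
  have hne_of : ∀ γ ∈ posRoots P, γ ∘ₗ (s : 𝔞 →ₗ[ℝ] 𝔞) ≠ β := by
    intro γ hγ h0
    have h1 := hinvol γ
    rw [h0, hsβ] at h1
    exact hP.not_neg hβ.2 (h1 ▸ hγ.2)
  have himage : (fun γ : Module.Dual ℝ 𝔞 => γ ∘ₗ (s : 𝔞 →ₗ[ℝ] 𝔞)) '' inversions P (s * w) =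
      inversions P w \ {β} := by
    ext γ
    constructor
    · rintro ⟨γ, ⟨hγ, hγw⟩, rfl⟩
      have hne : γ ≠ β := by
        rintro rfl
        rw [comp_mul_weyl, hsβ] at hγw
        exact hγw hβw0
      exact ⟨⟨hperm γ hγ hne, hγw⟩, hne_of γ hγ⟩
    · rintro ⟨⟨hγ, hγw⟩, hne⟩
      exact ⟨_, ⟨hperm γ hγ hne, by rwa [comp_mul_weyl, hinvol]⟩, hinvol γ⟩
  have hinj : Function.Injective (fun γ : Module.Dual ℝ 𝔞 => γ ∘ₗ (s : 𝔞 →ₗ[ℝ] 𝔞)) :=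
    Function.Injective.of_comp (f := fun γ : Module.Dual ℝ 𝔞 => γ ∘ₗ (s : 𝔞 →ₗ[ℝ] 𝔞))
      (by rw [Function.comp_def]; simp only [hinvol]; exact Function.injective_id)
  rw [← Set.ncard_image_of_injective _ hinj, himage]
  exact Set.ncard_sdiff_singleton_add_one ⟨hβ, hβw⟩ ((finite_posRoots h).subset fun _ h => h.1)

theorem ncard_inversions_of_mem (h : IsSplitCartan B θ 𝔞) (hP : IsPositivity P)
    {s w : 𝔞 ≃ₗ[ℝ] 𝔞} {β : Module.Dual ℝ 𝔞} (hβ : β ∈ posRoots P) (hss : s * s = 1)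
    (hsβ : β ∘ₗ (s : 𝔞 →ₗ[ℝ] 𝔞) = -β)
    (hperm : ∀ γ ∈ posRoots P, γ ≠ β → γ ∘ₗ (s : 𝔞 →ₗ[ℝ] 𝔞) ∈ posRoots P)
    (hβw : β ∘ₗ (w : 𝔞 →ₗ[ℝ] 𝔞) ∈ P) :
    (inversions P (s * w)).ncard = (inversions P w).ncard + 1 := by
  have h1 := ncard_inversions_of_notMem h hP (w := s * w) hβ hss hsβ hperm (by
    rw [comp_mul_weyl, hsβ]
    exact hP.not_neg hβw)
  rwa [← mul_assoc, hss, one_mul, eq_comm] at h1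

/-- While w has an inversion it has a simple one, and multiplying by that reflection removes exactly
one inversion; with none left w is trivial by `weyl_eq_one`. Conversely each letter changes the
count by one. -/
theorem weylLength_eq (h : IsSplitCartan B θ 𝔞) (hP : IsPositivity P) (hG : IsRealForm G)
    (hB : ∀ x ∈ G, ∀ X Y : 𝔤, B (x X) (x Y) = B X Y) {w : 𝔞 ≃ₗ[ℝ] 𝔞}
    (hw : w ∈ weylGroup θ 𝔞) : weylLength B P w = (inversions P w).ncard := by
  have hle : ∀ n, ∀ w ∈ weylGroup θ 𝔞, (inversions P w).ncard = n →
      ∃ l : List (𝔞 ≃ₗ[ℝ] 𝔞), (∀ s ∈ l, IsSimpleReflection B P s) ∧ l.prod = w ∧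
        l.length = n := by
    intro n
    induction n with
    | zero =>
      intro w hw h0
      rw [Set.ncard_eq_zero ((finite_posRoots h).subset fun _ h => h.1)] at h0
      have h1 := weyl_eq_one h hP hG hB hw fun β hβ => by
        by_contra hn
        have : β ∈ inversions P w := ⟨hβ, hn⟩
        rw [h0] at this
        exact this
      exact ⟨[], by simp, h1.symm, rfl⟩
    | succ n ih =>
      intro w hw hn
      obtain ⟨β, hβ, hβw⟩ : ∃ β, IsSimpleRoot P β ∧ β ∘ₗ (w : 𝔞 →ₗ[ℝ] 𝔞) ∉ P := by
        by_contra hcon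
        push Not at hcon
        have h1 : inversions P w = ∅ := by
          rw [Set.eq_empty_iff_forall_notMem]
          rintro γ ⟨hγ, hγw⟩
          exact hγw (posRoots_induction h hP (p := fun γ => γ ∘ₗ (w : 𝔞 →ₗ[ℝ] 𝔞) ∈ P) hcon
            (fun β γ h1 h2 => by rw [LinearMap.add_comp]; exact hP.add_mem _ h1 _ h2) hγ)
        rw [h1, Set.ncard_empty] at hn
        omega
      obtain ⟨s, hs1, hs2⟩ := exists_isSimpleReflection h hP hβ
      obtain ⟨hsW, hss, hsβ, hperm⟩ := IsSimpleReflection.properties h hP hβ hs1 hs2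
      have h1 := ncard_inversions_of_notMem h hP ⟨hβ.1, hβ.2.1⟩ hss hsβ hperm hβw
      obtain ⟨l, hl, hlw, hlen⟩ := ih (s * w) (mul_mem_weylGroup hsW hw) (by omega)
      refine ⟨s :: l, ?_, ?_, by rw [List.length_cons, hlen]⟩
      · intro r hr
        rcases List.mem_cons.1 hr with rfl | hr
        · exact ⟨β, hβ, hs1, hs2⟩
        · exact hl r hr
      · rw [List.prod_cons, hlw, ← mul_assoc, hss, one_mul]
  have hge : ∀ l : List (𝔞 ≃ₗ[ℝ] 𝔞), (∀ s ∈ l, IsSimpleReflection B P s) →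
      (inversions P l.prod).ncard ≤ l.length := by
    intro l
    induction l with
    | nil =>
      intro _
      have h1 : inversions P (1 : 𝔞 ≃ₗ[ℝ] 𝔞) = ∅ := by
        rw [Set.eq_empty_iff_forall_notMem]
        rintro γ ⟨hγ, hγw⟩
        exact hγw hγ.2
      rw [List.prod_nil, h1, Set.ncard_empty, List.length_nil]
    | cons s l ih =>
      intro hl
      have h1 := ih fun r hr => hl r (List.mem_cons_of_mem _ hr)
      obtain ⟨β, hβ, hs1, hs2⟩ := hl s List.mem_cons_self
      obtain ⟨hsW, hss, hsβ, hperm⟩ := IsSimpleReflection.properties h hP hβ hs1 hs2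
      rw [List.prod_cons, List.length_cons]
      by_cases hβw : β ∘ₗ (l.prod : 𝔞 →ₗ[ℝ] 𝔞) ∈ P
      · have h2 := ncard_inversions_of_mem h hP ⟨hβ.1, hβ.2.1⟩ hss hsβ hperm hβw
        omega
      · have h2 := ncard_inversions_of_notMem h hP ⟨hβ.1, hβ.2.1⟩ hss hsβ hperm hβw
        omega
  -- An actual word is needed: without one the infimum defining the length would default to 0.
  obtain ⟨l, hl, hlw, hlen⟩ := hle _ w hw rfl
  refine le_antisymm (Nat.sInf_le ⟨l, hl, hlw, hlen⟩) (le_csInf ⟨_, l, hl, hlw, hlen⟩ ?_)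
  rintro n ⟨l', hl', rfl, rfl⟩
  exact hge l' hl'

/-- Lengths are bounded by the number of positive roots, so a maximum is attained. -/
theorem exists_isLongest (h : IsSplitCartan B θ 𝔞) (hP : IsPositivity P) (hG : IsRealForm G)
    (hB : ∀ x ∈ G, ∀ X Y : 𝔤, B (x X) (x Y) = B X Y) :
    ∃ w₀ : 𝔞 ≃ₗ[ℝ] 𝔞, IsLongest B θ P w₀ := by
  let S : Set ℕ := weylLength B P '' weylGroup θ 𝔞
  have hne : S.Nonempty := ⟨_, 1, one_mem_weylGroup, rfl⟩
  have hbdd : BddAbove S := by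
    refine ⟨(posRoots P).ncard, ?_⟩
    rintro _ ⟨w, hw, rfl⟩
    rw [weylLength_eq h hP hG hB hw]
    exact Set.ncard_le_ncard (fun _ h => h.1) (finite_posRoots h)
  obtain ⟨w₀, hw₀, hmax⟩ := Nat.sSup_mem hne hbdd
  exact ⟨w₀, hw₀, fun w hw => hmax ▸ le_csSup hbdd ⟨w, hw, rfl⟩⟩

/-- The longest element of the Weyl group maps the chamber to its negative. -/
theorem IsLongest.neg_inv_mem_chamber (h : IsSplitCartan B θ 𝔞) (hP : IsPositivity P)
    (hG : IsRealForm G) (hB : ∀ x ∈ G, ∀ X Y : 𝔤, B (x X) (x Y) = B X Y)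
    {w₀ : 𝔞 ≃ₗ[ℝ] 𝔞} (hw₀ : IsLongest B θ P w₀) {A : 𝔞} (hA : A ∈ chamber P) :
    -(w₀⁻¹ A) ∈ chamber P := by
  -- If β ∘ w₀ were positive for a simple β, the reflection s in β would make s w₀ strictly longer.
  have hsimple : ∀ β, IsSimpleRoot P β → -(β ∘ₗ (w₀ : 𝔞 →ₗ[ℝ] 𝔞)) ∈ P := by
    intro β hβ
    refine (hP.pos_or_neg _ (IsRoot.comp_weyl hG hB hw₀.1 hβ.1).1).resolve_left fun hβw => ?_
    obtain ⟨s, hs1, hs2⟩ := exists_isSimpleReflection h hP hβ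
    obtain ⟨hsW, hss, hsβ, hperm⟩ := IsSimpleReflection.properties h hP hβ hs1 hs2
    have h1 := ncard_inversions_of_mem h hP ⟨hβ.1, hβ.2.1⟩ hss hsβ hperm hβw
    have h2 := hw₀.2 _ (mul_mem_weylGroup hsW hw₀.1)
    rw [weylLength_eq h hP hG hB (mul_mem_weylGroup hsW hw₀.1),
      weylLength_eq h hP hG hB hw₀.1] at h2
    omega
  have hpos : ∀ γ ∈ posRoots P, -(γ ∘ₗ (w₀ : 𝔞 →ₗ[ℝ] 𝔞)) ∈ P := fun γ hγ =>
    posRoots_induction h hP (p := fun γ => -(γ ∘ₗ (w₀ : 𝔞 →ₗ[ℝ] 𝔞)) ∈ P) hsimple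
      (fun β γ h1 h2 => by rw [LinearMap.add_comp, neg_add]; exact hP.add_mem _ h1 _ h2) hγ
  rw [mem_chamber_iff h hP] at hA ⊢
  intro γ hγ
  have hroot := IsRoot.comp_weyl hG hB (inv_mem_weylGroup hw₀.1) hγ.1
  have hcancel : (γ ∘ₗ ((w₀⁻¹ : 𝔞 ≃ₗ[ℝ] 𝔞) : 𝔞 →ₗ[ℝ] 𝔞)) ∘ₗ (w₀ : 𝔞 →ₗ[ℝ] 𝔞) = γ := by
    rw [← comp_mul_weyl, inv_mul_cancel]
    rfl
  have hneg : -(γ ∘ₗ ((w₀⁻¹ : 𝔞 ≃ₗ[ℝ] 𝔞) : 𝔞 →ₗ[ℝ] 𝔞)) ∈ P := by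
    refine (hP.pos_or_neg _ hroot.1).resolve_left fun hin => ?_
    have h1 := hpos _ ⟨hroot, hin⟩
    rw [hcancel] at h1
    exact hP.not_neg hγ.2 h1
  have h1 := hA _ ⟨isRoot_neg h hroot, hneg⟩
  rw [map_neg]
  exact h1

end Weyl

/-- A linear functional on `𝔞` is represented by a unique vector. -/
theorem IsSplitCartan.exists_dual_vector {𝔤 : Type*} [LieRing 𝔤] [LieAlgebra ℝ 𝔤]
    [FiniteDimensional ℝ 𝔤] {B : LinearMap.BilinForm ℝ 𝔤} {θ : 𝔤 ≃ₗ⁅ℝ⁆ 𝔤} {𝔞 : Submodule ℝ 𝔤}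
    (h : IsSplitCartan B θ 𝔞) (α : Module.Dual ℝ 𝔞) :
    ∃ αv : 𝔞, ∀ v : 𝔞, (∀ Y : 𝔞, B (v : 𝔤) (Y : 𝔤) = α Y) ↔ v = αv := by
  let D : 𝔞 →ₗ[ℝ] Module.Dual ℝ 𝔞 := (B.domRestrict₁₂ 𝔞 𝔞)
  have hD : ∀ v Y : 𝔞, D v Y = B (v : 𝔤) (Y : 𝔤) := fun v Y => rfl
  have hinj : Function.Injective D := by
    rw [← LinearMap.ker_eq_bot, LinearMap.ker_eq_bot']
    intro v hv
    by_contra h0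
    have h1 := h.form_pos v.2 (by rwa [ne_eq, Submodule.coe_eq_zero])
    rw [← hD, hv] at h1
    exact lt_irrefl _ h1
  have hsurj : Function.Surjective D :=
    (LinearMap.injective_iff_surjective_of_finrank_eq_finrank
      (Subspace.dual_finrank_eq (K := ℝ) (V := 𝔞)).symm).1 hinj
  obtain ⟨αv, hαv⟩ := hsurj α
  refine ⟨αv, fun v => ⟨fun hv => hinj (LinearMap.ext fun Y => ?_), ?_⟩⟩
  · rw [hD, hv, hαv]
  · rintro rfl Y
    rw [← hD, hαv]

/-- Two values are compared in the direction Y = θ(Z - Z'), where definiteness of the Cartan form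
decides. -/
theorem IsGoldmanValue.unique {𝔤 : Type*} [LieRing 𝔤] [LieAlgebra ℝ 𝔤]
    [FiniteDimensional ℝ 𝔤] {B : LinearMap.BilinForm ℝ 𝔤} {θ : 𝔤 ≃ₗ⁅ℝ⁆ 𝔤}
    (hθ : IsCartanInvolution B θ) {f : (𝔤 ≃ₗ[ℝ] 𝔤) → ℝ} {x : 𝔤 ≃ₗ[ℝ] 𝔤} {Z Z' : 𝔤}
    (hZ : IsGoldmanValue B f x Z) (hZ' : IsGoldmanValue B f x Z') : Z = Z' := by
  by_contra hne
  have h1 := hθ.pos (Z - Z') (sub_ne_zero.2 hne)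
  have h2 := (hZ (θ (Z - Z'))).unique (hZ' (θ (Z - Z')))
  rw [map_sub B, LinearMap.sub_apply, h2, sub_self, neg_zero] at h1
  exact lt_irrefl _ h1

end

end GoldmanLie

/-! ### The theorem. -/

open GoldmanLie
theorem lemma3p4 {𝔤 : Type*} [LieRing 𝔤] [LieAlgebra ℝ 𝔤] [FiniteDimensional ℝ 𝔤]
    (hsimple : LieAlgebra.IsSimple ℂ (ℂ ⊗[ℝ] 𝔤))
    (G : Subgroup (𝔤 ≃ₗ[ℝ] 𝔤)) (hG : IsRealForm G)
    (B : LinearMap.BilinForm ℝ 𝔤) (hBsymm : B.IsSymm) (hBnondeg : B.Nondegenerate)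
    (hBinv : ∀ x ∈ G, ∀ X Y : 𝔤, B (x X) (x Y) = B X Y)
    (θ : 𝔤 ≃ₗ⁅ℝ⁆ 𝔤) (hθ : IsCartanInvolution B θ)
    (𝔞 : Submodule ℝ 𝔤) (h𝔞 : IsMaximalAbelian θ 𝔞) (hsplit : IsSplit 𝔞)
    (P : Set (Module.Dual ℝ 𝔞)) (hP : IsPositivity P)
    (α : Module.Dual ℝ 𝔞)
    (U : Set (𝔤 ≃ₗ[ℝ] 𝔤)) (hU : U = purelyLoxodromic G P)
    (f : (𝔤 ≃ₗ[ℝ] 𝔤) → ℝ) (hf : ∀ x ∈ U, f x = α (jordanProjection G θ P x)) :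
    -- the Jordan projection is well defined on `U`
    (∀ x ∈ U, ∃! A : 𝔞, IsJordanProjection G θ P x A) ∧
    -- (i)
    (IsInvariantFunction G U f ∧ IsRealAnalyticOn U f) ∧
    -- (ii)
    IsHomogeneousOn U f ∧
    -- (iii): the Goldman function exists and is unique on `U`, and has the stated values
    (∀ x ∈ U, ∃! Z : 𝔤, IsGoldmanValue B f x Z) ∧
    (∃ w₀ : 𝔞 ≃ₗ[ℝ] 𝔞, IsLongest B θ P w₀) ∧
    (∃ αv : 𝔞, (∀ v : 𝔞, (∀ Y : 𝔞, B (v : 𝔤) (Y : 𝔤) = α Y) ↔ v = αv) ∧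
      ∀ X ∈ chamber P,
        (expAd ℝ (X : 𝔤) ∈ U ∧ IsGoldmanValue B f (expAd ℝ (X : 𝔤)) (αv : 𝔤)) ∧
        ∀ w₀ : 𝔞 ≃ₗ[ℝ] 𝔞, IsLongest B θ P w₀ →
          ((expAd ℝ (X : 𝔤))⁻¹ ∈ U ∧
            IsGoldmanValue B f (expAd ℝ (X : 𝔤))⁻¹ (w₀ αv : 𝔤))) := by
  have h : IsSplitCartan B θ 𝔞 :=
    { killing := isKilling_of_isSimple_baseChange hsimple
      symm := hBsymm
      inv := lie_invariant hG hBsymm hBinv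
      cartan := hθ
      neg := h𝔞.prop.1
      comm := h𝔞.prop.2
      split := hsplit }
  have hlie : ∀ x ∈ G, ∀ X Y : 𝔤, x ⁅X, Y⁆ = ⁅x X, x Y⁆ := fun x hx X Y => hG.map_lie hx X Y
  subst hU
  -- Uniqueness of the Jordan projection removes the choice operator: on U, f is α of the chamber
  -- element found by any conjugation. Since U is open in G, this fixes the germs of f at points of
  -- U.
  have hf' : ∀ x ∈ G, ∀ z ∈ G, ∀ A ∈ chamber P, z * x * z⁻¹ = expAd ℝ (A : 𝔤) → f x = α A := by
    intro x hx z hz A hA hxz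
    have h1 := isJordanProjection_iff h hP hG hBinv hx hz hA hxz
    have h2 : IsJordanProjection G θ P x (jordanProjection G θ P x) :=
      Classical.epsilon_spec ⟨A, (h1 A).2 rfl⟩
    rw [hf x ⟨hx, z, hz, A, hA, hxz⟩, (h1 _).1 h2]
  have hlocal := fun x hx y hy A hA hxy => analyticAt_and_isGoldmanValue (x := x) (y := y) (A₀ := A)
    h hP hG.expAd_mem hlie hBinv hf' hx hy hA hxy
  obtain ⟨αv, hαv⟩ := h.exists_dual_vector α
  have hαv' := (hαv αv).2 rfl
  have hmem : ∀ A ∈ chamber P, expAd ℝ (A : 𝔤) ∈ purelyLoxodromic G P := fun A hA =>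
    ⟨hG.expAd_mem _, 1, G.one_mem, A, hA, by simp⟩
  have hanalytic : IsRealAnalyticOn (purelyLoxodromic G P) f := by
    rintro x ⟨hx, y, hy, A, hA, hxy⟩
    exact (hlocal x hx y hy A hA hxy).1
  have hconj : ∀ y z x : 𝔤 ≃ₗ[ℝ] 𝔤, z * y⁻¹ * (y * x * y⁻¹) * (z * y⁻¹)⁻¹ = z * x * z⁻¹ := by
    intro y z x
    group
  refine ⟨?_, ⟨?_, hanalytic⟩, ?_, ?_, exists_isLongest h hP hG hBinv, αv, hαv, ?_⟩
  · rintro x ⟨hx, y, hy, A, hA, hxy⟩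
    exact ⟨A, (isJordanProjection_iff h hP hG hBinv hx hy hA hxy A).2 rfl,
      fun A' hA' => (isJordanProjection_iff h hP hG hBinv hx hy hA hxy A').1 hA'⟩
  · refine ⟨?_, isOpenIn_purelyLoxodromic h hP hG.expAd_mem hlie hBinv, ?_,
      fun x hx => (hanalytic x hx).differentiableAt, ?_⟩
    · obtain ⟨A, hA⟩ := chamber_nonempty h hP
      exact ⟨_, hmem A hA⟩
    · rintro y hy x ⟨hx, z, hz, A, hA, hxz⟩
      exact ⟨G.mul_mem (G.mul_mem hy hx) (G.inv_mem hy), z * y⁻¹, G.mul_mem hz (G.inv_mem hy),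
        A, hA, by rw [hconj, hxz]⟩
    · rintro y hy x ⟨hx, z, hz, A, hA, hxz⟩
      rw [hf' x hx z hz A hA hxz, hf' (y * x * y⁻¹) (G.mul_mem (G.mul_mem hy hx) (G.inv_mem hy))
        (z * y⁻¹) (G.mul_mem hz (G.inv_mem hy)) A hA (by rw [hconj, hxz])]
  · rintro x ⟨hx, y, hy, A, hA, hxy⟩ k hk -
    have hkA : (k : ℝ) • A ∈ chamber P := fun β hβ => by
      rw [map_smul, smul_eq_mul]
      exact mul_pos (Nat.cast_pos.2 hk) (hA β hβ)
    rw [hf' x hx y hy A hA hxy, hf' (x ^ k) (G.pow_mem hx k) y hy _ hkA, map_smul, smul_eq_mul]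
    rw [← conj_pow, hxy, ← expAd_nsmul, Submodule.coe_smul, Nat.cast_smul_eq_nsmul]
  · rintro x ⟨hx, y, hy, A, hA, hxy⟩
    have h1 := (hlocal x hx y hy A hA hxy).2 αv hαv'
    exact ⟨_, h1, fun Z hZ => IsGoldmanValue.unique hθ hZ h1⟩
  · intro X hX
    refine ⟨⟨hmem X hX, ?_⟩, fun w₀ hw₀ => ?_⟩
    · have h1 := (hlocal _ (hG.expAd_mem (X : 𝔤)) 1 G.one_mem X hX (by simp)).2 αv hαv'
      rwa [inv_one] at h1
    · have hA := hw₀.neg_inv_mem_chamber h hP hG hBinv hX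
      obtain ⟨k, hk, hkw⟩ := hw₀.1
      have hkG := (analyticK_preserves hG hBinv hk).1
      -- A representative k of w₀ conjugates exp(-X) to exp(-w₀⁻¹X), whose exponent lies in the
      -- chamber.
      have hkA : k⁻¹ * (expAd ℝ (X : 𝔤))⁻¹ * k⁻¹⁻¹ = expAd ℝ ((-(w₀⁻¹ X) : 𝔞) : 𝔤) := by
        rw [← expAd_neg, conj_expAd (hlie _ (G.inv_mem hkG))]
        congr 1
        apply k.injective
        rw [apply_inv_apply, hkw, map_neg]
        have h2 : w₀ (w₀⁻¹ X) = X := LinearEquiv.apply_symm_apply w₀ X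
        rw [h2]
        rfl
      have hmem' := G.inv_mem (hG.expAd_mem (X : 𝔤))
      refine ⟨⟨hmem', k⁻¹, G.inv_mem hkG, _, hA, hkA⟩, ?_⟩
      -- The conjugator is k⁻¹, so the Goldman value is (k⁻¹)⁻¹ αv = k αv = w₀ αv.
      have h1 := (hlocal _ hmem' k⁻¹ (G.inv_mem hkG) _ hA hkA).2 αv hαv'
      rwa [inv_inv, hkw] at h1
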